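/- **Conventions.** $\lg=\log_2$. Let $\mathbb F$ be a field. An *ABP* of depth $D$ and width $\le r$ is a layered directed graph with layers $V_0=\{s\},V_1,\dots,V_D=\{t\}$, $|V_i|\le r$, whose edges go from $V_{i-1}$ to $V_i$ and are labelled by polynomials; it computes the sum over all $s$-$t$ paths of the product of the labels on the path. A *ROABP* on $x_1,\dots,x_N$ is an ABP of depth $N$ such that, for some permutation $\pi$ of $[N]$ (the variable order), every label between $V_{i-1}$ and $V_i$ is a univariate polynomial in $x_{\pi(i)}$. A *set-multilinear ABP* on $N=Dn$ variables, partitioned into sets $X_1,\dots,X_D$ of size $n$, is an ABP of depth $D$ in which every label between $V_{i-1}$ and $V_i$ is a homogeneous linear form in $X_i$. A set $\mathcal H\subseteq\mathbb F^N$ is a *hitting set* for a class $\mathcal C$ of $N$-variate polynomials if for all $f\in\mathcal C$: $f=0$ iff $f|_{\mathcal H}=0$. Computations are done by a fixed program (independent of the parameters and of $\mathbb F$) of a random access machine with integer registers (logarithmic cost) and $\mathbb F$-registers (unit-cost field operations, addresses at logarithmic cost), which also has access to a list $\xi_0,\xi_1,\dots$ of elements of $\mathbb F$, of which the first $\mathrm{poly}(N,d)$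 are distinct. A polynomial map is *$T$-explicit* if its value at a given point is computed in time $\le T$ from the parameters; a hitting set is *$T$-explicit* if each of its elements is computed in time $\le T$ from the parameters and the index of the element. Below, each $\mathrm{poly}(N,d)$ means $(Nd+1)^{O(1)}$, similarly for $\mathrm{poly}(N,d,r)$ and $\mathrm{poly}(N)$, and the implied constants are absolute; in exponents and seed lengths, $O(\lg r)$ and $O(\lg N)$ are read as $O(\lfloor\lg r\rfloor+1)$ and $O(\lfloor\lg N\rfloor+1)$. *Klivans-Spielman generator* with sparsity parameter $S\ge1$ and seed $t,s\in\mathbb F^m$. Let $p$ be the least prime $\ge (Nd)^3$ and $m=\lfloor\log_{Nd}S\rfloor+1$ (with $m=1$ if $Nd=1$). Let $\mathbb 1[z=\xi_k]$ be the Lagrange polynomial for the nodes $\xi_0,\dots,\xi_{p-1}$. For $i\in[N]$, $$\big(\mathcal G^{KS}_{N,d,S}(t,s)\big)_i=\prod_{j=1}^m\ \sum_{k=0}^{p-1}\mathbb 1[s_j=\xi_k]\;t_j^{\,k^i\bmod p}.$$ *Shpilka-Volkovich generator.* $\big(\mathcal G^{SV}_{N,\ell}(y,z)\big)_k=\sum_{j=1}^{\ell}\mathbb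 1[z_j=\xi_k]\,y_j$ for $k\in[N]$, with the Lagrange polynomials for the nodes $\xi_0,\dots,\xi_N$. **Theorem.** (a) Let $n\ge0$, $N=2^n$, $d,r\ge1$, $|\mathbb F|\ge\mathrm{poly}(N,d)$. Let $$\mathcal G'_{N,d,r}(u_1,t_1,s_1,\dots,u_n,t_n,s_n)=\sum_{i=1}^n u_i\cdot\mathcal G^{KS}_{N,d,N^{2d(\lfloor\lg r^2\rfloor+1)}}(t_i,s_i).$$ If $n\ge1$, each $t_i$ and $s_i$ has length $O(d\lg r\cdot\log_{Nd}N)$. Every coordinate of $\mathcal G'$ has individual degree $\le\mathrm{poly}(N,d)$, and $\mathcal G'$ is $\mathrm{poly}(N,d,r)$-explicit. For every $N$-variate $f$ of individual degree $<d$ computed by a ROABP of width $\le r$ in some variable order, $f\ne0$ iff $f\circ\big(\mathcal G'_{N,d,r}+\mathcal G^{SV}_{N,\lfloor\lg r^2\rfloor+1}\big)\neq0$, where the two generators use disjoint variables. (b) For all $N,d,r\ge1$ and $|\mathbb F|\ge\mathrm{poly}(N,d)$, the class of $N$-variate polynomials of individual degree $<d$ computed by ROABPs of width $\le r$, in any (unknown)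 variable order, has a $\mathrm{poly}(N,d,r)$-explicit hitting set of size $\le\mathrm{poly}(N,d)^{O(d\cdot\lg r\cdot\lg N)}$. (c) For all $N,r\ge1$ and $|\mathbb F|\ge\mathrm{poly}(N)$, the class of $N$-variate multilinear polynomials computed by ROABPs of width $\le r$ in any variable order, and the class of $N$-variate polynomials computed by set-multilinear ABPs of width $\le r$ for any (unknown) partition of the variables into sets of equal size, each have a $\mathrm{poly}(N,r)$-explicit hitting set of size $\le\mathrm{poly}(N)^{O(\lg r\cdot\lg N)}$. -/

import Mathlib

universe u

namespace PIT

/-! ### Algebraic branching programs -/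

/-- An algebraic branching program of depth `D` and width `≤ r` with edge weights in `R`
(for us `R = F[x₁,…,x_N]`). The layer `V_i` is `Fin (width i)`; `V_0` and `V_D` are singletons
(source and sink). `weight i u v` is the label of the edge from `u ∈ V_i` to `v ∈ V_{i+1}`,
a missing edge being one of weight `0`. -/
structure ABP (R : Type u) (D r : ℕ) where
  width : Fin (D + 1) → ℕ
  width_source : width 0 = 1
  width_sink : width (Fin.last D) = 1
  width_le : ∀ i, width i ≤ r
  weight : ∀ i : Fin D, Fin (width i.castSucc) → Fin (width i.succ) → R

/-- The polynomial computed by a branching program: the sum over all source-sink paths of the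
product of the labels on the path. -/
def ABP.value {R : Type u} [CommSemiring R] {D r : ℕ} (A : ABP R D r) : R :=
  ∑ p : (∀ i : Fin (D + 1), Fin (A.width i)),
    ∏ i : Fin D, A.weight i (p i.castSucc) (p i.succ)

/-- Read-once oblivious: the depth is the number of variables, and for some order `π` of the
variables every weight in the `i`-th step is a univariate polynomial in `x_{π(i)}`. -/
def ABP.IsReadOnceOblivious {F : Type u} [Field F] {N r : ℕ}
    (A : ABP (MvPolynomial (Fin N) F) N r) : Prop :=
  ∃ π : Equiv.Perm (Fin N), ∀ i a b, ∃ q : Polynomial F,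
    A.weight i a b = Polynomial.aeval (MvPolynomial.X (π i) : MvPolynomial (Fin N) F) q

/-- Set-multilinear: the `N = D * n` variables are partitioned, in some unknown way `σ`, into `D`
sets of size `n`, and every weight in the `i`-th step is a homogeneous linear form in the
`i`-th set. -/
def ABP.IsSetMultilinear {F : Type u} [Field F] {N D r : ℕ}
    (A : ABP (MvPolynomial (Fin N) F) D r) (n : ℕ) : Prop :=
  ∃ σ : Fin D × Fin n ≃ Fin N, ∀ i a b, ∃ coeff : Fin n → F,
    A.weight i a b = ∑ j, MvPolynomial.C (coeff j) * MvPolynomial.X (σ (i, j))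

/-- `N`-variate polynomials of individual degree `< d` that are computed by a read-once oblivious
branching program of width `≤ r` in some variable order. -/
def roabpClass (F : Type u) [Field F] (N d r : ℕ) : Set (MvPolynomial (Fin N) F) :=
  {f | (∀ i, f.degreeOf i < d) ∧
    ∃ A : ABP (MvPolynomial (Fin N) F) N r, A.IsReadOnceOblivious ∧ A.value = f}

/-- `N`-variate polynomials that are computed by a set-multilinear branching program of width
`≤ r`, for some partition of the variables into sets of equal size. -/
def smabpClass (F : Type u) [Field F] (N r : ℕ) : Set (MvPolynomial (Fin N) F) :=
  {f | ∃ (D n : ℕ) (A : ABP (MvPolynomial (Fin N) F) D r), A.IsSetMultilinear n ∧ A.value = f}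

/-- `H` is a hitting set for the class `C`. -/
def IsHittingSet {F : Type u} [Field F] {N : ℕ} (C : Set (MvPolynomial (Fin N) F))
    (H : Set (Fin N → F)) : Prop :=
  ∀ f ∈ C, f = 0 ↔ ∀ x ∈ H, MvPolynomial.eval x f = 0

/-! ### The generators

Throughout, `ξ 0, ξ 1, …` is a list of elements of `F`, of which sufficiently many initial ones are
distinct; they are the interpolation nodes. -/

/-- The polynomial `1[z = ξ k]` in `z`, for the nodes `ξ 0, …, ξ (K - 1)`, as a polynomial in the
variable `v`. -/
noncomputable def nodeIndicator {F : Type u} [Field F] {V : Type} (ξ : ℕ → F) (K k : ℕ) (v : V) :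
    MvPolynomial V F :=
  Polynomial.aeval (MvPolynomial.X v : MvPolynomial V F) (Lagrange.basis (Finset.range K) ξ k)

/-- The Shpilka-Volkovich generator with `N` outputs: its `k`-th coordinate (counted from `1`) is
`∑ j, 1[z_j = ξ k] * y_j`, with nodes `ξ 0, …, ξ N`. The variable `y_j` is `inl j`, and `z_j` is
`inr j`. -/
noncomputable def svGen {F : Type u} [Field F] (ξ : ℕ → F) (N l : ℕ) (k : Fin N) :
    MvPolynomial (Fin l ⊕ Fin l) F :=
  ∑ j : Fin l, nodeIndicator ξ (N + 1) ((k : ℕ) + 1) (Sum.inr j) * MvPolynomial.X (Sum.inl j)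

/-- The modulus of the Klivans-Spielman generator: the least prime `≥ (N d)^3`. -/
def ksPrime (N d : ℕ) : ℕ := Nat.find (Nat.exists_infinite_primes ((N * d) ^ 3))

/-- The seed length `m = ⌊log_{N d} s⌋ + 1` of the Klivans-Spielman generator. -/
def ksSeed (N d s : ℕ) : ℕ := Nat.log (N * d) s + 1

/-- The Klivans-Spielman generator for `N` variables, individual degree `< d` and sparsity `s`.
With `p` the modulus and `m` the seed length, setting `s_j = ξ (k_j)`, `k_j < p`, gives the
substitution `x_i ↦ ∏_{j < m} t_j ^ (k_j ^ i mod p)` for `i = 1, …, N`; these are interpolated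
through the values of the `s_j`. The variable `t_j` is `inl j`, and `s_j` is `inr j`. -/
noncomputable def ksGen {F : Type u} [Field F] (ξ : ℕ → F) (N d s : ℕ) (i : Fin N) :
    MvPolynomial (Fin (ksSeed N d s) ⊕ Fin (ksSeed N d s)) F :=
  ∏ j : Fin (ksSeed N d s), ∑ k ∈ Finset.range (ksPrime N d),
    nodeIndicator ξ (ksPrime N d) k (Sum.inr j) *
      MvPolynomial.X (Sum.inl j) ^ (k ^ ((i : ℕ) + 1) % ksPrime N d)

/-- The support bound `⌊lg r²⌋ + 1`. -/
def supp (r : ℕ) : ℕ := Nat.log 2 (r ^ 2) + 1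

/-- The sparsity `N^{2d(⌊lg r²⌋+1)}`, for `N = 2^n`. -/
def mainSparsity (n d r : ℕ) : ℕ := (2 ^ n) ^ (2 * d * supp r)

/-- The length `m` of each of the vectors `t_i`, `s_i`. -/
def mainSeed (n d r : ℕ) : ℕ := ksSeed (2 ^ n) d (mainSparsity n d r)

/-- The variables of the main generator: `(i, none)` is `u_i`, `(i, some (inl j))` is the `j`-th
entry of `t_i`, and `(i, some (inr j))` is the `j`-th entry of `s_i`. -/
abbrev MainVar (n d r : ℕ) : Type :=
  Fin n × Option (Fin (mainSeed n d r) ⊕ Fin (mainSeed n d r))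

/-- The polynomial map `G' = ∑ i, u_i * G^KS(t_i, s_i)` into `F^N`, `N = 2^n`. -/
noncomputable def mainGen {F : Type u} [Field F] (ξ : ℕ → F) (n d r : ℕ) (k : Fin (2 ^ n)) :
    MvPolynomial (MainVar n d r) F :=
  ∑ i : Fin n, MvPolynomial.X (i, none) *
    MvPolynomial.rename (fun v => (i, some v)) (ksGen ξ (2 ^ n) d (mainSparsity n d r) k)

/-- The polynomial map `G' + G^SV`, the two summands on disjoint sets of variables. -/
noncomputable def fullGen {F : Type u} [Field F] (ξ : ℕ → F) (n d r : ℕ) (k : Fin (2 ^ n)) :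
    MvPolynomial (MainVar n d r ⊕ (Fin (supp r) ⊕ Fin (supp r))) F :=
  MvPolynomial.rename Sum.inl (mainGen ξ n d r k) +
    MvPolynomial.rename Sum.inr (svGen ξ (2 ^ n) (supp r) k)

/-! ### The machine model

A random access machine over `F` with a memory of natural numbers and a memory of field elements.
Operations on natural numbers are charged by the bit lengths of their operands (logarithmic cost),
and operations on field elements cost one unit, plus the bit lengths of the addresses involved.
Besides the field operations the machine can obtain the `k`-th element of the list `ξ`.
It cannot test field elements. Programs do not depend on `F` or on `ξ`. -/

structure State (F : Type u) where
  nat : ℕ → ℕ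
  fld : ℕ → F

/-- Basic instructions. A cell of the memory of natural numbers is addressed directly, except in
`load` and `store`. A cell of the field memory is addressed by the content of a cell of the
memory of natural numbers. -/
inductive Instr where
  | const (dst k : ℕ)
  | add (dst a b : ℕ)
  | sub (dst a b : ℕ)
  | mul (dst a b : ℕ)
  | div (dst a b : ℕ)
  | mod (dst a b : ℕ)
  | load (dst a : ℕ)
  | store (a b : ℕ)
  | fzero (dst : ℕ)
  | fone (dst : ℕ)
  | fnode (dst a : ℕ)
  | fadd (dst a b : ℕ)
  | fsub (dst a b : ℕ)
  | fmul (dst a b : ℕ)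
  | finv (dst a : ℕ)

def State.setNat {F : Type u} (σ : State F) (a v : ℕ) : State F :=
  ⟨Function.update σ.nat a v, σ.fld⟩

def State.setFld {F : Type u} (σ : State F) (a : ℕ) (v : F) : State F :=
  ⟨σ.nat, Function.update σ.fld a v⟩

/-- The effect of an instruction. Subtraction on natural numbers is truncated, division is with
remainder. -/
def Instr.step {F : Type u} [Field F] (ξ : ℕ → F) : Instr → State F → State F
  | .const dst k, σ => σ.setNat dst k
  | .add dst a b, σ => σ.setNat dst (σ.nat a + σ.nat b)
  | .sub dst a b, σ => σ.setNat dst (σ.nat a - σ.nat b)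
  | .mul dst a b, σ => σ.setNat dst (σ.nat a * σ.nat b)
  | .div dst a b, σ => σ.setNat dst (σ.nat a / σ.nat b)
  | .mod dst a b, σ => σ.setNat dst (σ.nat a % σ.nat b)
  | .load dst a, σ => σ.setNat dst (σ.nat (σ.nat a))
  | .store a b, σ => σ.setNat (σ.nat a) (σ.nat b)
  | .fzero dst, σ => σ.setFld (σ.nat dst) 0
  | .fone dst, σ => σ.setFld (σ.nat dst) 1
  | .fnode dst a, σ => σ.setFld (σ.nat dst) (ξ (σ.nat a))
  | .fadd dst a b, σ => σ.setFld (σ.nat dst) (σ.fld (σ.nat a) + σ.fld (σ.nat b))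
  | .fsub dst a b, σ => σ.setFld (σ.nat dst) (σ.fld (σ.nat a) - σ.fld (σ.nat b))
  | .fmul dst a b, σ => σ.setFld (σ.nat dst) (σ.fld (σ.nat a) * σ.fld (σ.nat b))
  | .finv dst a, σ => σ.setFld (σ.nat dst) (σ.fld (σ.nat a))⁻¹

/-- The cost of an instruction in a given state. -/
def Instr.cost {F : Type u} : Instr → State F → ℕ
  | .const _ k, _ => 1 + k.size
  | .add _ a b, σ => 1 + (σ.nat a).size + (σ.nat b).size
  | .sub _ a b, σ => 1 + (σ.nat a).size + (σ.nat b).size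
  | .mul _ a b, σ => 1 + (σ.nat a).size + (σ.nat b).size
  | .div _ a b, σ => 1 + (σ.nat a).size + (σ.nat b).size
  | .mod _ a b, σ => 1 + (σ.nat a).size + (σ.nat b).size
  | .load _ a, σ => 1 + (σ.nat a).size + (σ.nat (σ.nat a)).size
  | .store a b, σ => 1 + (σ.nat a).size + (σ.nat b).size
  | .fzero dst, σ => 1 + (σ.nat dst).size
  | .fone dst, σ => 1 + (σ.nat dst).size
  | .fnode dst a, σ => 1 + (σ.nat dst).size + (σ.nat a).size
  | .fadd dst a b, σ => 1 + (σ.nat dst).size + (σ.nat a).size + (σ.nat b).size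
  | .fsub dst a b, σ => 1 + (σ.nat dst).size + (σ.nat a).size + (σ.nat b).size
  | .fmul dst a b, σ => 1 + (σ.nat dst).size + (σ.nat a).size + (σ.nat b).size
  | .finv dst a, σ => 1 + (σ.nat dst).size + (σ.nat a).size

/-- Programs. `branch a P Q` runs `P` if cell `a` is nonzero, else `Q`; `loop a P` runs `P` as long
as cell `a` is nonzero. -/
inductive Prog where
  | instr (I : Instr)
  | seq (P Q : Prog)
  | branch (a : ℕ) (P Q : Prog)
  | loop (a : ℕ) (P : Prog)

/-- `Exec ξ P σ τ t`: started in state `σ`, the program `P` halts in state `τ` after time `t`. -/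
inductive Exec {F : Type u} [Field F] (ξ : ℕ → F) : Prog → State F → State F → ℕ → Prop
  | instr (I : Instr) (σ : State F) : Exec ξ (.instr I) σ (I.step ξ σ) (I.cost σ)
  | seq {P Q : Prog} {σ τ ρ : State F} {t t' : ℕ} :
      Exec ξ P σ τ t → Exec ξ Q τ ρ t' → Exec ξ (.seq P Q) σ ρ (t + t')
  | branch_pos {a : ℕ} {P Q : Prog} {σ τ : State F} {t : ℕ} :
      σ.nat a ≠ 0 → Exec ξ P σ τ t → Exec ξ (.branch a P Q) σ τ (1 + (σ.nat a).size + t)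
  | branch_zero {a : ℕ} {P Q : Prog} {σ τ : State F} {t : ℕ} :
      σ.nat a = 0 → Exec ξ Q σ τ t → Exec ξ (.branch a P Q) σ τ (1 + t)
  | loop_pos {a : ℕ} {P : Prog} {σ τ ρ : State F} {t t' : ℕ} :
      σ.nat a ≠ 0 → Exec ξ P σ τ t → Exec ξ (.loop a P) τ ρ t' →
        Exec ξ (.loop a P) σ ρ (1 + (σ.nat a).size + t + t')
  | loop_zero {a : ℕ} {P : Prog} {σ : State F} :
      σ.nat a = 0 → Exec ξ (.loop a P) σ σ 1

/-- With the list `input` in the first cells of the memory of natural numbers (all others being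
`0`) and with field memory `w`, the program `P` halts within time `T`, and then the first `N`
cells of the field memory hold the vector `out`. -/
def Prog.Outputs {F : Type u} [Field F] (P : Prog) (ξ : ℕ → F) (input : List ℕ) (w : ℕ → F)
    {N : ℕ} (out : Fin N → F) (T : ℕ) : Prop :=
  ∃ (τ : State F) (t : ℕ), Exec ξ P ⟨fun k => input.getD k 0, w⟩ τ t ∧ t ≤ T ∧
    ∀ k : Fin N, τ.fld k = out k

/-- The position in the field memory at which the value of a variable of the main generator is
given: `u_1, t_1, s_1, u_2, t_2, s_2, …` one after the other. -/
def mainPos (n d r : ℕ) : MainVar n d r → ℕ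
  | (i, none) => i * (2 * mainSeed n d r + 1)
  | (i, some (Sum.inl j)) => i * (2 * mainSeed n d r + 1) + 1 + j
  | (i, some (Sum.inr j)) => i * (2 * mainSeed n d r + 1) + 1 + mainSeed n d r + j

/-- The class `C` has a hitting set of size at most `S`, whose elements `P` computes within
time `T` from the parameters `input` and the index of the element. -/
def HasExplicitHittingSet {F : Type u} [Field F] (P : Prog) (ξ : ℕ → F) (input : List ℕ)
    {N : ℕ} (C : Set (MvPolynomial (Fin N) F)) (S T : ℕ) : Prop :=
  ∃ (s : ℕ) (h : Fin s → Fin N → F), s ≤ S ∧ IsHittingSet C (Set.range h) ∧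
    ∀ i : Fin s, P.Outputs ξ (input ++ [(i : ℕ)]) (fun _ => 0) (h i) T

end PIT

/-! The generator works by rank concentration with merging and shifting. A polynomial of the class
is a bilinear form of a product of matrices over the polynomial ring, each factor univariate in its
own variable. The product is expanded into coefficient matrices indexed by exponent vectors. If the
coefficients of small support control all others (`Conc`), then a nonzero polynomial keeps a nonzero
coefficient of small support, so all but a few variables can be set to zero.

Concentration is produced by shifting. Let `W` be a weight that separates the monomials of bounded
degree and puts lower degrees first (`Isolating`). By `Conc.shift`, the shift of each variable `x_w`
by `X ^ W w`, with `X` fresh, improves concentration on supports of size `M` to supports of size `lg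
r²`, where `r²` is the dimension of the matrix space. The lowest-order terms belong to linearly
independent coefficient matrices, so there are at most `r²` of them, and `exists_small_support`
finds a monomial of logarithmic support that survives. In `exists_conc` a product of `2 ^ (j + 1)`
factors is cut into halves. Both are concentrated under the same earlier shifts, the product is
concentrated on doubled supports (`Conc.append`), and one new shift restores the bound. Thus `n`
shifts suffice for `2 ^ n` variables. Since `W` isolates on every subset of the variables in every
arrangement (`Isolating.comp`), the variable order is never needed.

The weight comes from the Klivans-Spielman exponents: a root count modulo a prime plus a union bound
(`exists_ks_injOn`) separates the relevant monomials by `m`-tuples, and base-`t` digits merge these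
into one integer. A large constant `E` gives the degree priority; the factor `u_i` of the generator
realizes `E`. The Shpilka-Volkovich summand supplies the few variables that are not set to zero.
Together this is `bind₁_fullGen_ne_zero`. A grid of seeds, of side larger than every individual
degree of the composition, gives the hitting set (`isHittingSet`). Set-multilinear programs of width
`r` are rewritten as products of univariate matrices of size `2 * r` (`smabpClass_subset`).

Explicitness is proved by a small compiler: `NatC` and `FldC` say that a number or a field element
is computable in polynomial time by a program fixed in advance, and they are closed under
arithmetic, bounded sums, products and case distinction. The parameters (`Nat.log`, `Nat.clog`,
`ksPrime`) are rewritten as such expressions. -/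

namespace PIT
open Finset

/-! ### Polynomially bounded functions -/

/-- `f` is bounded by a fixed power of `X`. -/
def PB {α : Type} (X f : α → ℕ) : Prop := ∃ c : ℕ, ∀ x, f x ≤ X x ^ c

section PB
variable {α : Type} {X f g : α → ℕ}

theorem PB.mono (hg : PB X g) (h : ∀ x, f x ≤ g x) : PB X f :=
  hg.imp fun _ hc x => (h x).trans (hc x)

theorem PB.self : PB X X := ⟨1, fun x => by simp⟩

theorem PB.comp {β : Type} (hf : PB X f) (h : β → α) : PB (fun y => X (h y)) (fun y => f (h y)) :=
  hf.imp fun _ hc y => hc (h y)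

theorem PB.mul (hf : PB X f) (hg : PB X g) : PB X (fun x => f x * g x) := by
  obtain ⟨a, ha⟩ := hf
  obtain ⟨b, hb⟩ := hg
  exact ⟨a + b, fun x => by rw [pow_add]; exact Nat.mul_le_mul (ha x) (hb x)⟩

theorem PB.pow (hf : PB X f) (k : ℕ) : PB X (fun x => f x ^ k) := by
  obtain ⟨a, ha⟩ := hf
  exact ⟨a * k, fun x => by rw [pow_mul]; exact Nat.pow_le_pow_left (ha x) k⟩

variable (hX : ∀ x, 2 ≤ X x)
include hX

theorem PB.const (k : ℕ) : PB X (fun _ => k) :=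
  ⟨k, fun x => (Nat.lt_two_pow_self).le.trans (Nat.pow_le_pow_left (hX x) k)⟩

theorem PB.add (hf : PB X f) (hg : PB X g) : PB X (fun x => f x + g x) := by
  obtain ⟨a, ha⟩ := hf
  obtain ⟨b, hb⟩ := hg
  refine ⟨a + b + 1, fun x => ?_⟩
  have h1 : 1 ≤ X x := le_trans (by norm_num) (hX x)
  have h2 : X x ^ a ≤ X x ^ (a + b) := Nat.pow_le_pow_right h1 (by omega)
  have h3 : X x ^ b ≤ X x ^ (a + b) := Nat.pow_le_pow_right h1 (by omega)
  calc f x + g x ≤ X x ^ (a + b) * 2 := by linarith [ha x, hb x]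
    _ ≤ X x ^ (a + b) * X x := Nat.mul_le_mul_left _ (hX x)
    _ = _ := (pow_succ _ _).symm

end PB

theorem PB.size {α : Type} {X f : α → ℕ} (hf : PB X f) : PB X (fun x => (f x).size) :=
  hf.mono fun x => by rw [Nat.size_le]; exact Nat.lt_two_pow_self

theorem size_add_le (a b : ℕ) : (a + b).size ≤ a.size + b.size + 1 := by
  rw [Nat.size_le]
  have ha := Nat.lt_size_self a
  have hb := Nat.lt_size_self b
  have h1 : 2 ^ a.size ≤ 2 ^ (a.size + b.size) := Nat.pow_le_pow_right (by norm_num) (by omega)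
  have h2 : 2 ^ b.size ≤ 2 ^ (a.size + b.size) := Nat.pow_le_pow_right (by norm_num) (by omega)
  rw [pow_succ]; omega

theorem size_mul_le (a b : ℕ) : (a * b).size ≤ a.size + b.size := by
  rw [Nat.size_le, pow_add]
  exact Nat.mul_lt_mul'' (Nat.lt_size_self a) (Nat.lt_size_self b)

theorem size_sum_le {g : ℕ → ℕ} {B : ℕ} (n : ℕ) (h : ∀ i < n, (g i).size ≤ B) :
    (∑ i ∈ range n, g i).size ≤ n * (B + 1) := by
  induction n with
  | zero => simp
  | succ n ih =>
    have hh : ∑ i ∈ range (n + 1), g i < 2 ^ ((n + 1) * (B + 1)) := by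
      rw [sum_range_succ]
      have h1 := ih fun i hi => h i (by omega)
      rw [Nat.size_le] at h1
      have h2 : g n < 2 ^ B := Nat.size_le.1 (h n (by omega))
      have h3 : 2 ^ (n * (B + 1)) ≤ 2 ^ (n * (B + 1) + B) :=
        Nat.pow_le_pow_right (by norm_num) (by omega)
      have h4 : 2 ^ B ≤ 2 ^ (n * (B + 1) + B) := Nat.pow_le_pow_right (by norm_num) (by omega)
      have : (n + 1) * (B + 1) = n * (B + 1) + B + 1 := by ring
      rw [this, pow_succ]; omega
    exact Nat.size_le.2 hh

theorem size_prod_le {g : ℕ → ℕ} {B : ℕ} (n : ℕ) (h : ∀ i < n, (g i).size ≤ B) :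
    (∏ i ∈ range n, g i).size ≤ n * B + 1 := by
  induction n with
  | zero => simp
  | succ n ih =>
    rw [prod_range_succ]
    have h1 := size_mul_le (∏ i ∈ range n, g i) (g n)
    have h2 := ih fun i hi => h i (by omega)
    have h3 := h n (by omega)
    have : (n + 1) * B = n * B + B := by ring
    omega

/-! ### Total correctness with time bounds -/

section Runs
variable {F : Type u} [Field F] {ξ : ℕ → F}

/-- Started in `σ`, the program `P` halts within time `T`, in a state satisfying `Q`. -/
def Runs (ξ : ℕ → F) (P : Prog) (σ : State F) (T : ℕ) (Q : State F → Prop) : Prop :=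
  ∃ τ t, Exec ξ P σ τ t ∧ t ≤ T ∧ Q τ

theorem Runs.mono {P : Prog} {σ : State F} {T T' : ℕ} {Q Q' : State F → Prop}
    (h : Runs ξ P σ T Q) (hT : T ≤ T') (hQ : ∀ τ, Q τ → Q' τ) : Runs ξ P σ T' Q' := by
  obtain ⟨τ, t, h1, h2, h3⟩ := h
  exact ⟨τ, t, h1, h2.trans hT, hQ τ h3⟩

theorem Runs.seq {P P' : Prog} {σ : State F} {T T' : ℕ} {Q Q' : State F → Prop}
    (h : Runs ξ P σ T Q) (h' : ∀ τ, Q τ → Runs ξ P' τ T' Q') :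
    Runs ξ (.seq P P') σ (T + T') Q' := by
  obtain ⟨τ, t, h1, h2, h3⟩ := h
  obtain ⟨ρ, t', h1', h2', h3'⟩ := h' τ h3
  exact ⟨ρ, t + t', .seq h1 h1', add_le_add h2 h2', h3'⟩

theorem Runs.instr {I : Instr} {σ : State F} {T : ℕ} {Q : State F → Prop}
    (hT : I.cost σ ≤ T) (hQ : Q (I.step ξ σ)) : Runs ξ (.instr I) σ T Q :=
  ⟨_, _, .instr I σ, hT, hQ⟩

theorem Runs.loop {P : Prog} {a : ℕ} (I : ℕ → State F → Prop) {n T : ℕ} {σ : State F}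
    (h0 : I 0 σ) (hI : ∀ i ≤ n, ∀ σ, I i σ → σ.nat a = n - i)
    (h : ∀ i < n, ∀ σ, I i σ → Runs ξ P σ T (I (i + 1))) :
    Runs ξ (.loop a P) σ (n * (1 + n.size + T) + 1) (I n) := by
  -- Induction on the number `k` of rounds that remain, which is what the counter cell holds.
  have key : ∀ k, k ≤ n → ∀ σ, I (n - k) σ →
      Runs ξ (.loop a P) σ (k * (1 + n.size + T) + 1) (I n) := by
    intro k
    induction k with
    | zero =>
      intro _ σ hσ
      have := hI n le_rfl σ hσ
      exact ⟨σ, 1, .loop_zero (by omega), by omega, hσ⟩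
    | succ k ih =>
      intro hk σ hσ
      obtain ⟨τ, t, h1, h2, h3⟩ := h (n - (k + 1)) (by omega) σ hσ
      rw [show n - (k + 1) + 1 = n - k by omega] at h3
      obtain ⟨ρ, t', h1', h2', h3'⟩ := ih (by omega) τ h3
      have hs := hI _ (by omega) σ hσ
      refine ⟨ρ, _, .loop_pos (by omega) h1 h1', ?_, h3'⟩
      have : (σ.nat a).size ≤ n.size := Nat.size_le_size (by omega)
      have : (k + 1) * (1 + n.size + T) = k * (1 + n.size + T) + (1 + n.size + T) := by ring
      omega
  exact key n le_rfl σ (by simpa using h0)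

/-- With the number of rounds in cell `b`, repeat `P` while cell `b + 1` holds the number of the
round. Cell `b + 2` is scratch. -/
def Prog.for (b : ℕ) (P : Prog) : Prog :=
  .seq (.instr (.const (b + 1) 0)) (.loop b (.seq P (.seq (.instr (.const (b + 2) 1))
    (.seq (.instr (.add (b + 1) (b + 1) (b + 2))) (.instr (.sub b b (b + 2)))))))

/-- The hypothesis `hI` makes the invariant insensitive to the three control cells of the loop. The
bookkeeping instructions, which change only these cells, therefore preserve it. -/
theorem Runs.for {P : Prog} {b : ℕ} (I : ℕ → State F → Prop) {n T : ℕ} {σ : State F}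
    (hn : σ.nat b = n)
    (hI : ∀ i, ∀ σ τ, I i σ → τ.fld = σ.fld →
      (∀ j, j ≠ b → j ≠ b + 1 → j ≠ b + 2 → τ.nat j = σ.nat j) → I i τ)
    (h0 : I 0 σ)
    (h : ∀ i < n, ∀ σ, I i σ → σ.nat (b + 1) = i →
      Runs ξ P σ T (fun τ => I (i + 1) τ ∧ τ.nat b = σ.nat b ∧ τ.nat (b + 1) = i)) :
    Runs ξ (Prog.for b P) σ (n * (7 + 3 * n.size + T) + 2) (I n) := by
  have h2 : Runs ξ (.instr (.const (b + 1) 0)) σ 1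
      (fun τ => I 0 τ ∧ τ.nat b = n ∧ τ.nat (b + 1) = 0) := by
    refine Runs.instr (by simp [Instr.cost]) ⟨?_, ?_, ?_⟩
    · refine hI 0 σ _ h0 rfl fun j h1 h2 h3 => ?_
      simp [Instr.step, State.setNat, Function.update_of_ne h2]
    · simp [Instr.step, State.setNat, hn]
    · simp [Instr.step, State.setNat]
  refine (h2.seq (T' := n * (1 + n.size + (T + (2 + ((2 + n.size) + (2 + n.size))))) + 1)
    (Q' := I n) fun τ hτ => ?_).mono ?_ fun _ h => h
  · refine (Runs.loop (fun i σ => I i σ ∧ σ.nat b = n - i ∧ σ.nat (b + 1) = i) ⟨hτ.1, by simpa using hτ.2.1, hτ.2.2⟩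
      (fun i _ σ h => h.2.1) ?_).mono le_rfl fun _ h => h.1
    rintro i hi σ ⟨hσ1, hσ2, hσ3⟩
    refine (h i hi σ hσ1 hσ3).seq fun τ hτ => ?_
    refine Runs.seq (Q := fun ρ => I (i + 1) ρ ∧ ρ.nat b = n - i ∧ ρ.nat (b + 1) = i ∧
      ρ.nat (b + 2) = 1) (Runs.instr (by simp [Instr.cost]) ⟨?_, ?_, ?_, ?_⟩) fun ρ hρ => ?_
    · refine hI (i + 1) τ _ hτ.1 rfl fun j h1 h2 h3 => ?_
      simp [Instr.step, State.setNat, Function.update_of_ne h3]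
    · simp [Instr.step, State.setNat, hτ.2.1, hσ2]
    · simp [Instr.step, State.setNat, hτ.2.2]
    · simp [Instr.step, State.setNat]
    refine Runs.seq (Q := fun ρ => I (i + 1) ρ ∧ ρ.nat b = n - i ∧ ρ.nat (b + 1) = i + 1 ∧
      ρ.nat (b + 2) = 1) (Runs.instr ?_ ⟨?_, ?_, ?_, ?_⟩) fun ρ' hρ' => ?_
    · have : i.size ≤ n.size := Nat.size_le_size (by omega)
      simp only [Instr.cost, hρ.2.2.1, hρ.2.2.2, Nat.size_one]; omega
    · refine hI (i + 1) ρ _ hρ.1 rfl fun j h1 h2 h3 => ?_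
      simp [Instr.step, State.setNat, Function.update_of_ne h2]
    · simp [Instr.step, State.setNat, hρ]
    · simp [Instr.step, State.setNat, hρ]
    · simp [Instr.step, State.setNat, hρ]
    refine Runs.instr ?_ ⟨?_, ?_, ?_⟩
    · have : (n - i).size ≤ n.size := Nat.size_le_size (by omega)
      simp only [Instr.cost, hρ'.2.1, hρ'.2.2.2, Nat.size_one]; omega
    · refine hI (i + 1) ρ' _ hρ'.1 rfl fun j h1 h2 h3 => ?_
      simp [Instr.step, State.setNat, Function.update_of_ne h1]
    · simp [Instr.step, State.setNat, hρ', Nat.sub_sub]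
    · simp [Instr.step, State.setNat, hρ']
  · have : 1 + n.size + (T + (2 + ((2 + n.size) + (2 + n.size)))) = 7 + 3 * n.size + T := by ring
    rw [this]; omega

end Runs

/-! ### Polynomial-time functions into the natural numbers -/

/-- The function `f` of the situation `x` is computable in time polynomial in `X x`, from the values
of the functions in `Γ`: for every choice of cells `loc g < b` containing the values of the `g ∈ Γ`,
some program writes `f x` into cell `b` and changes neither the cells before `b` nor the field
memory. -/
def NatC {α : Type} (X : α → ℕ) (Γ : Set (α → ℕ)) (f : α → ℕ) : Prop :=
  PB X (fun x => (f x).size) ∧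
  ∀ (loc : (α → ℕ) → ℕ) (b : ℕ), (∀ g ∈ Γ, loc g < b) → ∃ (P : Prog) (T : α → ℕ), PB X T ∧
    ∀ (F : Type u) [Field F] (ξ : ℕ → F) (x : α) (σ : State F),
      (∀ g ∈ Γ, σ.nat (loc g) = g x) →
      Runs ξ P σ (T x) fun τ => τ.nat b = f x ∧ (∀ j < b, τ.nat j = σ.nat j) ∧ τ.fld = σ.fld

/-- The context for the body of a loop with `n` rounds: the index of the round is available, too. -/
def loopCtx {α : Type} (Γ : Set (α → ℕ)) (n : α → ℕ) : Set ((x : α) × Fin (n x) → ℕ) :=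
  insert (fun q => (q.2 : ℕ)) ((fun g q => g q.1) '' Γ)

section NatC
variable {α : Type} {X : α → ℕ} {Γ : Set (α → ℕ)} {f g : α → ℕ}

theorem NatC.comap {β : Type} {Δ : Set (β → ℕ)} (h : β → α) (hf : NatC.{u} X Γ f)
    (hΔ : ∀ g ∈ Γ, (fun y => g (h y)) ∈ Δ) : NatC.{u} (fun y => X (h y)) Δ (fun y => f (h y)) := by
  refine ⟨hf.1.comp h, fun loc b hb => ?_⟩
  obtain ⟨P, T, hT, hP⟩ := hf.2 (fun g => loc fun y => g (h y)) b fun g hg => hb _ (hΔ g hg)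
  exact ⟨P, _, hT.comp h, fun F _ ξ y σ hσ => hP F ξ (h y) σ fun g hg => hσ _ (hΔ g hg)⟩

theorem NatC.weaken {Δ : Set (α → ℕ)} (hf : NatC.{u} X Γ f) (hΔ : Γ ⊆ Δ) : NatC.{u} X Δ f :=
  hf.comap id hΔ

theorem NatC.lift {n : α → ℕ} (hf : NatC.{u} X Γ f) :
    NatC.{u} (fun q => X q.1) (loopCtx Γ n) (fun q => f q.1) :=
  hf.comap Sigma.fst fun g hg => Or.inr ⟨g, hg, rfl⟩

variable (hX : ∀ x, 2 ≤ X x)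
include hX

theorem NatC.const (k : ℕ) : NatC.{u} X Γ (fun _ => k) := by
  refine ⟨PB.const hX _, fun loc b hb => ⟨.instr (.const b k), fun _ => 1 + k.size, PB.const hX _,
    fun F _ ξ x σ hσ => Runs.instr le_rfl ⟨?_, fun j hj => ?_, rfl⟩⟩⟩
  · simp [Instr.step, State.setNat]
  · simp [Instr.step, State.setNat, Function.update_of_ne hj.ne]

theorem NatC.var (hg : g ∈ Γ) (hs : PB X (fun x => (g x).size)) : NatC.{u} X Γ g := by
  refine ⟨hs, fun loc b hb => ⟨.seq (.instr (.const b 0)) (.instr (.add b (loc g) b)),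
    fun x => 1 + (1 + (g x).size), (PB.const hX _).add hX ((PB.const hX _).add hX hs),
    fun F _ ξ x σ hσ => ?_⟩⟩
  have hl := hb g hg
  refine Runs.seq (Q := fun τ => τ.nat b = 0 ∧ (∀ j < b, τ.nat j = σ.nat j) ∧ τ.fld = σ.fld)
    (Runs.instr (by simp [Instr.cost]) ⟨?_, fun j hj => ?_, rfl⟩) fun τ hτ => Runs.instr ?_ ⟨?_, fun j hj => ?_, hτ.2.2⟩
  · simp [Instr.step, State.setNat]
  · simp [Instr.step, State.setNat, Function.update_of_ne hj.ne]
  · simp [Instr.cost, hτ.1, hτ.2.1 _ hl, hσ g hg]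
  · simp [Instr.step, State.setNat, hτ.1, hτ.2.1 _ hl, hσ g hg]
  · simp [Instr.step, State.setNat, Function.update_of_ne hj.ne, hτ.2.1 j hj]

/-- The second operand is computed in cell `b + 1`, so the first one survives in cell `b`, where the
result replaces it. -/
theorem NatC.binop (I : ℕ → ℕ → ℕ → Instr) (op : ℕ → ℕ → ℕ)
    (hstep : ∀ {F : Type u} [Field F] (ξ : ℕ → F) (c a b : ℕ) (σ : State F),
      (I c a b).step ξ σ = σ.setNat c (op (σ.nat a) (σ.nat b)))
    (hcost : ∀ {F : Type u} (c a b : ℕ) (σ : State F),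
      (I c a b).cost σ = 1 + (σ.nat a).size + (σ.nat b).size)
    (hf : NatC.{u} X Γ f) (hg : NatC.{u} X Γ g) (hs : PB X (fun x => (op (f x) (g x)).size)) :
    NatC.{u} X Γ (fun x => op (f x) (g x)) := by
  refine ⟨hs, fun loc b hb => ?_⟩
  obtain ⟨P, T, hT, hP⟩ := hf.2 loc b hb
  obtain ⟨P', T', hT', hP'⟩ := hg.2 loc (b + 1) fun g hg => (hb g hg).trans (Nat.lt_succ_self b)
  refine ⟨.seq P (.seq P' (.instr (I b b (b + 1)))),
    fun x => T x + (T' x + (1 + (f x).size + (g x).size)),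
    hT.add hX (hT'.add hX (((PB.const hX _).add hX hf.1).add hX hg.1)), fun F _ ξ x σ hσ => ?_⟩
  refine (hP F ξ x σ hσ).seq fun τ hτ => (hP' F ξ x τ fun g hg => ?_).seq fun ρ hρ =>
    Runs.instr ?_ ⟨?_, fun j hj => ?_, ?_⟩
  · rw [hτ.2.1 _ (hb g hg), hσ g hg]
  · rw [hcost, hρ.1, hρ.2.1 b (by omega), hτ.1]
  · simp [hstep, State.setNat, hρ.1, hρ.2.1 b (by omega), hτ.1]
  · simp [hstep, State.setNat, Function.update_of_ne hj.ne, hρ.2.1 j (by omega), hτ.2.1 j hj]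
  · simp [hstep, State.setNat, hρ.2.2, hτ.2.2]

theorem NatC.add (hf : NatC.{u} X Γ f) (hg : NatC.{u} X Γ g) : NatC.{u} X Γ (fun x => f x + g x) :=
  NatC.binop hX .add (· + ·) (fun _ _ _ _ _ => rfl) (fun _ _ _ _ => rfl) hf hg
    (((hf.1.add hX hg.1).add hX (PB.const hX 1)).mono fun _ => size_add_le _ _)

theorem NatC.mul (hf : NatC.{u} X Γ f) (hg : NatC.{u} X Γ g) : NatC.{u} X Γ (fun x => f x * g x) :=
  NatC.binop hX .mul (· * ·) (fun _ _ _ _ _ => rfl) (fun _ _ _ _ => rfl) hf hg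
    ((hf.1.add hX hg.1).mono fun _ => size_mul_le _ _)

theorem NatC.sub (hf : NatC.{u} X Γ f) (hg : NatC.{u} X Γ g) : NatC.{u} X Γ (fun x => f x - g x) :=
  NatC.binop hX .sub (· - ·) (fun _ _ _ _ _ => rfl) (fun _ _ _ _ => rfl) hf hg
    (hf.1.mono fun _ => Nat.size_le_size (Nat.sub_le _ _))

theorem NatC.div (hf : NatC.{u} X Γ f) (hg : NatC.{u} X Γ g) : NatC.{u} X Γ (fun x => f x / g x) :=
  NatC.binop hX .div (· / ·) (fun _ _ _ _ _ => rfl) (fun _ _ _ _ => rfl) hf hg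
    (hf.1.mono fun _ => Nat.size_le_size (Nat.div_le_self _ _))

theorem NatC.mod (hf : NatC.{u} X Γ f) (hg : NatC.{u} X Γ g) : NatC.{u} X Γ (fun x => f x % g x) :=
  NatC.binop hX .mod (· % ·) (fun _ _ _ _ _ => rfl) (fun _ _ _ _ => rfl) hf hg
    (hf.1.mono fun _ => Nat.size_le_size (Nat.mod_le _ _))

/-- The value of the `n`-th member of a sequence with computable recursion. -/
theorem NatC.iterate {n : α → ℕ} (a : α → ℕ → ℕ) (hn : NatC.{u} X Γ n) (hnX : PB X n)
    (h0 : NatC.{u} X Γ (fun x => a x 0))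
    (hs : PB X (fun x => (a x (n x)).size))
    (h : NatC.{u} (fun q => X q.1) (insert (fun q => a q.1 q.2) (loopCtx Γ n))
      (fun q => a q.1 (q.2 + 1))) :
    NatC.{u} X Γ (fun x => a x (n x)) := by
  classical
  refine ⟨hs, fun loc b hb => ?_⟩
  obtain ⟨P₀, T₀, hT₀, hP₀⟩ := h0.2 loc b hb
  obtain ⟨P₁, T₁, hT₁, hP₁⟩ := hn.2 loc (b + 1) fun g hg => (hb g hg).trans (by omega)
  -- The loop occupies `b + 1`, `b + 2`, `b + 3`, and its round index is in `b + 2`. Different `g ∈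
  -- Γ` may induce the same function on the loop situations, but they then agree at the current one,
  -- so any choice of preimage gives the right value.
  let loc' : ((x : α) × Fin (n x) → ℕ) → ℕ := fun g' =>
    if g' = (fun q => a q.1 q.2) then b else if g' = (fun q => (q.2 : ℕ)) then b + 2 else
      if hg : ∃ g ∈ Γ, (fun q : (x : α) × Fin (n x) => g q.1) = g' then loc hg.choose else 0
  obtain ⟨P, T, ⟨c, hT⟩, hP⟩ := h.2 loc' (b + 4) (by
    intro g hg
    simp only [loc']
    split_ifs with h1 h2 h3
    · omega
    · omega
    · exact (hb _ h3.choose_spec.1).trans (by omega)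
    · omega)
  obtain ⟨c', hc'⟩ := h.1
  let B := fun x => X x ^ c + (1 + (1 + X x ^ c'))
  -- The new member is computed in `b + 4` while the old one is still readable in `b`. It is then
  -- moved by adding a zero put into `b + 3`, the scratch cell of the loop.
  refine ⟨.seq P₀ (.seq P₁ (.for (b + 1) (.seq P (.seq (.instr (.const (b + 3) 0))
    (.instr (.add b (b + 4) (b + 3))))))), fun x => T₀ x + (T₁ x + (n x * (7 + 3 * (n x).size + B x) + 2)),
    ?_, fun F _ ξ x σ hσ => ?_⟩
  · have := PB.const hX
    have hXc : ∀ c, PB X fun x => X x ^ c := fun c => PB.self.pow c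
    exact hT₀.add hX (hT₁.add hX ((hnX.mul (((this 7).add hX ((this 3).mul hn.1)).add hX
      ((hXc _).add hX ((this 1).add hX ((this 1).add hX (hXc _)))))).add hX (this 2)))
  refine (hP₀ F ξ x σ hσ).seq fun τ hτ => (hP₁ F ξ x τ fun g hg => ?_).seq fun ρ hρ => ?_
  · rw [hτ.2.1 _ (hb g hg), hσ g hg]
  refine (Runs.for (fun i υ => υ.nat b = a x i ∧ (∀ j < b, υ.nat j = σ.nat j) ∧ υ.fld = σ.fld)
    hρ.1 ?_ ⟨?_, fun j hj => ?_, ?_⟩ ?_).mono le_rfl fun υ hυ => hυ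
  · rintro i υ υ' ⟨h1, h2, h3⟩ h4 h5
    refine ⟨?_, fun j hj => ?_, h4.trans h3⟩
    · rw [h5 b (by omega) (by omega) (by omega), h1]
    · rw [h5 j (by omega) (by omega) (by omega), h2 j hj]
  · rw [hρ.2.1 b (by omega), hτ.1]
  · rw [hρ.2.1 j (by omega), hτ.2.1 j hj]
  · rw [hρ.2.2, hτ.2.2]
  rintro i hi υ ⟨h1, h2, h3⟩ h4
  refine ((hP F ξ ⟨x, ⟨i, hi⟩⟩ υ ?_).mono (hT _) fun _ h => h).seq fun υ' hυ' => ?_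
  · rintro g' hg'
    simp only [loc']
    split_ifs with h5 h6 h7
    · rw [h5, h1]
    · rw [h6]; exact h4
    · rw [h2 _ (hb _ h7.choose_spec.1), hσ _ h7.choose_spec.1]
      exact congr_fun h7.choose_spec.2 ⟨x, ⟨i, hi⟩⟩
    · rcases hg' with hg' | hg' | ⟨g, hg, rfl⟩
      · exact absurd hg' h5
      · exact absurd hg' h6
      · exact absurd ⟨g, hg, rfl⟩ h7
  obtain ⟨h5, h6, h7⟩ := hυ'
  refine Runs.seq (Q := fun ω => ω.nat (b + 3) = 0 ∧ (∀ j, j ≠ b + 3 → ω.nat j = υ'.nat j) ∧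
    ω.fld = υ'.fld) (Runs.instr (by simp [Instr.cost]) ⟨?_, fun j hj => ?_, rfl⟩)
    fun ω hω => Runs.instr ?_ ⟨⟨?_, fun j hj => ?_, ?_⟩, ?_, ?_⟩
  · simp [Instr.step, State.setNat]
  · simp [Instr.step, State.setNat, Function.update_of_ne hj]
  · simp only [Instr.cost, hω.1, hω.2.1 (b + 4) (by omega), h5, Nat.size_zero, add_zero]
    have := hc' ⟨x, ⟨i, hi⟩⟩
    simp only at this
    omega
  · simp [Instr.step, State.setNat, hω.1, hω.2.1 (b + 4) (by omega), h5]
  · simp [Instr.step, State.setNat, Function.update_of_ne hj.ne, hω.2.1 j (by omega),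
      h6 j (by omega), h2 j hj]
  · simp [Instr.step, State.setNat, hω.2.2, h7, h3]
  · simp [Instr.step, State.setNat, hω.2.1 (b + 1) (by omega), h6 (b + 1) (by omega)]
  · have := hω.2.1 (b + 1 + 1) (by omega)
    simp only [Instr.step, State.setNat]
    rw [Function.update_of_ne (by omega), this, h6 (b + 1 + 1) (by omega), h4]

theorem NatC.sum {n : α → ℕ} {g : α → ℕ → ℕ} (hn : NatC.{u} X Γ n) (hnX : PB X n)
    (hg : NatC.{u} (fun q => X q.1) (loopCtx Γ n) (fun q => g q.1 q.2)) :
    NatC.{u} X Γ (fun x => ∑ i ∈ range (n x), g x i) := by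
  obtain ⟨c, hc⟩ := hg.1
  -- All partial sums need a bit-length bound, because each is an input of a round.
  have hb : ∀ x, ∀ k ≤ n x, (∑ i ∈ range k, g x i).size ≤ n x * (X x ^ c + 1) := fun x k hk =>
    (size_sum_le k fun i hi => hc ⟨x, ⟨i, by omega⟩⟩).trans (Nat.mul_le_mul_right _ hk)
  have hB : PB X fun x => n x * (X x ^ c + 1) :=
    hnX.mul ((PB.self.pow c).add hX (PB.const hX 1))
  refine NatC.iterate hX (fun x k => ∑ i ∈ range k, g x i) hn hnX ?_ (hB.mono fun x => hb x _ le_rfl) ?_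
  · simpa using NatC.const hX 0
  · simp only [sum_range_succ]
    refine NatC.add (fun q => hX q.1) (NatC.var (fun q => hX q.1) (Set.mem_insert _ _) ?_)
      (hg.weaken (Set.subset_insert _ _))
    exact (hB.comp Sigma.fst).mono fun q => hb q.1 q.2 q.2.2.le

theorem NatC.prod {n : α → ℕ} {g : α → ℕ → ℕ} (hn : NatC.{u} X Γ n) (hnX : PB X n)
    (hg : NatC.{u} (fun q => X q.1) (loopCtx Γ n) (fun q => g q.1 q.2)) :
    NatC.{u} X Γ (fun x => ∏ i ∈ range (n x), g x i) := by
  obtain ⟨c, hc⟩ := hg.1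
  have hb : ∀ x, ∀ k ≤ n x, (∏ i ∈ range k, g x i).size ≤ n x * X x ^ c + 1 := fun x k hk =>
    (size_prod_le k fun i hi => hc ⟨x, ⟨i, by omega⟩⟩).trans
      (Nat.add_le_add_right (Nat.mul_le_mul_right _ hk) 1)
  have hB : PB X fun x => n x * X x ^ c + 1 :=
    (hnX.mul (PB.self.pow c)).add hX (PB.const hX 1)
  refine NatC.iterate hX (fun x k => ∏ i ∈ range k, g x i) hn hnX ?_ (hB.mono fun x => hb x _ le_rfl) ?_
  · simpa using NatC.const hX 1
  · simp only [prod_range_succ]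
    refine NatC.mul (fun q => hX q.1) (NatC.var (fun q => hX q.1) (Set.mem_insert _ _) ?_)
      (hg.weaken (Set.subset_insert _ _))
    exact (hB.comp Sigma.fst).mono fun q => hb q.1 q.2 q.2.2.le

/-- Powers are loops of multiplications. The exponent must be polynomial in value, whereas for the
base and the result polynomial bit length is enough. -/
theorem NatC.pow (hf : NatC.{u} X Γ f) (hg : NatC.{u} X Γ g) (hgX : PB X g) :
    NatC.{u} X Γ (fun x => f x ^ g x) := by
  simpa using NatC.prod hX (g := fun x _ => f x) hg hgX hf.lift

/-- The index of the round of a loop is available. -/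
theorem NatC.index {n : α → ℕ} (hnX : PB X n) :
    NatC.{u} (fun q => X q.1) (loopCtx Γ n) (fun q => (q.2 : ℕ)) :=
  NatC.var (fun q => hX q.1) (Set.mem_insert _ _)
    ((hnX.comp Sigma.fst).mono fun q => q.2.2.le).size

/-- The indicator of `f ≤ g`. -/
theorem NatC.le (hf : NatC.{u} X Γ f) (hg : NatC.{u} X Γ g) :
    NatC.{u} X Γ (fun x => if f x ≤ g x then 1 else 0) := by
  -- With truncated subtraction the indicator is `1 - (f - g)`.
  have := (NatC.const hX 1).sub hX (hf.sub hX hg)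
  convert this using 2 with x
  split_ifs <;> omega

end NatC
/-! ### Polynomial-time field computations -/

/-- The field element `e` (a function of the situation `x`, which may depend on the list `ξ` and on
the contents `mem` of the field memory before address `R x`) is computable in time polynomial in
`X x`, from the values of the functions in `Γ`. The result is written at address `A x + o`, only later
cells being used as scratch space. -/
def FldC {α : Type} (X : α → ℕ) (Γ : Set (α → ℕ)) (R A : α → ℕ)
    (e : ∀ (F : Type u) [Field F], (ℕ → F) → (ℕ → F) → α → F) : Prop :=
  ∀ (loc : (α → ℕ) → ℕ) (b : ℕ), (∀ g ∈ Γ, loc g < b) → ∀ o : ℕ,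
    ∃ (P : Prog) (T : α → ℕ), PB X T ∧
    ∀ (F : Type u) [Field F] (ξ mem : ℕ → F) (x : α) (σ : State F),
      (∀ g ∈ Γ, σ.nat (loc g) = g x) → (∀ j < R x, σ.fld j = mem j) →
      Runs ξ P σ (T x) fun τ => τ.fld (A x + o) = e F ξ mem x ∧
        (∀ j < A x + o, τ.fld j = σ.fld j) ∧ ∀ j < b, τ.nat j = σ.nat j

section FldC
variable {α : Type} {X : α → ℕ} {Γ : Set (α → ℕ)} {R A : α → ℕ}
  {e e' : ∀ (F : Type u) [Field F], (ℕ → F) → (ℕ → F) → α → F}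

theorem FldC.comap {β : Type} {Δ : Set (β → ℕ)} (h : β → α) (he : FldC.{u} X Γ R A e)
    (hΔ : ∀ g ∈ Γ, (fun y => g (h y)) ∈ Δ) :
    FldC.{u} (fun y => X (h y)) Δ (fun y => R (h y)) (fun y => A (h y))
      (fun F _ ξ mem y => e F ξ mem (h y)) := by
  intro loc b hb o
  obtain ⟨P, T, hT, hP⟩ := he (fun g => loc fun y => g (h y)) b (fun g hg => hb _ (hΔ g hg)) o
  exact ⟨P, _, hT.comp h, fun F _ ξ mem y σ hσ => hP F ξ mem (h y) σ fun g hg => hσ _ (hΔ g hg)⟩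

theorem FldC.lift {n : α → ℕ} (he : FldC.{u} X Γ R A e) :
    FldC.{u} (fun q => X q.1) (loopCtx Γ n) (fun q => R q.1) (fun q => A q.1)
      (fun F _ ξ mem q => e F ξ mem q.1) :=
  he.comap Sigma.fst fun g hg => Or.inr ⟨g, hg, rfl⟩

variable (hX : ∀ x, 2 ≤ X x)
include hX

/-- Case distinction. -/
theorem FldC.ite {f : α → ℕ} (hf : NatC.{u} X Γ f) (he : FldC.{u} X Γ R A e) (he' : FldC.{u} X Γ R A e') :
    FldC.{u} X Γ R A (fun F _ ξ mem x => if f x = 0 then e F ξ mem x else e' F ξ mem x) := by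
  intro loc b hb o
  obtain ⟨P₀, T₀, hT₀, hP₀⟩ := hf.2 loc b hb
  obtain ⟨P₁, T₁, hT₁, hP₁⟩ := he loc b hb o
  obtain ⟨P₂, T₂, hT₂, hP₂⟩ := he' loc b hb o
  refine ⟨.seq P₀ (.branch b P₂ P₁), fun x => T₀ x + (1 + (f x).size + (T₁ x + T₂ x)),
    hT₀.add hX (((PB.const hX 1).add hX hf.1).add hX (hT₁.add hX hT₂)),
    fun F _ ξ mem x σ hσ hm => ?_⟩
  refine (hP₀ F ξ x σ hσ).seq fun τ hτ => ?_
  have hτσ : ∀ g ∈ Γ, τ.nat (loc g) = g x := fun g hg => by rw [hτ.2.1 _ (hb g hg), hσ g hg]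
  have hτm : ∀ j < R x, τ.fld j = mem j := fun j hj => by rw [hτ.2.2, hm j hj]
  by_cases h : f x = 0
  · obtain ⟨ρ, t, h1, h2, h3, h4, h5⟩ := hP₁ F ξ mem x τ hτσ hτm
    exact ⟨ρ, _, .branch_zero (hτ.1.trans h) h1, by omega, by simp only [h3, if_pos h],
      fun j hj => by rw [h4 j hj, hτ.2.2], fun j hj => by rw [h5 j hj, hτ.2.1 j hj]⟩
  · obtain ⟨ρ, t, h1, h2, h3, h4, h5⟩ := hP₂ F ξ mem x τ hτσ hτm
    exact ⟨ρ, _, .branch_pos (by rwa [hτ.1]) h1, by rw [hτ.1]; omega, by simp only [h3, if_neg h],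
      fun j hj => by rw [h4 j hj, hτ.2.2], fun j hj => by rw [h5 j hj, hτ.2.1 j hj]⟩

variable (hA : NatC.{u} X Γ A)
include hA

/-- A single instruction that computes a field element from field elements that are
computed before, and from a natural number. -/
theorem FldC.instr₁ (I : ℕ → ℕ → Instr) (op : ∀ (F : Type u) [Field F], (ℕ → F) → ℕ → F)
    (hstep : ∀ {F : Type u} [Field F] (ξ : ℕ → F) (c a : ℕ) (σ : State F),
      (I c a).step ξ σ = σ.setFld (σ.nat c) (op F ξ (σ.nat a)))
    (hcost : ∀ {F : Type u} (c a : ℕ) (σ : State F),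
      (I c a).cost σ ≤ 1 + (σ.nat c).size + (σ.nat a).size)
    {f : α → ℕ} (hf : NatC.{u} X Γ f) : FldC.{u} X Γ R A (fun F _ ξ _ x => op F ξ (f x)) := by
  intro loc b hb o
  have hAo := hA.add hX (NatC.const hX o)
  obtain ⟨P₁, T₁, hT₁, hP₁⟩ := hAo.2 loc b hb
  obtain ⟨P₂, T₂, hT₂, hP₂⟩ := hf.2 loc (b + 1) fun g hg => (hb g hg).trans (by omega)
  refine ⟨.seq P₁ (.seq P₂ (.instr (I b (b + 1)))),
    fun x => T₁ x + (T₂ x + (1 + (A x + o).size + (f x).size)),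
    hT₁.add hX (hT₂.add hX (((PB.const hX 1).add hX hAo.1).add hX hf.1)),
    fun F _ ξ mem x σ hσ hm => ?_⟩
  refine (hP₁ F ξ x σ hσ).seq fun τ hτ => (hP₂ F ξ x τ fun g hg => ?_).seq fun ρ hρ =>
    Runs.instr ((hcost _ _ _).trans ?_) ⟨?_, fun j hj => ?_, fun j hj => ?_⟩
  · rw [hτ.2.1 _ (hb g hg), hσ g hg]
  · rw [hρ.1, hρ.2.1 b (by omega), hτ.1]
  · simp [hstep, State.setFld, hρ.1, hρ.2.1 b (by omega), hτ.1]
  · simp [hstep, State.setFld, hρ.2.1 b (by omega), hτ.1, Function.update_of_ne hj.ne, hρ.2.2,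
      hτ.2.2]
  · simp [hstep, State.setFld, hρ.2.1 j (by omega), hτ.2.1 j hj]

theorem FldC.zero : FldC.{u} X Γ R A (fun _ _ _ _ _ => 0) :=
  FldC.instr₁ hX hA (fun c _ => .fzero c) (fun _ _ _ _ => 0) (fun _ _ _ _ => rfl)
    (fun _ _ _ => by simp [Instr.cost]) (NatC.const hX 0)

theorem FldC.one : FldC.{u} X Γ R A (fun _ _ _ _ _ => 1) :=
  FldC.instr₁ hX hA (fun c _ => .fone c) (fun _ _ _ _ => 1) (fun _ _ _ _ => rfl)
    (fun _ _ _ => by simp [Instr.cost]) (NatC.const hX 0)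

theorem FldC.node {f : α → ℕ} (hf : NatC.{u} X Γ f) : FldC.{u} X Γ R A (fun _ _ ξ _ x => ξ (f x)) :=
  FldC.instr₁ hX hA .fnode (fun _ _ ξ k => ξ k) (fun _ _ _ _ => rfl) (fun _ _ _ => le_rfl) hf

/-- A binary operation on field elements. -/
theorem FldC.binop (I : ℕ → ℕ → ℕ → Instr) (op : ∀ (F : Type u) [Field F], F → F → F)
    (hstep : ∀ {F : Type u} [Field F] (ξ : ℕ → F) (c a b : ℕ) (σ : State F),
      (I c a b).step ξ σ = σ.setFld (σ.nat c) (op F (σ.fld (σ.nat a)) (σ.fld (σ.nat b))))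
    (hcost : ∀ {F : Type u} (c a b : ℕ) (σ : State F),
      (I c a b).cost σ ≤ 1 + (σ.nat c).size + (σ.nat a).size + (σ.nat b).size)
    (hRA : ∀ x, R x ≤ A x) (he : FldC.{u} X Γ R A e) (he' : FldC.{u} X Γ R A e') :
    FldC.{u} X Γ R A (fun F _ ξ mem x => op F (e F ξ mem x) (e' F ξ mem x)) := by
  intro loc b hb o
  have hAo := hA.add hX (NatC.const hX o)
  have hAo' := hA.add hX (NatC.const hX (o + 1))
  obtain ⟨P₁, T₁, hT₁, hP₁⟩ := he loc b hb o
  obtain ⟨P₂, T₂, hT₂, hP₂⟩ := he' loc b hb (o + 1)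
  obtain ⟨P₃, T₃, hT₃, hP₃⟩ := hAo.2 loc b hb
  obtain ⟨P₄, T₄, hT₄, hP₄⟩ := hAo'.2 loc (b + 1) fun g hg => (hb g hg).trans (by omega)
  refine ⟨.seq P₁ (.seq P₂ (.seq P₃ (.seq P₄ (.instr (I b b (b + 1)))))),
    fun x => T₁ x + (T₂ x + (T₃ x + (T₄ x + (1 + (A x + o).size + (A x + o).size +
      (A x + (o + 1)).size)))),
    hT₁.add hX (hT₂.add hX (hT₃.add hX (hT₄.add hX ((((PB.const hX 1).add hX hAo.1).add hX
      hAo.1).add hX hAo'.1)))), fun F _ ξ mem x σ hσ hm => ?_⟩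
  refine (hP₁ F ξ mem x σ hσ hm).seq fun τ hτ => (hP₂ F ξ mem x τ (fun g hg => ?_)
    fun j hj => ?_).seq fun ρ hρ => (hP₃ F ξ x ρ fun g hg => ?_).seq fun υ hυ =>
      (hP₄ F ξ x υ fun g hg => ?_).seq fun ω hω =>
    Runs.instr ((hcost _ _ _ _).trans ?_) ⟨?_, fun j hj => ?_, fun j hj => ?_⟩
  · rw [hτ.2.2 _ (hb g hg), hσ g hg]
  · rw [hτ.2.1 j (hj.trans_le ((hRA x).trans (by omega))), hm j hj]
  · rw [hρ.2.2 _ (hb g hg), hτ.2.2 _ (hb g hg), hσ g hg]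
  · rw [hυ.2.1 _ (hb g hg), hρ.2.2 _ (hb g hg), hτ.2.2 _ (hb g hg), hσ g hg]
  · rw [hω.1, hω.2.1 b (by omega), hυ.1]
  · have h1 : ω.fld (A x + o) = e F ξ mem x := by
      rw [hω.2.2, hυ.2.2, hρ.2.1 _ (by omega), hτ.1]
    have h2 : ω.fld (A x + (o + 1)) = e' F ξ mem x := by
      rw [hω.2.2, hυ.2.2, hρ.1]
    simp [hstep, State.setFld, hω.1, hω.2.1 b (by omega), hυ.1, h1, h2]
  · simp [hstep, State.setFld, hω.2.1 b (by omega), hυ.1, Function.update_of_ne hj.ne, hω.2.2,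
      hυ.2.2, hρ.2.1 j (by omega), hτ.2.1 j hj]
  · simp [hstep, State.setFld, hω.2.1 j (by omega), hυ.2.1 j hj, hρ.2.2 j hj, hτ.2.2 j hj]

/-- The content of the field memory at a computed address. -/
theorem FldC.mem {f : α → ℕ} (hf : NatC.{u} X Γ f) (hRA : ∀ x, R x ≤ A x) (hfR : ∀ x, f x < R x) :
    FldC.{u} X Γ R A (fun _ _ _ mem x => mem (f x)) := by
  intro loc b hb o
  have hAo := hA.add hX (NatC.const hX o)
  -- A field cell is fetched by adding it to a zero placed at the target.
  obtain ⟨P₁, T₁, hT₁, hP₁⟩ := FldC.zero (R := R) hX hA loc b hb o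
  obtain ⟨P₂, T₂, hT₂, hP₂⟩ := hAo.2 loc b hb
  obtain ⟨P₃, T₃, hT₃, hP₃⟩ := hf.2 loc (b + 1) fun g hg => (hb g hg).trans (by omega)
  refine ⟨.seq P₁ (.seq P₂ (.seq P₃ (.instr (.fadd b b (b + 1))))),
    fun x => T₁ x + (T₂ x + (T₃ x + (1 + (A x + o).size + (A x + o).size + (f x).size))),
    hT₁.add hX (hT₂.add hX (hT₃.add hX ((((PB.const hX 1).add hX hAo.1).add hX
      hAo.1).add hX hf.1))), fun F _ ξ mem x σ hσ hm => ?_⟩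
  refine (hP₁ F ξ mem x σ hσ hm).seq fun τ hτ => (hP₂ F ξ x τ fun g hg => ?_).seq fun ρ hρ =>
    (hP₃ F ξ x ρ fun g hg => ?_).seq fun υ hυ => Runs.instr ?_ ⟨?_, fun j hj => ?_, fun j hj => ?_⟩
  · rw [hτ.2.2 _ (hb g hg), hσ g hg]
  · rw [hρ.2.1 _ (hb g hg), hτ.2.2 _ (hb g hg), hσ g hg]
  · simp only [Instr.cost]; rw [hυ.1, hυ.2.1 b (by omega), hρ.1]
  · have h1 : υ.fld (A x + o) = 0 := by rw [hυ.2.2, hρ.2.2, hτ.1]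
    have h2 : υ.fld (f x) = mem (f x) := by
      rw [hυ.2.2, hρ.2.2, hτ.2.1 _ (((hfR x).trans_le (hRA x)).trans_le (by omega)), hm _ (hfR x)]
    simp [Instr.step, State.setFld, hυ.1, hυ.2.1 b (by omega), hρ.1, h1, h2]
  · simp [Instr.step, State.setFld, hυ.2.1 b (by omega), hρ.1, Function.update_of_ne hj.ne,
      hυ.2.2, hρ.2.2, hτ.2.1 j hj]
  · simp [Instr.step, State.setFld, hυ.2.1 j (by omega), hρ.2.1 j hj, hτ.2.2 j hj]

theorem FldC.add (hRA : ∀ x, R x ≤ A x) (he : FldC.{u} X Γ R A e) (he' : FldC.{u} X Γ R A e') :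
    FldC.{u} X Γ R A (fun F _ ξ mem x => e F ξ mem x + e' F ξ mem x) :=
  FldC.binop hX hA .fadd (fun _ _ => (· + ·)) (fun _ _ _ _ _ => rfl) (fun _ _ _ _ => le_rfl) hRA he
    he'

theorem FldC.sub (hRA : ∀ x, R x ≤ A x) (he : FldC.{u} X Γ R A e) (he' : FldC.{u} X Γ R A e') :
    FldC.{u} X Γ R A (fun F _ ξ mem x => e F ξ mem x - e' F ξ mem x) :=
  FldC.binop hX hA .fsub (fun _ _ => (· - ·)) (fun _ _ _ _ _ => rfl) (fun _ _ _ _ => le_rfl) hRA he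
    he'

theorem FldC.mul (hRA : ∀ x, R x ≤ A x) (he : FldC.{u} X Γ R A e) (he' : FldC.{u} X Γ R A e') :
    FldC.{u} X Γ R A (fun F _ ξ mem x => e F ξ mem x * e' F ξ mem x) :=
  FldC.binop hX hA .fmul (fun _ _ => (· * ·)) (fun _ _ _ _ _ => rfl) (fun _ _ _ _ => le_rfl) hRA he
    he'

theorem FldC.inv (hRA : ∀ x, R x ≤ A x) (he : FldC.{u} X Γ R A e) :
    FldC.{u} X Γ R A (fun F _ ξ mem x => (e F ξ mem x)⁻¹) :=
  -- A unary operation is treated as a binary one that ignores its second operand, at the price of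
  -- computing `e` twice.
  FldC.binop hX hA (fun c a _ => .finv c a) (fun _ _ a _ => a⁻¹) (fun _ _ _ _ _ => rfl)
    (fun _ _ _ _ => by simp [Instr.cost]) hRA he he

/-- Iterating a binary operation. -/
theorem FldC.fold (I : ℕ → ℕ → ℕ → Instr) (op : ∀ (F : Type u) [Field F], F → F → F)
    (hstep : ∀ {F : Type u} [Field F] (ξ : ℕ → F) (c a b : ℕ) (σ : State F),
      (I c a b).step ξ σ = σ.setFld (σ.nat c) (op F (σ.fld (σ.nat a)) (σ.fld (σ.nat b))))
    (hcost : ∀ {F : Type u} (c a b : ℕ) (σ : State F),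
      (I c a b).cost σ ≤ 1 + (σ.nat c).size + (σ.nat a).size + (σ.nat b).size)
    (hRA : ∀ x, R x ≤ A x) {n : α → ℕ} (hn : NatC.{u} X Γ n) (hnX : PB X n)
    (s : ∀ (F : Type u) [Field F], (ℕ → F) → (ℕ → F) → α → ℕ → F)
    (g : ∀ (F : Type u) [Field F], (ℕ → F) → (ℕ → F) → α → ℕ → F)
    (hs : ∀ (F : Type u) [Field F] (ξ mem : ℕ → F) (x : α) (i : ℕ),
      s F ξ mem x (i + 1) = op F (s F ξ mem x i) (g F ξ mem x i))
    (h0 : FldC.{u} X Γ R A (fun F _ ξ mem x => s F ξ mem x 0))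
    (hg : FldC.{u} (fun q => X q.1) (loopCtx Γ n) (fun q => R q.1) (fun q => A q.1)
      (fun F _ ξ mem q => g F ξ mem q.1 q.2)) :
    FldC.{u} X Γ R A (fun F _ ξ mem x => s F ξ mem x (n x)) := by
  classical
  intro loc b hb o
  have hAo := hA.add hX (NatC.const hX o)
  have hAo' := hA.add hX (NatC.const hX (o + 1))
  obtain ⟨P₀, T₀, hT₀, hP₀⟩ := h0 loc b hb o
  obtain ⟨P₁, T₁, hT₁, hP₁⟩ := hn.2 loc b hb
  obtain ⟨P₃, T₃, hT₃, hP₃⟩ := hAo.2 loc (b + 3) fun g hg => (hb g hg).trans (by omega)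
  obtain ⟨P₄, T₄, hT₄, hP₄⟩ := hAo'.2 loc (b + 4) fun g hg => (hb g hg).trans (by omega)
  let loc' : ((x : α) × Fin (n x) → ℕ) → ℕ := fun g' =>
    if g' = (fun q => (q.2 : ℕ)) then b + 1 else
      if hg : ∃ g ∈ Γ, (fun q : (x : α) × Fin (n x) => g q.1) = g' then loc hg.choose else 0
  -- The terms are written at offset `o + 1`, so the accumulator at offset `o` is left intact.
  obtain ⟨P, T, ⟨c, hT⟩, hP⟩ := hg loc' (b + 3) (by
    intro g hg
    simp only [loc']
    split_ifs with h2 h3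
    · omega
    · exact (hb _ h3.choose_spec.1).trans (by omega)
    · omega) (o + 1)
  let C := fun x => 1 + (A x + o).size + (A x + o).size + (A x + (o + 1)).size
  let B := fun x => X x ^ c + (T₃ x + (T₄ x + C x))
  have hC : PB X C := (((PB.const hX 1).add hX hAo.1).add hX hAo.1).add hX hAo'.1
  have hB : PB X B := (PB.self.pow c).add hX (hT₃.add hX (hT₄.add hX hC))
  refine ⟨.seq P₀ (.seq P₁ (.for b (.seq P (.seq P₃ (.seq P₄ (.instr (I (b + 3) (b + 3) (b + 4)))))))),
    fun x => T₀ x + (T₁ x + (n x * (7 + 3 * (n x).size + B x) + 2)),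
    ?_, fun F _ ξ mem x σ hσ hm => ?_⟩
  · exact hT₀.add hX (hT₁.add hX ((hnX.mul (((PB.const hX 7).add hX ((PB.const hX 3).mul
      hn.1)).add hX hB)).add hX (PB.const hX 2)))
  refine (hP₀ F ξ mem x σ hσ hm).seq fun τ hτ => (hP₁ F ξ x τ fun g hg => ?_).seq fun ρ hρ => ?_
  · rw [hτ.2.2 _ (hb g hg), hσ g hg]
  refine (Runs.for (fun i υ => υ.fld (A x + o) = s F ξ mem x i ∧
    (∀ j < A x + o, υ.fld j = σ.fld j) ∧ ∀ j < b, υ.nat j = σ.nat j)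
    hρ.1 ?_ ⟨?_, fun j hj => ?_, fun j hj => ?_⟩ ?_).mono le_rfl fun υ hυ => hυ
  · rintro i υ υ' ⟨h1, h2, h3⟩ h4 h5
    exact ⟨by rw [h4, h1], fun j hj => by rw [h4, h2 j hj],
      fun j hj => by rw [h5 j (by omega) (by omega) (by omega), h3 j hj]⟩
  · rw [hρ.2.2, hτ.1]
  · rw [hρ.2.2, hτ.2.1 j hj]
  · rw [hρ.2.1 j hj, hτ.2.2 j hj]
  rintro i hi υ ⟨h1, h2, h3⟩ h4
  refine ((hP F ξ mem ⟨x, ⟨i, hi⟩⟩ υ ?_ ?_).mono (hT _) fun _ h => h).seq fun υ' hυ' => ?_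
  · rintro g' hg'
    simp only [loc']
    split_ifs with h6 h7
    · rw [h6]; exact h4
    · rw [h3 _ (hb _ h7.choose_spec.1), hσ _ h7.choose_spec.1]
      exact congr_fun h7.choose_spec.2 ⟨x, ⟨i, hi⟩⟩
    · rcases hg' with hg' | ⟨g, hg, rfl⟩
      · exact absurd hg' h6
      · exact absurd ⟨g, hg, rfl⟩ h7
  · exact fun j hj => by rw [h2 j (hj.trans_le ((hRA x).trans (by omega))), hm j hj]
  obtain ⟨h5, h6, h7⟩ := hυ'
  have hl : ∀ g ∈ Γ, υ'.nat (loc g) = g x := fun g hg => by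
    rw [h7 _ ((hb g hg).trans (by omega)), h3 _ (hb g hg), hσ g hg]
  refine (hP₃ F ξ x υ' hl).seq fun ψ hψ =>
    (hP₄ F ξ x ψ fun g hg => ?_).seq fun ω hω =>
    Runs.instr ((hcost _ _ _ _).trans ?_) ⟨⟨?_, fun j hj => ?_, fun j hj => ?_⟩, ?_, ?_⟩
  · rw [hψ.2.1 _ ((hb g hg).trans (by omega)), hl g hg]
  · rw [hω.1, hω.2.1 _ (by omega), hψ.1]
  · have e1 : ω.fld (A x + o) = s F ξ mem x i := by
      rw [hω.2.2, hψ.2.2, h6 _ (by simp), h1]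
    have e2 : ω.fld (A x + (o + 1)) = g F ξ mem x i := by
      rw [hω.2.2, hψ.2.2]; exact h5
    simp [hstep, State.setFld, hω.1, hω.2.1 (b + 3) (by omega), hψ.1, e1, e2, hs]
  · simp [hstep, State.setFld, hω.2.1 (b + 3) (by omega), hψ.1, Function.update_of_ne hj.ne, hω.2.2,
      hψ.2.2, h6 j (Nat.lt_succ_of_lt hj), h2 j hj]
  · simp [hstep, State.setFld, hω.2.1 j (by omega), hψ.2.1 j (by omega), h7 j (by omega), h3 j hj]
  · simp [hstep, State.setFld, hω.2.1 b (by omega), hψ.2.1 b (by omega), h7 b (by omega)]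
  · simp [hstep, State.setFld, hω.2.1 (b + 1) (by omega), hψ.2.1 (b + 1) (by omega),
      h7 (b + 1) (by omega), h4]

theorem FldC.sum (hRA : ∀ x, R x ≤ A x) {n : α → ℕ} (hn : NatC.{u} X Γ n) (hnX : PB X n)
    {g : ∀ (F : Type u) [Field F], (ℕ → F) → (ℕ → F) → α → ℕ → F}
    (hg : FldC.{u} (fun q => X q.1) (loopCtx Γ n) (fun q => R q.1) (fun q => A q.1)
      (fun F _ ξ mem q => g F ξ mem q.1 q.2)) :
    FldC.{u} X Γ R A (fun F _ ξ mem x => ∑ i ∈ range (n x), g F ξ mem x i) :=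
  FldC.fold hX hA .fadd (fun _ _ => (· + ·)) (fun _ _ _ _ _ => rfl) (fun _ _ _ _ => le_rfl) hRA
    hn hnX (fun F _ ξ mem x k => ∑ i ∈ range k, g F ξ mem x i) g
    (fun _ _ _ _ _ _ => sum_range_succ _ _) (by simpa using FldC.zero hX hA) hg

theorem FldC.prod (hRA : ∀ x, R x ≤ A x) {n : α → ℕ} (hn : NatC.{u} X Γ n) (hnX : PB X n)
    {g : ∀ (F : Type u) [Field F], (ℕ → F) → (ℕ → F) → α → ℕ → F}
    (hg : FldC.{u} (fun q => X q.1) (loopCtx Γ n) (fun q => R q.1) (fun q => A q.1)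
      (fun F _ ξ mem q => g F ξ mem q.1 q.2)) :
    FldC.{u} X Γ R A (fun F _ ξ mem x => ∏ i ∈ range (n x), g F ξ mem x i) :=
  FldC.fold hX hA .fmul (fun _ _ => (· * ·)) (fun _ _ _ _ _ => rfl) (fun _ _ _ _ => le_rfl) hRA
    hn hnX (fun F _ ξ mem x k => ∏ i ∈ range k, g F ξ mem x i) g
    (fun _ _ _ _ _ _ => prod_range_succ _ _) (by simpa using FldC.one hX hA) hg

theorem FldC.pow (hRA : ∀ x, R x ≤ A x) (he : FldC.{u} X Γ R A e) {n : α → ℕ} (hn : NatC.{u} X Γ n)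
    (hnX : PB X n) : FldC.{u} X Γ R A (fun F _ ξ mem x => e F ξ mem x ^ n x) := by
  simpa using FldC.prod hX hA hRA hn hnX (g := fun F _ ξ mem x _ => e F ξ mem x) he.lift

end FldC

/-- Copying `n` consecutive cells of the field memory to the front. -/
theorem FldC.vector {α : Type} {X : α → ℕ} {Γ : Set (α → ℕ)} {R n : α → ℕ} (hX : ∀ x, 2 ≤ X x)
    (hR : NatC.{u} X Γ R) (hn : NatC.{u} X Γ n) (hnX : PB X n)
    {e : ∀ (F : Type u) [Field F], (ℕ → F) → (ℕ → F) → α → ℕ → F}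
    (he : FldC.{u} (fun q => X q.1) (loopCtx Γ n) (fun q => R q.1) (fun q => R q.1 + q.2)
      (fun F _ ξ mem q => e F ξ mem q.1 q.2))
    (loc : (α → ℕ) → ℕ) (b : ℕ) (hb : ∀ g ∈ Γ, loc g < b) :
    ∃ (P : Prog) (T : α → ℕ), PB X T ∧
      ∀ (F : Type u) [Field F] (ξ : ℕ → F) (x : α) (σ : State F),
        (∀ g ∈ Γ, σ.nat (loc g) = g x) →
        Runs ξ P σ (T x) fun τ => ∀ k < n x, τ.fld k = e F ξ σ.fld x k := by
  classical
  let loc' : ((x : α) × Fin (n x) → ℕ) → ℕ := fun g' =>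
    if g' = (fun q => (q.2 : ℕ)) then b + 1 else
      if hg : ∃ g ∈ Γ, (fun q : (x : α) × Fin (n x) => g q.1) = g' then loc hg.choose else 0
  have hloc' : ∀ g ∈ loopCtx Γ n, loc' g < b + 3 := by
    intro g hg
    simp only [loc']
    split_ifs with h2 h3
    · omega
    · exact (hb _ h3.choose_spec.1).trans (by omega)
    · omega
  have hl : ∀ {F : Type u} (x : α) (i : ℕ) (hi : i < n x) (υ : State F),
      (∀ g ∈ Γ, υ.nat (loc g) = g x) → υ.nat (b + 1) = i →
      ∀ g ∈ loopCtx Γ n, υ.nat (loc' g) = g ⟨x, ⟨i, hi⟩⟩ := by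
    rintro F x i hi υ hσ h4 g' hg'
    simp only [loc']
    split_ifs with h6 h7
    · rw [h6]; exact h4
    · rw [hσ _ h7.choose_spec.1]
      exact congr_fun h7.choose_spec.2 ⟨x, ⟨i, hi⟩⟩
    · rcases hg' with hg' | ⟨g, hg, rfl⟩
      · exact absurd hg' h6
      · exact absurd ⟨g, hg, rfl⟩ h7
  have hX' : ∀ q : (x : α) × Fin (n x), 2 ≤ X q.1 := fun q => hX q.1
  have hi : NatC.{u} (fun q => X q.1) (loopCtx Γ n) (fun q => (q.2 : ℕ)) := NatC.index hX hnX
  have hRk : NatC.{u} (fun q => X q.1) (loopCtx Γ n) (fun q => R q.1 + q.2) := hR.lift.add hX' hi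
  have hRn : NatC.{u} X Γ (fun x => R x + n x) := hR.add hX hn
  obtain ⟨P₀, T₀, hT₀, hP₀⟩ := hn.2 loc b hb
  obtain ⟨P, T, ⟨c, hT⟩, hP⟩ := he loc' (b + 3) hloc' 0
  -- The cell after the results holds zero, and a field cell is copied by adding this zero to it.
  obtain ⟨P₁, T₁, hT₁, hP₁⟩ := FldC.zero (R := R) hX hRn loc b hb 0
  obtain ⟨P₂, T₂, ⟨c₂, hT₂⟩, hP₂⟩ := hRk.2 loc' (b + 3) hloc'
  obtain ⟨P₃, T₃, hT₃, hP₃⟩ := hRn.2 loc (b + 4) fun g hg => (hb g hg).trans (by omega)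
  obtain ⟨c₄, hc₄⟩ := hi.1.add hX' hRk.1
  let B := fun x => X x ^ c₂ + (T₃ x + (1 + X x ^ c₄ + (R x + n x).size))
  have hB : PB X B := (PB.self.pow c₂).add hX (hT₃.add hX (((PB.const hX 1).add hX
    (PB.self.pow c₄)).add hX hRn.1))
  -- Every entry may depend on all of the first `R x` cells, so the results are collected behind
  -- them and moved to the front only afterwards. The first loop exhausts its counter, so `P₀` sets
  -- it anew for the second.
  refine ⟨.seq P₀ (.seq (.for b P) (.seq P₁ (.seq P₀ (.for b (.seq P₂ (.seq P₃
      (.instr (.fadd (b + 1) (b + 3) (b + 4))))))))),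
    fun x => T₀ x + (n x * (7 + 3 * (n x).size + X x ^ c) + 2 + (T₁ x + (T₀ x +
      (n x * (7 + 3 * (n x).size + B x) + 2)))), ?_, fun F _ ξ x σ hσ => ?_⟩
  · have hS := ((PB.const hX 7).add hX ((PB.const hX 3).mul hn.1))
    exact hT₀.add hX (((hnX.mul (hS.add hX (PB.self.pow c))).add hX (PB.const hX 2)).add hX
      (hT₁.add hX (hT₀.add hX ((hnX.mul (hS.add hX hB)).add hX (PB.const hX 2)))))
  refine (hP₀ F ξ x σ hσ).seq fun τ hτ => ?_
  refine (Runs.for (fun i υ => (∀ k < i, υ.fld (R x + k) = e F ξ σ.fld x k) ∧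
    (∀ j < R x, υ.fld j = σ.fld j) ∧ ∀ j < b, υ.nat j = σ.nat j) hτ.1 ?_ ⟨?_, ?_, ?_⟩ ?_).seq
    fun ρ hρ => (hP₁ F ξ ρ.fld x ρ (fun g hg => ?_) fun _ _ => rfl).seq fun ρ' hρ' =>
    (hP₀ F ξ x ρ' fun g hg => ?_).seq fun τ' hτ' => ?_
  · rintro i υ υ' ⟨h1, h2, h3⟩ h4 h5
    exact ⟨fun k hk => by rw [h4, h1 k hk], fun j hj => by rw [h4, h2 j hj],
      fun j hj => by rw [h5 j (by omega) (by omega) (by omega), h3 j hj]⟩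
  · simp
  · intro j _; rw [hτ.2.2]
  · exact hτ.2.1
  · rintro i hi υ ⟨h1, h2, h3⟩ h4
    refine (hP F ξ σ.fld ⟨x, ⟨i, hi⟩⟩ υ (hl x i hi υ (fun g hg => ?_) h4) h2).mono (hT _)
      fun ω hω => ⟨⟨fun k hk => ?_, fun j hj => ?_, fun j hj => ?_⟩, ?_, ?_⟩
    · rw [h3 _ (hb g hg), hσ g hg]
    · rcases Nat.lt_succ_iff_lt_or_eq.1 hk with hk | rfl
      · rw [hω.2.1 _ (by simpa using hk), h1 k hk]
      · exact hω.1
    · rw [hω.2.1 _ (by simp only; omega), h2 j hj]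
    · rw [hω.2.2 j (by omega), h3 j hj]
    · exact hω.2.2 b (by omega)
    · rw [hω.2.2 (b + 1) (by omega), h4]
  · rw [hρ.2.2 _ (hb g hg), hσ g hg]
  · rw [hρ'.2.2 _ (hb g hg), hρ.2.2 _ (hb g hg), hσ g hg]
  -- The two ranges may overlap. Moving in increasing order is safe since `i < R x + k` for `k > i`,
  -- so round `i` overwrites no result that is still needed, and `i < n x` keeps the zero cell
  -- intact.
  refine (Runs.for (fun i υ => (∀ k < i, υ.fld k = e F ξ σ.fld x k) ∧
    (∀ k < n x, i ≤ k → υ.fld (R x + k) = e F ξ σ.fld x k) ∧ υ.fld (R x + n x) = 0 ∧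
    ∀ j < b, υ.nat j = σ.nat j) hτ'.1 ?_ ⟨?_, ?_, ?_, ?_⟩ ?_).mono le_rfl fun υ hυ => hυ.1
  · rintro i υ υ' ⟨h1, h2, h3, h3'⟩ h4 h5
    exact ⟨fun k hk => by rw [h4, h1 k hk], fun j hj hj' => by rw [h4, h2 j hj hj'], by rw [h4, h3],
      fun j hj => by rw [h5 j (by omega) (by omega) (by omega), h3' j hj]⟩
  · simp
  · intro k hk _
    rw [hτ'.2.2, hρ'.2.1 _ (by simp only; omega), hρ.1 k hk]
  · rw [hτ'.2.2]; exact hρ'.1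
  · intro j hj; rw [hτ'.2.1 j hj, hρ'.2.2 j hj, hρ.2.2 j hj]
  rintro i hi υ ⟨h1, h2, h3, h3'⟩ h4
  have hυ : ∀ g ∈ Γ, υ.nat (loc g) = g x := fun g hg => by rw [h3' _ (hb g hg), hσ g hg]
  refine ((hP₂ F ξ ⟨x, ⟨i, hi⟩⟩ υ (hl x i hi υ hυ h4)).mono (hT₂ _) fun _ h => h).seq fun ω hω =>
    (hP₃ F ξ x ω fun g hg => ?_).seq fun ψ hψ => Runs.instr ?_ ?_
  · rw [hω.2.1 _ ((hb g hg).trans (by omega)), hυ g hg]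
  · have := hc₄ ⟨x, ⟨i, hi⟩⟩
    simp only at this
    simp only [Instr.cost, hψ.1, hψ.2.1 (b + 1) (by omega), hψ.2.1 (b + 3) (by omega), hω.1,
      hω.2.1 (b + 1) (by omega), h4]
    omega
  · have e1 : ψ.nat (b + 1) = i := by rw [hψ.2.1 _ (by omega), hω.2.1 _ (by omega), h4]
    have e2 : ψ.nat (b + 3) = R x + i := by rw [hψ.2.1 _ (by omega), hω.1]
    have e3 : ψ.fld = υ.fld := by rw [hψ.2.2, hω.2.2]
    simp only [Instr.step, State.setFld, e1, e2, hψ.1, e3, h3, h2 i hi le_rfl, add_zero]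
    refine ⟨⟨fun k hk => ?_, fun k hk hk' => ?_, ?_, fun j hj => ?_⟩, ?_, trivial⟩
    · rcases Nat.lt_succ_iff_lt_or_eq.1 hk with hk | rfl
      · rw [Function.update_of_ne hk.ne, h1 k hk]
      · simp
    · rw [Function.update_of_ne (by omega), h2 k hk (by omega)]
    · rw [Function.update_of_ne (by omega), h3]
    · rw [hψ.2.1 j (by omega), hω.2.1 j (by omega), h3' j hj]
    · rw [hψ.2.1 b (by omega), hω.2.1 b (by omega)]

/-! ### Rank concentration -/

/-- The size of the support of an exponent vector. -/
def nsupp {k : ℕ} (a : Fin k → ℕ) : ℕ := #{i | a i ≠ 0}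

theorem nsupp_append {k l : ℕ} (a : Fin k → ℕ) (b : Fin l → ℕ) :
    nsupp (Fin.append a b) = nsupp a + nsupp b := by
  simp [nsupp, Finset.card_filter, Fin.sum_univ_add]

theorem nsupp_cons {k : ℕ} (e : ℕ) (a : Fin k → ℕ) :
    nsupp (Fin.cons e a : Fin (k + 1) → ℕ) = (if e ≠ 0 then 1 else 0) + nsupp a := by
  simp [nsupp, Finset.card_filter, Fin.sum_univ_succ]

/-- After the shift of all variables by `1`, a polynomial with `s ≠ 0` monomials has a monomial of
support at most `lg s`. -/
theorem exists_small_support {K : Type*} [CommRing K] : ∀ (k : ℕ) (S : Finset (Fin k → ℕ))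
    (c : (Fin k → ℕ) → K), S.Nonempty → (∀ b ∈ S, c b ≠ 0) →
    ∃ a : Fin k → ℕ, 2 ^ nsupp a ≤ #S ∧ ∑ b ∈ S, c b * ∏ i, ((b i).choose (a i) : K) ≠ 0 := by
  classical
  intro k
  induction k with
  | zero =>
    rintro S c ⟨b, hb⟩ hc
    have : S = {b} := by ext x; simp [Subsingleton.elim x b, hb]
    exact ⟨b, by simp [nsupp, this], by simpa [this] using hc b hb⟩
  | succ k ih =>
    intro S c hS hc
    let E := S.image fun b => b 0
    let fib : ℕ → Finset (Fin k → ℕ) := fun e => (S.filter fun b => b 0 = e).image Fin.tail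
    have hfib : ∀ {e b'}, b' ∈ fib e ↔ (Fin.cons e b' : Fin (k + 1) → ℕ) ∈ S := by
      intro e b'
      simp only [fib, mem_image, mem_filter]
      constructor
      · rintro ⟨b, ⟨hb, rfl⟩, rfl⟩
        rwa [Fin.cons_self_tail]
      · intro h
        exact ⟨_, ⟨h, rfl⟩, rfl⟩
    have hinj : ∀ e, Set.InjOn (Fin.tail : (Fin (k + 1) → ℕ) → _)
        ((S.filter fun b => b 0 = e : Finset _) : Set (Fin (k + 1) → ℕ)) := by
      intro e b hb b' hb' h
      simp only [coe_filter, Set.mem_ofPred_eq] at hb hb'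
      rw [← Fin.cons_self_tail b, ← Fin.cons_self_tail b', h, hb.2, hb'.2]
    have hcard : ∀ e, #(fib e) = #(S.filter fun b => b 0 = e) := fun e =>
      card_image_of_injOn (hinj e)
    let h : (Fin k → ℕ) → ℕ → K := fun a' e =>
      ∑ b' ∈ fib e, c (Fin.cons e b') * ∏ i, ((b' i).choose (a' i) : K)
    have hsum : ∀ (e₀ : ℕ) (a' : Fin k → ℕ),
        ∑ b ∈ S, c b * ∏ i, ((b i).choose ((Fin.cons e₀ a' : Fin (k + 1) → ℕ) i) : K) =
          ∑ e ∈ E, (e.choose e₀ : K) * h a' e := by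
      intro e₀ a'
      rw [← sum_fiberwise_of_maps_to (g := fun b => b 0) (t := E)
        (fun b hb => mem_image_of_mem _ hb)]
      refine sum_congr rfl fun e _ => ?_
      simp only [h, fib]
      rw [sum_image (hinj e), mul_sum]
      refine sum_congr rfl fun b hb => ?_
      obtain rfl := (mem_filter.1 hb).2
      rw [Fin.cons_self_tail, Fin.prod_univ_succ]
      simp only [Fin.cons_zero, Fin.cons_succ, Fin.tail]
      ring
    have hfibS : ∀ e ∈ E, (fib e).Nonempty := by
      intro e he
      obtain ⟨b, hb, rfl⟩ := mem_image.1 he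
      exact ⟨Fin.tail b, hfib.2 (by rwa [Fin.cons_self_tail])⟩
    have hIH : ∀ e ∈ E, ∃ a', 2 ^ nsupp a' ≤ #(fib e) ∧ h a' e ≠ 0 := fun e he =>
      ih (fib e) (fun b' => c (Fin.cons e b')) (hfibS e he) fun b' hb' => hc _ (hfib.1 hb')
    obtain ⟨b₀, hb₀⟩ := hS
    have he₀ : b₀ 0 ∈ E := mem_image_of_mem _ hb₀
    -- If the first exponent is constant on `S`, the new entry is `0`, whose binomial coefficients
    -- are all `1`, and the support does not grow.
    by_cases hE : ∀ e ∈ E, e = b₀ 0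
    · obtain ⟨a', h1, h2⟩ := hIH _ he₀
      have hE' : E = {b₀ 0} := by
        ext e
        exact ⟨fun he => mem_singleton.2 (hE e he), fun he => mem_singleton.1 he ▸ he₀⟩
      refine ⟨Fin.cons 0 a', ?_, ?_⟩
      · rw [nsupp_cons]
        simpa using h1.trans ((hcard _).trans_le (card_filter_le _ _))
      · rw [hsum, hE']
        simpa using h2
    · push Not at hE
      obtain ⟨e₁, he₁, hne⟩ := hE
      -- Of two different fibres one has at most half of the elements, and this pays for one more
      -- support element.
      have hhalf : ∃ e ∈ E, 2 * #(fib e) ≤ #S := by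
        have : #(fib e₁) + #(fib (b₀ 0)) ≤ #S := by
          rw [hcard, hcard, ← card_union_of_disjoint]
          · exact card_le_card (union_subset (filter_subset _ _) (filter_subset _ _))
          · exact disjoint_filter.2 fun b _ h1 h2 => hne (h1.symm.trans h2)
        by_cases hle : #(fib e₁) ≤ #(fib (b₀ 0))
        · exact ⟨e₁, he₁, by omega⟩
        · exact ⟨_, he₀, by omega⟩
      obtain ⟨e, he, hle⟩ := hhalf
      obtain ⟨a', h1, h2⟩ := hIH e he
      -- With `m` the largest exponent whose fibre sum is nonzero, larger exponents contribute
      -- nothing, smaller ones have `choose e' m = 0`, and `choose m m = 1`. Hence exactly one term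
      -- survives, in every characteristic.
      obtain ⟨m, hm, hmax⟩ := exists_max_image (E.filter fun e => h a' e ≠ 0) id
        ⟨e, mem_filter.2 ⟨he, h2⟩⟩
      refine ⟨Fin.cons m a', ?_, ?_⟩
      · rw [nsupp_cons, pow_add]
        refine (Nat.mul_le_mul (?_ : _ ≤ 2) h1).trans hle
        split_ifs <;> simp
      · rw [hsum, sum_eq_single m]
        · simpa using (mem_filter.1 hm).2
        · intro e' he' hne'
          by_cases hz : h a' e' = 0
          · rw [hz, mul_zero]
          · have : e' ≤ m := hmax e' (mem_filter.2 ⟨he', hz⟩)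
            rw [Nat.choose_eq_zero_of_lt (lt_of_le_of_ne this hne'), Nat.cast_zero, zero_mul]
        · exact fun hn => absurd (mem_filter.1 hm).1 hn

section Conc
variable {ι : Type}

/-- The family `B` of coefficients of a matrix-valued polynomial is concentrated on supports of size
at most `L`: a linear functional that vanishes on these coefficients vanishes on all. -/
def Conc {K : Type*} [CommRing K] {k : ℕ} (L : ℕ) (B : (Fin k → ℕ) → Matrix ι ι K) : Prop :=
  ∀ φ : Matrix ι ι K →ₗ[K] K, (∀ a, nsupp a ≤ L → φ (B a) = 0) → ∀ a, φ (B a) = 0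

/-- A weight of exponent vectors. -/
def wt {k : ℕ} (W a : Fin k → ℕ) : ℕ := ∑ i, W i * a i

/-- The weight `W` isolates the monomials of degree at most `D` (among those of individual
degree `< d`), and among monomials of different degrees it prefers those of lower degree. -/
structure Isolating {k : ℕ} (d D : ℕ) (W : Fin k → ℕ) : Prop where
  inj : ∀ a b : Fin k → ℕ, (∀ i, a i < d) → (∀ i, b i < d) → ∑ i, a i ≤ D → ∑ i, b i ≤ D →
    wt W a = wt W b → a = b
  lt : ∀ a b : Fin k → ℕ, (∀ i, a i < d) → (∀ i, b i < d) → ∑ i, a i < ∑ i, b i → wt W a < wt W b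

variable [Fintype ι]

open Polynomial in
/-- Shifting by an isolating weight improves the concentration to supports of size
`lg (dimension)`. -/
theorem Conc.shift {K : Type*} [CommRing K] [IsDomain K] {k d M : ℕ}
    {B : (Fin k → ℕ) → Matrix ι ι K} (hB : ∀ a, ∀ i, d ≤ a i → B a = 0) (hM : Conc M B)
    {W : Fin k → ℕ} (hW : Isolating d (M * (d - 1)) W) {L : ℕ}
    (hL : ∀ s, 2 ^ s ≤ Fintype.card ι * Fintype.card ι → s ≤ L)
    (φ : Matrix ι ι K[X] →ₗ[K[X]] K[X])
    (hφ : ∀ a, nsupp a ≤ L → φ (∑ b ∈ Fintype.piFinset fun _ => range d,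
      (∏ i, ((b i).choose (a i) : K[X]) * (X ^ W i) ^ (b i - a i)) • (B b).map C) = 0)
    (b : Fin k → ℕ) : φ ((B b).map C) = 0 := by
  classical
  by_contra hb
  let g : (Fin k → ℕ) → K[X] := fun b => φ ((B b).map C)
  -- The functional over `K[X]` is split into its coefficients, which are functionals over `K`; the
  -- hypothesis `hM` applies to these.
  let ψ : ℕ → Matrix ι ι K →ₗ[K] K := fun ν =>
    { toFun := fun Y => (φ (Y.map C)).coeff ν
      map_add' := fun Y Z => by
        rw [Matrix.map_add _ (fun a b => C_add), map_add, coeff_add]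
      map_smul' := fun r Y => by
        have : (r • Y).map C = (C r) • Y.map (C : K → K[X]) := by
          ext i j; simp [Matrix.smul_apply]
        rw [this, map_smul, smul_eq_mul, coeff_C_mul, RingHom.id_apply, smul_eq_mul] }
  have hψ : ∀ ν b, ψ ν (B b) = (g b).coeff ν := fun _ _ => rfl
  let box : Finset (Fin k → ℕ) := Fintype.piFinset fun _ => range d
  have hbox : ∀ {b}, b ∈ box ↔ ∀ i, b i < d := by simp [box, Fintype.mem_piFinset]
  have hgbox : ∀ {b}, g b ≠ 0 → b ∈ box := by
    intro b hb
    rw [hbox]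
    by_contra hcon
    push Not at hcon
    obtain ⟨i, hi⟩ := hcon
    refine hb ?_
    simp only [g]
    rw [hB b i hi, Matrix.map_zero _ C_0, map_zero]
  -- Up to the factor `X ^ wt W a`, the term of `b` in the shifted coefficient has order at least
  -- `wt W b` plus the order of `g b`. The least value `μ` of this quantity is attained exactly on
  -- `S`.
  obtain ⟨bm, hbm, hmin⟩ := exists_min_image (box.filter fun b => g b ≠ 0)
    (fun b => wt W b + (g b).natTrailingDegree) ⟨b, mem_filter.2 ⟨hgbox hb, hb⟩⟩
  set μ := wt W bm + (g bm).natTrailingDegree with hμ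
  let S := (box.filter fun b => g b ≠ 0).filter fun b => wt W b + (g b).natTrailingDegree = μ
  have hS : ∀ {b}, b ∈ S ↔ g b ≠ 0 ∧ wt W b + (g b).natTrailingDegree = μ := by
    intro b
    simp only [S, mem_filter]
    exact ⟨fun h => ⟨h.1.2, h.2⟩, fun h => ⟨⟨hgbox h.1, h.1⟩, h.2⟩⟩
  have hmin' : ∀ b, g b ≠ 0 → μ ≤ wt W b + (g b).natTrailingDegree := fun b hb =>
    hmin b (mem_filter.2 ⟨hgbox hb, hb⟩)
  have hc : ∀ b, g b ≠ 0 → (g b).coeff (g b).natTrailingDegree ≠ 0 := fun b hb =>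
    trailingCoeff_nonzero_iff_nonzero.2 hb
  -- By concentration some `a` of support at most `M` has `g a` of order at most that of `g b`. If
  -- `b` had larger degree than `a`, then `a` would have smaller weight and undercut `μ`.
  have hdeg : ∀ b ∈ S, ∑ i, b i ≤ M * (d - 1) := by
    intro b hbS
    obtain ⟨hb0, hbμ⟩ := hS.1 hbS
    by_contra hlt
    have : ∃ a, nsupp a ≤ M ∧ ψ (g b).natTrailingDegree (B a) ≠ 0 := by
      by_contra hcon
      push Not at hcon
      exact hc b hb0 (hM (ψ (g b).natTrailingDegree) hcon b)
    obtain ⟨a, ha, hψa⟩ := this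
    rw [hψ] at hψa
    have hga : g a ≠ 0 := fun h => hψa (by rw [h, coeff_zero])
    have h1 : (g a).natTrailingDegree ≤ (g b).natTrailingDegree := natTrailingDegree_le_of_ne_zero hψa
    have h2 : ∑ i, a i ≤ M * (d - 1) := by
      calc ∑ i, a i = ∑ i with a i ≠ 0, a i := (sum_filter_ne_zero _).symm
        _ ≤ ∑ i with a i ≠ 0, (d - 1) := sum_le_sum fun i _ => by
            have := hbox.1 (hgbox hga) i; omega
        _ ≤ _ := by
            rw [sum_const, smul_eq_mul]
            exact Nat.mul_le_mul_right _ ha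
    have h3 := hW.lt a b (hbox.1 (hgbox hga)) (hbox.1 (hgbox hb0)) (by omega)
    have := hmin' a hga
    omega
  have hind : LinearIndependent K (fun b : S => B b) := by
    rw [Fintype.linearIndependent_iff]
    intro l hl
    by_contra hcon
    push Not at hcon
    obtain ⟨i, hi⟩ := hcon
    -- Weight plus order is constant on `S` and the weights are distinct there. The `b₀` of largest
    -- weight thus has the strictly smallest order among the terms of the relation, and the
    -- coefficient functional at that order sees only `b₀`.
    obtain ⟨b₀, hb₀, hmax⟩ := exists_max_image (univ.filter fun b : S => l b ≠ 0)
      (fun b => wt W b) ⟨i, by simpa using hi⟩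
    have hlb₀ : l b₀ ≠ 0 := by simpa using hb₀
    obtain ⟨hg₀, hμ₀⟩ := hS.1 b₀.2
    have h1 := congr_arg (ψ (g b₀).natTrailingDegree) hl
    rw [map_sum, map_zero, sum_eq_single b₀] at h1
    · rw [map_smul, smul_eq_mul, hψ] at h1
      exact (mul_ne_zero hlb₀ (hc _ hg₀)) h1
    · intro b _ hne
      rw [map_smul, smul_eq_mul, hψ]
      by_cases hlb : l b = 0
      · rw [hlb, zero_mul]
      obtain ⟨hgb, hμb⟩ := hS.1 b.2
      have h2 : wt W b ≤ wt W b₀ := hmax b (by simpa using hlb)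
      have h3 : wt W b ≠ wt W b₀ := fun h => hne <| Subtype.ext <|
        hW.inj _ _ (hbox.1 (hgbox hgb)) (hbox.1 (hgbox hg₀)) (hdeg _ b.2) (hdeg _ b₀.2) h
      rw [coeff_eq_zero_of_lt_natTrailingDegree (by omega), mul_zero]
    · simp
  have hcard : #S ≤ Fintype.card ι * Fintype.card ι := by
    have := hind.fintype_card_le_finrank
    simpa [Module.finrank_matrix] using this
  obtain ⟨a, ha, hsum⟩ := exists_small_support k S (fun b => (g b).coeff (g b).natTrailingDegree)
    ⟨bm, hS.2 ⟨(mem_filter.1 hbm).2, rfl⟩⟩ fun b hb => hc b (hS.1 hb).1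
  have h0 := hφ a (hL _ (ha.trans hcard))
  rw [map_sum] at h0
  -- Multiplying by `X ^ wt W a` cancels the truncated exponents `b i - a i`. The coefficient at `μ`
  -- is then precisely the sum provided by `exists_small_support`.
  have h1 := congr_arg (fun q => (X ^ wt W a * q).coeff μ) h0
  simp only [mul_zero, coeff_zero, mul_sum, finsetSum_coeff, map_smul, smul_eq_mul] at h1
  refine hsum (Eq.trans ?_ h1)
  have hterm : ∀ b : Fin k → ℕ, X ^ wt W a * ((∏ i, ((b i).choose (a i) : K[X]) *
      (X ^ W i) ^ (b i - a i)) * φ ((B b).map C)) =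
      C (∏ i, ((b i).choose (a i) : K)) * (g b * X ^ wt W b) := by
    intro b
    have : X ^ wt W a * (∏ i, ((b i).choose (a i) : K[X]) * (X ^ W i) ^ (b i - a i)) =
        (∏ i, ((b i).choose (a i) : K[X])) * X ^ wt W b := by
      simp only [wt, ← prod_pow_eq_pow_sum, ← prod_mul_distrib]
      refine prod_congr rfl fun i _ => ?_
      by_cases h : a i ≤ b i
      · rw [mul_left_comm, ← pow_mul, ← pow_add, ← mul_add, Nat.add_sub_cancel' h]
      · rw [Nat.choose_eq_zero_of_lt (by omega)]; simp
    rw [← mul_assoc, this]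
    simp only [map_prod, map_natCast, g]
    ring
  simp only [hterm, coeff_C_mul, coeff_mul_X_pow']
  rw [← sum_subset (s₁ := S) (fun b hb => hgbox (hS.1 hb).1)]
  · refine sum_congr rfl fun b hb => ?_
    have := (hS.1 hb).2
    rw [if_pos (by omega), mul_comm]
    congr 2
    omega
  · intro b _ hbS
    by_cases hb0 : g b = 0
    · simp [hb0]
    · have h2 := hmin' b hb0
      have h3 : wt W b + (g b).natTrailingDegree ≠ μ := fun h => hbS (hS.2 ⟨hb0, h⟩)
      split_ifs
      · rw [coeff_eq_zero_of_lt_natTrailingDegree (by omega), mul_zero]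
      · simp

variable [DecidableEq ι]

/-- The coefficient at `a` of the product of the univariate matrix-valued polynomials with
coefficients `A i`, in distinct variables. -/
def blk {K : Type*} [CommRing K] {k : ℕ} (A : Fin k → ℕ → Matrix ι ι K) (a : Fin k → ℕ) :
    Matrix ι ι K :=
  (List.ofFn fun i => A i (a i)).prod

theorem blk_append {K : Type*} [CommRing K] {k l : ℕ} (A : Fin (k + l) → ℕ → Matrix ι ι K)
    (a : Fin k → ℕ) (b : Fin l → ℕ) : blk A (Fin.append a b) =
      blk (fun i => A (Fin.castAdd l i)) a * blk (fun i => A (Fin.natAdd k i)) b := by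
  simp only [blk, List.ofFn_add, List.prod_append]
  simp
  rfl

/-- One factor is handled at a time. With a right factor of small support fixed, `φ` composed with
right multiplication is a functional of the left factor. Once all left factors are reached, left
multiplication does the same for the right factor. -/
theorem Conc.append {K : Type*} [CommRing K] {k l L : ℕ} {A : Fin (k + l) → ℕ → Matrix ι ι K}
    (h₁ : Conc L (blk fun i => A (Fin.castAdd l i))) (h₂ : Conc L (blk fun i => A (Fin.natAdd k i))) :
    Conc (L + L) (blk A) := by
  intro φ hφ c
  have h : ∀ a b, nsupp b ≤ L → φ (blk (fun i => A (Fin.castAdd l i)) a *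
      blk (fun i => A (Fin.natAdd k i)) b) = 0 := by
    intro a b hb
    refine h₁ (φ ∘ₗ LinearMap.mulRight K (blk (fun i => A (Fin.natAdd k i)) b)) (fun a ha => ?_) a
    have := hφ (Fin.append a b) (by rw [nsupp_append]; omega)
    rwa [blk_append] at this
  have := h₂ (φ ∘ₗ LinearMap.mulLeft K (blk (fun i => A (Fin.castAdd l i))
    fun i => c (Fin.castAdd l i))) (fun b hb => h _ b hb) fun i => c (Fin.natAdd k i)
  rw [← Fin.append_castAdd_natAdd (f := c), blk_append]
  exact this

end Conc
/-! ### Products of univariate matrices -/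

section MatEval
open Polynomial
variable {ι : Type} {F : Type u} [Field F]

/-- The shift is undone by the opposite shift, so it cannot annihilate a nonzero polynomial. -/
theorem aeval_sub_aeval_add {K : Type*} [CommRing K] [Algebra F K] {N : ℕ} (s : Fin N → K)
    (f : MvPolynomial (Fin N) F) :
    MvPolynomial.aeval (R := K) (fun w => MvPolynomial.X w - algebraMap K (MvPolynomial (Fin N) K) (s w))
      (MvPolynomial.aeval (fun w => algebraMap K (MvPolynomial (Fin N) K) (s w) + MvPolynomial.X w) f) =
      MvPolynomial.map (algebraMap F K) f := by
  induction f using MvPolynomial.induction_on with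
  | C a => rw [MvPolynomial.aeval_C, IsScalarTower.algebraMap_apply F K (MvPolynomial (Fin N) K),
      AlgHom.commutes, MvPolynomial.map_C, MvPolynomial.algebraMap_eq]
  | add p q hp hq => simp only [map_add, hp, hq]
  | mul_X p w hp =>
    rw [map_mul, map_mul, hp, map_mul, MvPolynomial.aeval_X, map_add, MvPolynomial.aeval_X,
      AlgHom.commutes, MvPolynomial.map_X]
    ring

/-- The coefficients of the univariate matrices `M i (x_i + s i)`. -/
noncomputable def coefShift {K : Type*} [CommRing K] [Algebra F K] {l : ℕ} (s : Fin l → K)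
    (M : Fin l → Matrix ι ι F[X]) (i : Fin l) (e : ℕ) : Matrix ι ι K :=
  (M i).map fun q => (taylor (s i) (q.map (algebraMap F K))).coeff e

theorem natDegree_taylor_map_lt {K : Type*} [CommRing K] [Nontrivial K] [Algebra F K] {q : F[X]} {d : ℕ}
    (hq : q.natDegree < d) (s : K) : (taylor s (q.map (algebraMap F K))).natDegree < d := by
  rwa [natDegree_taylor, natDegree_map]

theorem coefShift_eq_zero {K : Type*} [CommRing K] [Nontrivial K] [Algebra F K] {d l : ℕ}
    {M : Fin l → Matrix ι ι F[X]} (hM : ∀ i a b, (M i a b).natDegree < d) (s : Fin l → K) (i : Fin l)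
    {e : ℕ} (he : d ≤ e) : coefShift s M i e = 0 := by
  ext a b
  exact coeff_eq_zero_of_natDegree_lt ((natDegree_taylor_map_lt (hM i a b) _).trans_le he)

/-- The effect of a further shift on the coefficients. -/
theorem coefShift_add {K : Type*} [CommRing K] [Nontrivial K] [Algebra F K] {d l : ℕ}
    {M : Fin l → Matrix ι ι F[X]} (hM : ∀ i a b, (M i a b).natDegree < d) (s : Fin l → K)
    (y : Fin l → K[X]) (i : Fin l) (e : ℕ) : coefShift (fun i => y i + C (s i)) M i e =
      ∑ e' ∈ range d, ((e'.choose e : K[X]) * y i ^ (e' - e)) • (coefShift s M i e').map C := by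
  ext1 a b
  simp only [coefShift, Matrix.map_apply, Matrix.sum_apply, Matrix.smul_apply, smul_eq_mul]
  have h : (M i a b).map (algebraMap F K[X]) = ((M i a b).map (algebraMap F K)).map C := by
    rw [Polynomial.map_map]; rfl
  -- Successive shifts compose, and the Hasse derivative yields the binomial coefficients without
  -- dividing by factorials.
  rw [← taylor_taylor, h, ← map_taylor, taylor_coeff, hasseDeriv_apply,
    sum_over_range' _ (by simp) d ((natDegree_map_le).trans_lt (natDegree_taylor_map_lt (hM i a b) _)),
    eval_finsetSum]
  refine sum_congr rfl fun e' _ => ?_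
  rw [eval_monomial, coeff_map]
  ring

variable [Fintype ι] [DecidableEq ι]

/-- Expanding a product of linear combinations of matrices. -/
theorem prod_sum_smul {R : Type*} [CommRing R] {k : ℕ} (d : ℕ) (w : Fin k → ℕ → R)
    (A : Fin k → ℕ → Matrix ι ι R) : (List.ofFn fun i => ∑ e ∈ range d, w i e • A i e).prod =
      ∑ b ∈ Fintype.piFinset fun _ => range d, (∏ i, w i (b i)) • blk A b := by
  have h := (MultilinearMap.mkPiAlgebraFin R k (Matrix ι ι R)).map_sum_finset
    (fun i e => w i e • A i e) fun _ => range d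
  simp only [MultilinearMap.map_smul_univ, MultilinearMap.mkPiAlgebraFin_apply] at h
  exact h

theorem map_blk {R S : Type*} [CommRing R] [CommRing S] (f : R →+* S) {k : ℕ}
    (A : Fin k → ℕ → Matrix ι ι R) (b : Fin k → ℕ) :
    (blk A b).map f = blk (fun i e => (A i e).map f) b := by
  have h := map_list_prod f.mapMatrix (List.ofFn fun i => A i (b i))
  rw [List.map_ofFn] at h
  exact h

/-- The value of a bilinear form of the product of univariate matrices. -/
noncomputable def matEval {R : Type*} [CommRing R] [Algebra F R] {l : ℕ}
    (c : Matrix ι ι F) (M : Fin l → Matrix ι ι F[X]) (y : Fin l → R) : R :=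
  ∑ a, ∑ b, algebraMap F R (c a b) * (List.ofFn fun i => (M i).map (aeval (y i))).prod a b

theorem map_matEval {R S : Type*} [CommRing R] [Algebra F R] [CommRing S] [Algebra F S]
    (f : R →ₐ[F] S) {l : ℕ} (c : Matrix ι ι F) (M : Fin l → Matrix ι ι F[X]) (y : Fin l → R) :
    f (matEval c M y) = matEval c M fun i => f (y i) := by
  simp only [matEval, map_sum, map_mul, AlgHom.commutes]
  refine sum_congr rfl fun a _ => sum_congr rfl fun b _ => ?_
  have h := map_list_prod f.mapMatrix (List.ofFn fun i => (M i).map (aeval (y i)))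
  have h' : (⇑f.mapMatrix ∘ fun i => (M i).map (aeval (y i))) =
      fun i => (M i).map (aeval (f (y i))) := by
    ext i j k
    simp [aeval_algHom_apply]
  rw [List.map_ofFn, h'] at h
  rw [← h]
  rfl

theorem blk_coefShift_eq_zero {K : Type*} [CommRing K] [Nontrivial K] [Algebra F K] {d l : ℕ}
    {M : Fin l → Matrix ι ι F[X]} (hM : ∀ i a b, (M i a b).natDegree < d) (s : Fin l → K)
    (a : Fin l → ℕ) (i : Fin l) (hi : d ≤ a i) : blk (coefShift s M) a = 0 := by
  exact List.prod_eq_zero (List.mem_ofFn.2 ⟨i, coefShift_eq_zero hM s i hi⟩)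

/-- Evaluation at shifted points. -/
theorem matEval_add {K R : Type*} [CommRing K] [Nontrivial K] [Algebra F K] [CommRing R] [Algebra K R] [Algebra F R]
    [IsScalarTower F K R] {d l : ℕ} {M : Fin l → Matrix ι ι F[X]}
    (hM : ∀ i a b, (M i a b).natDegree < d) (c : Matrix ι ι F) (s : Fin l → K) (y : Fin l → R) :
    matEval c M (fun i => algebraMap K R (s i) + y i) =
      ∑ b ∈ Fintype.piFinset fun _ => range d, (∏ i, y i ^ b i) * algebraMap K R
        (∑ p, ∑ q, algebraMap F K (c p q) * blk (coefShift s M) b p q) := by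
  have h1 : ∀ i, (M i).map (aeval (algebraMap K R (s i) + y i)) =
      ∑ e ∈ range d, y i ^ e • (coefShift s M i e).map (algebraMap K R) := by
    intro i
    ext1 a b
    simp only [coefShift, Matrix.map_apply, Matrix.sum_apply, Matrix.smul_apply, smul_eq_mul]
    have h2 : aeval (algebraMap K R (s i) + y i) (M i a b) =
        aeval (y i) (taylor (s i) ((M i a b).map (algebraMap F K))) := by
      rw [taylor_apply, aeval_comp, aeval_map_algebraMap]
      simp [add_comm]
    rw [h2, aeval_eq_sum_range' (natDegree_taylor_map_lt (hM i a b) _)]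
    exact sum_congr rfl fun e _ => by rw [Algebra.smul_def, mul_comm]
  simp only [matEval, h1, prod_sum_smul, ← map_blk, Matrix.sum_apply, Matrix.smul_apply, smul_eq_mul,
    Matrix.map_apply, map_sum, map_mul, mul_sum, ← IsScalarTower.algebraMap_apply]
  exact (sum_congr rfl fun a _ => sum_comm).trans (sum_comm.trans (sum_congr rfl fun b _ =>
    sum_congr rfl fun p _ => sum_congr rfl fun q _ => by ring))

/-! ### Isolating weights on selected variables, and the merge-and-shift induction -/

theorem wt_comp {N l : ℕ} {v : Fin l → Fin N} (hv : Function.Injective v) (W : Fin N → ℕ) (a : Fin l → ℕ) :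
    wt (fun i => W (v i)) a = wt W (Function.extend v a 0) :=
  Fintype.sum_of_injective v hv _ _
    (fun i hi => by rw [Function.extend_apply' _ _ _ (by simpa using hi)]; simp)
    fun i => by rw [hv.extend_apply]

theorem sum_extend {N l : ℕ} {v : Fin l → Fin N} (hv : Function.Injective v) (a : Fin l → ℕ) :
    ∑ i, a i = ∑ i, Function.extend v a 0 i :=
  Fintype.sum_of_injective v hv _ _
    (fun i hi => by rw [Function.extend_apply' _ _ _ (by simpa using hi)]; simp)
    fun i => by rw [hv.extend_apply]

/-- Exponent vectors on the chosen variables are extended by zero, which changes neither weight nor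
degree. One weight therefore serves for all factors in every order. -/
theorem Isolating.comp {N l d D : ℕ} (hd : 0 < d) {W : Fin N → ℕ} (hW : Isolating d D W) {v : Fin l → Fin N}
    (hv : Function.Injective v) : Isolating d D fun i => W (v i) := by
  have hlt : ∀ a : Fin l → ℕ, (∀ i, a i < d) → ∀ i, Function.extend v a 0 i < d := by
    intro a ha i
    by_cases h : ∃ j, v j = i
    · obtain ⟨j, rfl⟩ := h
      rw [hv.extend_apply]; exact ha j
    · rw [Function.extend_apply' _ _ _ h]; exact hd
  refine ⟨fun a b ha hb ha' hb' h => ?_, fun a b ha hb h => ?_⟩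
  · have := hW.inj _ _ (hlt a ha) (hlt b hb) (by rwa [← sum_extend hv]) (by rwa [← sum_extend hv])
      (by rwa [← wt_comp hv, ← wt_comp hv])
    ext i
    simpa [hv.extend_apply] using congr_fun this (v i)
  · rw [wt_comp hv, wt_comp hv]
    exact hW.lt _ _ (hlt a ha) (hlt b hb) (by rwa [← sum_extend hv, ← sum_extend hv])

/-- Products of at most `2 ^ j` univariate matrices become concentrated on small supports after the
sum of `j` independent isolating shifts. -/
theorem exists_conc {N d L : ℕ} (hd : 0 < d) {W : Fin N → ℕ} (hW : Isolating d ((L + L) * (d - 1)) W)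
    (hL1 : 1 ≤ L) (hL : ∀ s, 2 ^ s ≤ Fintype.card ι * Fintype.card ι → s ≤ L) (j : ℕ) :
    ∃ (K : Type u) (_ : CommRing K) (_ : IsDomain K) (_ : Algebra F K) (τ : Fin j → K),
      ∀ l ≤ 2 ^ j, ∀ v : Fin l → Fin N, Function.Injective v → ∀ M : Fin l → Matrix ι ι F[X],
        (∀ i a b, (M i a b).natDegree < d) →
        Conc L (blk (coefShift (fun i => ∑ t, τ t ^ W (v i)) M)) := by
  induction j with
  | zero =>
    -- At most one variable is present, so every support has size at most `1 ≤ L`.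
    refine ⟨F, inferInstance, inferInstance, inferInstance, Fin.elim0, fun l hl v hv M hM φ hφ a =>
      hφ a (le_trans ?_ hL1)⟩
    exact (card_le_univ _).trans (by simpa using hl)
  | succ j ih =>
    obtain ⟨K, _, _, _, τ, ih⟩ := ih
    refine ⟨K[X], inferInstance, inferInstance, inferInstance,
      Fin.cons X fun t => C (τ t), fun l hl v hv M hM φ hφ a => ?_⟩
    let s : Fin l → K := fun i => ∑ t, τ t ^ W (v i)
    have hs : (fun i => ∑ t, (Fin.cons X fun t => C (τ t) : Fin (j + 1) → K[X]) t ^ W (v i)) =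
        fun i => X ^ W (v i) + C (s i) := by
      ext1 i
      simp [Fin.sum_univ_succ, s]
    -- The induction hypothesis covers every injective choice of variables, so both halves are
    -- concentrated under the same shift `s`. The fresh variable `X` then brings `L + L` back to
    -- `L`.
    have hconc : Conc (L + L) (blk (coefShift s M)) := by
      obtain ⟨l₁, l₂, rfl, h₁, h₂⟩ : ∃ l₁ l₂, l = l₁ + l₂ ∧ l₁ ≤ 2 ^ j ∧ l₂ ≤ 2 ^ j := by
        rw [pow_succ] at hl
        exact ⟨min l (2 ^ j), l - 2 ^ j, by omega, by omega, by omega⟩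
      exact Conc.append
        (ih l₁ h₁ (fun i => v (Fin.castAdd l₂ i)) (fun i i' h => by simpa using hv h)
          (fun i => M (Fin.castAdd l₂ i)) fun i => hM _)
        (ih l₂ h₂ (fun i => v (Fin.natAdd l₁ i)) (fun i i' h => by simpa using hv h)
          (fun i => M (Fin.natAdd l₁ i)) fun i => hM _)
    rw [hs] at hφ ⊢
    have hexp : ∀ a, blk (coefShift (fun i => X ^ W (v i) + C (s i)) M) a =
        ∑ b ∈ Fintype.piFinset fun _ => range d,
          (∏ i, ((b i).choose (a i) : K[X]) * (X ^ W (v i)) ^ (b i - a i)) •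
            (blk (coefShift s M) b).map C := by
      intro a
      simp only [map_blk]
      rw [← prod_sum_smul d (fun i e' => (e'.choose (a i) : K[X]) * (X ^ W (v i)) ^ (e' - a i))]
      simp only [blk, coefShift_add hM]
    have := hconc.shift (blk_coefShift_eq_zero hM s) (hW.comp hd hv) hL φ fun a ha => by
      rw [← hexp]; exact hφ a ha
    rw [hexp, map_sum]
    exact sum_eq_zero fun b _ => by rw [map_smul, this, smul_zero]

/-- A nonzero polynomial that is computed by a product of at most `2 ^ j` univariate matrices in distinct
variables remains nonzero after the sum of `j` independent isolating shifts, even if all but `L`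
variables are set to zero thereafter. -/
theorem exists_shift_ne_zero {N d L : ℕ} (hd : 0 < d) {W : Fin N → ℕ}
    (hW : Isolating d ((L + L) * (d - 1)) W) (hL1 : 1 ≤ L)
    (hL : ∀ s, 2 ^ s ≤ Fintype.card ι * Fintype.card ι → s ≤ L) {j l : ℕ} (hl : l ≤ 2 ^ j)
    {v : Fin l → Fin N} (hv : Function.Injective v) {M : Fin l → Matrix ι ι F[X]}
    (hM : ∀ i a b, (M i a b).natDegree < d) {c : Matrix ι ι F} {f : MvPolynomial (Fin N) F}
    (hf : f = matEval c M fun i => MvPolynomial.X (v i)) (hf0 : f ≠ 0) :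
    ∃ (K : Type u) (_ : CommRing K) (_ : IsDomain K) (_ : Algebra F K) (τ : Fin j → K)
      (S : Finset (Fin N)) (y : Fin N → MvPolynomial (Fin l) K), #S ≤ L ∧ (∀ w ∉ S, y w = 0) ∧
      MvPolynomial.aeval (fun w => MvPolynomial.C (∑ t, τ t ^ W w) + y w) f ≠ 0 := by
  classical
  obtain ⟨K, i₁, i₂, i₃, τ, hK⟩ := exists_conc (F := F) (ι := ι) hd hW hL1 hL j
  let s : Fin N → K := fun w => ∑ t, τ t ^ W w
  have hconc := hK l hl v hv M hM
  let φ : Matrix ι ι K →ₗ[K] K :=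
    { toFun := fun Y => ∑ p, ∑ q, algebraMap F K (c p q) * Y p q
      map_add' := fun Y Z => by simp [mul_add, sum_add_distrib]
      map_smul' := fun r Y => by simp [mul_sum, mul_left_comm] }
  -- Otherwise every coefficient of the shifted polynomial would vanish, and shifting back would
  -- give `f = 0`.
  have hex : ∃ b, φ (blk (coefShift (fun i => s (v i)) M) b) ≠ 0 := by
    by_contra hcon
    push Not at hcon
    have h0 : MvPolynomial.aeval (fun w => algebraMap K (MvPolynomial (Fin N) K) (s w) +
        MvPolynomial.X w) f = 0 := by
      rw [hf, map_matEval]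
      simp only [MvPolynomial.aeval_X]
      rw [matEval_add hM c (fun i => s (v i)) fun i => MvPolynomial.X (v i)]
      refine sum_eq_zero fun b _ => ?_
      have := hcon b
      simp only [φ, LinearMap.coe_mk, AddHom.coe_mk] at this
      rw [this, map_zero, mul_zero]
    have h1 := congr_arg (MvPolynomial.aeval (R := K) fun w => MvPolynomial.X w -
      algebraMap K (MvPolynomial (Fin N) K) (s w)) h0
    rw [aeval_sub_aeval_add, map_zero] at h1
    exact hf0 (MvPolynomial.map_injective _ (algebraMap F K).injective (by rw [h1, map_zero]))
  have : ∃ a, nsupp a ≤ L ∧ φ (blk (coefShift (fun i => s (v i)) M) a) ≠ 0 := by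
    by_contra hcon
    push Not at hcon
    obtain ⟨b, hb⟩ := hex
    exact hb (hconc φ hcon b)
  obtain ⟨a, ha, hφa⟩ := this
  -- Only the variables in the support of `a` are kept. The monomial with exponent `a` survives this
  -- with unchanged coefficient.
  let z : Fin l → MvPolynomial (Fin l) K := fun i => if a i ≠ 0 then MvPolynomial.X i else 0
  have hz : ∀ b : Fin l → ℕ, (∏ i, z i ^ b i) = if ∀ i, a i = 0 → b i = 0 then
      MvPolynomial.monomial (Finsupp.equivFunOnFinite.symm b) 1 else 0 := by
    intro b
    split_ifs with h
    · rw [MvPolynomial.monomial_eq, Finsupp.prod_fintype _ _ (by simp), map_one, one_mul]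
      refine prod_congr rfl fun i _ => ?_
      by_cases hi : a i = 0
      · simp [h i hi]
      · simp [z, hi]
    · push Not at h
      obtain ⟨i, hi, hbi⟩ := h
      exact prod_eq_zero (mem_univ i) (by simp [z, hi, hbi])
  refine ⟨K, i₁, i₂, i₃, τ, (univ.filter fun i => a i ≠ 0).image v, Function.extend v z 0,
    card_image_le.trans ha, fun w hw => ?_, fun h0 => hφa ?_⟩
  · by_cases h : ∃ i, v i = w
    · obtain ⟨i, rfl⟩ := h
      rw [hv.extend_apply]
      simp only [mem_image, mem_filter, mem_univ, true_and, not_exists, not_and] at hw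
      simp only [z]
      rw [if_neg fun h => hw i h rfl]
    · rw [Function.extend_apply' _ _ _ h]; rfl
  · rw [hf, map_matEval] at h0
    simp only [MvPolynomial.aeval_X, hv.extend_apply] at h0
    have h1 := matEval_add hM c (fun i => s (v i)) z
    rw [MvPolynomial.algebraMap_eq, h0] at h1
    have h2 := congr_arg (MvPolynomial.coeff (Finsupp.equivFunOnFinite.symm a)) h1
    rw [MvPolynomial.coeff_zero, MvPolynomial.coeff_sum, sum_eq_single a] at h2
    · rw [hz, if_pos fun _ h => h, mul_comm, MvPolynomial.coeff_C_mul, MvPolynomial.coeff_monomial,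
        if_pos rfl, mul_one] at h2
      exact h2.symm
    · intro b _ hb
      rw [hz]
      split_ifs
      · rw [mul_comm, MvPolynomial.coeff_C_mul, MvPolynomial.coeff_monomial,
          if_neg fun h => hb (Finsupp.equivFunOnFinite.symm.injective h), mul_zero]
      · simp
    · intro hna
      obtain ⟨i, hi⟩ : ∃ i, d ≤ a i := by simpa [Fintype.mem_piFinset] using hna
      exact absurd (by rw [blk_coefShift_eq_zero hM _ a i hi, map_zero]) hφa

end MatEval
/-! ### Klivans-Spielman weights -/

theorem ksPrime_prime (N d : ℕ) : (ksPrime N d).Prime :=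
  (Nat.find_spec (Nat.exists_infinite_primes ((N * d) ^ 3))).2

theorem le_ksPrime (N d : ℕ) : (N * d) ^ 3 ≤ ksPrime N d :=
  (Nat.find_spec (Nat.exists_infinite_primes ((N * d) ^ 3))).1

/-- Bertrand's postulate. -/
theorem ksPrime_le {N d : ℕ} (h : N * d ≠ 0) : ksPrime N d ≤ 2 * (N * d) ^ 3 := by
  obtain ⟨p, hp, h1, h2⟩ := Nat.exists_prime_lt_and_le_two_mul ((N * d) ^ 3) (by positivity)
  exact (Nat.find_min' _ ⟨h1.le, hp⟩).trans h2

/-- There are few monomials of degree at most `D`. -/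
theorem exists_monomials {N : ℕ} (hN : 2 ≤ N) (D : ℕ) : ∃ T : Finset (Fin N → ℕ),
    (∀ a : Fin N → ℕ, ∑ i, a i ≤ D → a ∈ T) ∧ #T + 1 ≤ N ^ (D + 1) := by
  classical
  induction D with
  | zero => exact ⟨{0}, fun a ha => by
      rw [mem_singleton]; ext i
      simpa using (single_le_sum (fun _ _ => Nat.zero_le _) (mem_univ i)).trans ha, by simpa⟩
  | succ D ih =>
    obtain ⟨T, hT, hc⟩ := ih
    refine ⟨insert 0 (univ.biUnion fun v : Fin N => T.image fun a => a + Pi.single v 1),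
      fun a ha => ?_, ?_⟩
    · by_cases h : a = 0
      · simp [h]
      obtain ⟨v, hv⟩ : ∃ v, a v ≠ 0 := by
        by_contra hcon
        push Not at hcon
        exact h (funext hcon)
      refine mem_insert_of_mem (mem_biUnion.2 ⟨v, mem_univ _, mem_image.2 ⟨a - Pi.single v 1, hT _ ?_, ?_⟩⟩)
      · have hle : Pi.single v 1 ≤ a := by
          intro i
          by_cases hi : i = v
          · subst hi; simp; omega
          · simp [hi]
        have : ∑ i, (a - Pi.single v 1 : Fin N → ℕ) i + ∑ i, (Pi.single v 1 : Fin N → ℕ) i = ∑ i, a i := by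
          rw [← sum_add_distrib]
          exact sum_congr rfl fun i _ => Nat.sub_add_cancel (hle i)
        have h1 : ∑ i, (Pi.single v 1 : Fin N → ℕ) i = 1 := by simp
        omega
      · ext i
        simp only [Pi.add_apply, Pi.sub_apply, Pi.single_apply]
        split_ifs with hi
        · subst hi; omega
        · omega
    · have h1 : #(univ.biUnion fun v : Fin N => T.image fun a => a + Pi.single v 1) ≤ N * #T := by
        refine card_biUnion_le.trans ((sum_le_card_nsmul _ _ #T fun v _ => card_image_le).trans ?_)
        simp
      have h2 := card_insert_le (0 : Fin N → ℕ)
        (univ.biUnion fun v : Fin N => T.image fun a => a + Pi.single v 1)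
      -- The summand `1` in the bound absorbs the inserted zero vector: `N * #T + 2 ≤ N * (#T + 1)`
      -- because `2 ≤ N`.
      have h3 : N * (#T + 1) ≤ N ^ (D + 1 + 1) := by
        rw [pow_succ' _ (D + 1)]
        exact Nat.mul_le_mul_left _ hc
      rw [mul_add] at h3
      omega

/-- Distinct exponent vectors collide for at most `N` values of the parameter. -/
theorem card_collisions_le {N d p : ℕ} [Fact p.Prime] (hdp : d ≤ p) {a b : Fin N → ℕ}
    (ha : ∀ i, a i < d) (hb : ∀ i, b i < d) (hab : a ≠ b) :
    #{k : Fin p | ∑ i, a i * ((k : ℕ) ^ ((i : ℕ) + 1) % p) = ∑ i, b i * ((k : ℕ) ^ ((i : ℕ) + 1) % p)} ≤ N := by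
  classical
  -- Colliding parameters are roots of `q` modulo `p`. It is nonzero because the entries of `a` and
  -- `b` are below `d ≤ p`, so they do not become congruent.
  let q : Polynomial (ZMod p) := ∑ i : Fin N, Polynomial.monomial ((i : ℕ) + 1) ((a i : ZMod p) - b i)
  have hq : q ≠ 0 := by
    intro h0
    refine hab (funext fun i => ?_)
    have h1 := congr_arg (fun q => Polynomial.coeff q ((i : ℕ) + 1)) h0
    simp only [q, Polynomial.finsetSum_coeff, Polynomial.coeff_monomial, Polynomial.coeff_zero] at h1
    rw [sum_eq_single i (fun j _ hj => if_neg (by simpa [Fin.val_inj] using hj)) (by simp),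
      if_pos rfl, sub_eq_zero, ZMod.natCast_eq_natCast_iff] at h1
    exact Nat.ModEq.eq_of_lt_of_lt h1 ((ha i).trans_le hdp) ((hb i).trans_le hdp)
  have hdeg : q.natDegree ≤ N := Polynomial.natDegree_sum_le_of_forall_le _ _ fun i _ =>
    (Polynomial.natDegree_monomial_le _).trans (by omega)
  refine le_trans ?_ ((Multiset.toFinset_card_le q.roots).trans (q.card_roots'.trans hdeg))
  refine card_le_card_of_injOn (fun k => ((k : ℕ) : ZMod p)) (fun k hk => ?_) fun k _ k' _ h => ?_
  · simp only [coe_filter, mem_univ, true_and, Set.mem_ofPred_eq] at hk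
    rw [mem_coe, Multiset.mem_toFinset, Polynomial.mem_roots hq, Polynomial.IsRoot.def]
    have h2 := congr_arg (Nat.cast (R := ZMod p)) hk
    simp only [Nat.cast_sum, Nat.cast_mul, ZMod.natCast_mod, Nat.cast_pow] at h2
    simp only [q, Polynomial.eval_finsetSum, Polynomial.eval_monomial, sub_mul, sum_sub_distrib, h2,
      sub_self]
  · rw [ZMod.natCast_eq_natCast_iff] at h
    exact Fin.ext (Nat.ModEq.eq_of_lt_of_lt h k.2 k'.2)

/-- The exponents of the Klivans-Spielman generator for the parameters `k`. -/
def ksExp {p m : ℕ} (k : Fin m → Fin p) (i : ℕ) (j : Fin m) : ℕ := (k j : ℕ) ^ (i + 1) % p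

/-- For suitable parameters, the Klivans-Spielman map is injective on a given set of monomials. -/
theorem exists_ks_injOn {N d S : ℕ} (hN : 2 ≤ N) (hd : 1 ≤ d) (T : Finset (Fin N → ℕ))
    (hT : ∀ a ∈ T, ∀ i, a i < d) (hTS : #T ≤ S) :
    ∃ k : Fin (ksSeed N d S) → Fin (ksPrime N d), Set.InjOn
      (fun (a : Fin N → ℕ) j => ∑ i, a i * ksExp k i j) (T : Set (Fin N → ℕ)) := by
  classical
  set p := ksPrime N d
  set m := ksSeed N d S
  have : Fact p.Prime := ⟨ksPrime_prime N d⟩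
  have hNd : 1 < N * d := by nlinarith
  have hp : (N * d) ^ 3 ≤ p := le_ksPrime N d
  have hdp : d ≤ p := by
    refine le_trans ?_ hp
    calc d ≤ N * d := Nat.le_mul_of_pos_left _ (by omega)
      _ ≤ (N * d) ^ 3 := Nat.le_self_pow (by norm_num) _
  have hSm : S < (N * d) ^ m := Nat.lt_pow_succ_log_self hNd S
  by_contra hcon
  push Not at hcon
  -- A tuple `k` fails for a pair only if all `m` components collide, which leaves at most `N ^ m`
  -- tuples out of `p ^ m`.
  let bad : (Fin N → ℕ) × (Fin N → ℕ) → Finset (Fin m → Fin p) := fun q =>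
    Fintype.piFinset fun _ => {k : Fin p | ∑ i, q.1 i * ((k : ℕ) ^ ((i : ℕ) + 1) % p) =
      ∑ i, q.2 i * ((k : ℕ) ^ ((i : ℕ) + 1) % p)}
  have hbad : ∀ q ∈ (T ×ˢ T).filter fun q => q.1 ≠ q.2, #(bad q) ≤ N ^ m := by
    rintro ⟨a, b⟩ hq
    simp only [mem_filter, mem_product] at hq
    simp only [bad, Fintype.card_piFinset, prod_const, card_univ, Fintype.card_fin]
    exact Nat.pow_le_pow_left (card_collisions_le hdp (hT a hq.1.1) (hT b hq.1.2) hq.2) m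
  have hcov : (univ : Finset (Fin m → Fin p)) ⊆ ((T ×ˢ T).filter fun q => q.1 ≠ q.2).biUnion bad := by
    intro k _
    have h1 := hcon k
    simp only [Set.InjOn] at h1
    push Not at h1
    obtain ⟨a, ha, b, hb, h2, h3⟩ := h1
    refine mem_biUnion.2 ⟨(a, b), mem_filter.2 ⟨mem_product.2 ⟨ha, hb⟩, h3⟩, ?_⟩
    simp only [bad, Fintype.mem_piFinset, mem_filter, mem_univ, true_and]
    exact fun j => congr_fun h2 j
  have h1 := (card_le_card hcov).trans (card_biUnion_le.trans (sum_le_card_nsmul _ _ _ hbad))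
  simp only [card_univ, Fintype.card_fun, Fintype.card_fin, smul_eq_mul] at h1
  have h2 : #((T ×ˢ T).filter fun q => q.1 ≠ q.2) ≤ S * S :=
    (card_filter_le _ _).trans (by rw [card_product]; exact Nat.mul_le_mul hTS hTS)
  -- Of the three factors `N * d` bounded by `p`, two pay for the fewer than `(N * d) ^ (2 * m)`
  -- pairs and the third for the collisions of one pair.
  have h3 : (N * d) ^ m * (N * d) ^ m * N ^ m ≤ p ^ m := by
    rw [← mul_pow, ← mul_pow]
    refine Nat.pow_le_pow_left (le_trans ?_ hp) m
    calc N * d * (N * d) * N ≤ N * d * (N * d) * (N * d) :=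
          Nat.mul_le_mul_left _ (Nat.le_mul_of_pos_right _ hd)
      _ = (N * d) ^ 3 := by ring
  have h4 : S * S < (N * d) ^ m * (N * d) ^ m := Nat.mul_lt_mul'' hSm hSm
  have h5 : S * S * N ^ m < (N * d) ^ m * (N * d) ^ m * N ^ m :=
    Nat.mul_lt_mul_of_pos_right h4 (by positivity)
  have h6 := Nat.mul_le_mul_right (N ^ m) h2
  omega

/-- Integers `e j` such that distinct vectors of numbers `< t` have distinct products with `e`. -/
theorem exists_kronecker (m t : ℕ) : ∃ e : Fin m → ℕ, ∀ x y : Fin m → ℕ, (∀ j, x j < t) → (∀ j, y j < t) →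
    ∑ j, e j * x j = ∑ j, e j * y j → x = y := by
  refine ⟨fun j => t ^ (j : ℕ), fun x y hx hy h => ?_⟩
  have h1 : finFunctionFinEquiv (fun j => (⟨x j, hx j⟩ : Fin t)) =
      finFunctionFinEquiv (fun j => (⟨y j, hy j⟩ : Fin t)) := by
    ext
    simp only [finFunctionFinEquiv_apply]
    simpa [mul_comm] using h
  ext j
  simpa using congr_arg Fin.val (congr_fun (finFunctionFinEquiv.injective h1) j)

/-- Isolating weights from the Klivans-Spielman generator. -/
theorem exists_isolating {N d S D : ℕ} (hN : 2 ≤ N) (hd : 1 ≤ d) (hS : N ^ (D + 1) ≤ S) :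
    ∃ (k : Fin (ksSeed N d S) → Fin (ksPrime N d)) (E : ℕ) (e : Fin (ksSeed N d S) → ℕ),
      Isolating d D fun i : Fin N => E + ∑ j, e j * ksExp k i j := by
  classical
  obtain ⟨T, hT, hTc⟩ := exists_monomials hN D
  obtain ⟨k, hk⟩ := exists_ks_injOn hN hd (T.filter fun a => ∀ i, a i < d)
    (fun a ha => (mem_filter.1 ha).2) ((card_filter_le _ _).trans (((Nat.le_succ _).trans hTc).trans hS))
  have hbd : ∀ j (a : Fin N → ℕ), (∀ i, a i < d) →
      ∑ i, a i * ksExp k i j < N * (d * ksPrime N d) + 1 := by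
    intro j a ha
    refine Nat.lt_succ_of_le ((sum_le_card_nsmul _ _ (d * ksPrime N d) fun i _ =>
      Nat.mul_le_mul (ha i).le (Nat.mod_lt _ (ksPrime_prime N d).pos).le).trans ?_)
    simp
  obtain ⟨e, he⟩ := exists_kronecker (ksSeed N d S) (N * (d * ksPrime N d) + 1)
  -- `E` exceeds the contribution of the exponents `e j * ksExp k i j` for every admissible vector,
  -- so the degree decides first.
  let E := (∑ j, e j * (N * (d * ksPrime N d) + 1)) + 1
  have hwt : ∀ a : Fin N → ℕ, wt (fun i : Fin N => E + ∑ j, e j * ksExp k i j) a =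
      E * (∑ i, a i) + ∑ j, e j * ∑ i, a i * ksExp k i j := by
    intro a
    simp only [wt, add_mul, sum_add_distrib, mul_sum, sum_mul]
    rw [sum_comm]
    congr 1
    exact sum_congr rfl fun _ _ => sum_congr rfl fun _ _ => by ring
  have hlt : ∀ a : Fin N → ℕ, (∀ i, a i < d) → ∑ j, e j * ∑ i, a i * ksExp k i j < E := fun a ha =>
    Nat.lt_succ_of_le (sum_le_sum fun j _ => Nat.mul_le_mul_left _ (hbd j a ha).le)
  have hord : ∀ a b : Fin N → ℕ, (∀ i, a i < d) → (∀ i, b i < d) → ∑ i, a i < ∑ i, b i →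
      wt (fun i : Fin N => E + ∑ j, e j * ksExp k i j) a <
        wt (fun i : Fin N => E + ∑ j, e j * ksExp k i j) b := by
    intro a b ha hb hab
    rw [hwt, hwt]
    have h1 := hlt a ha
    have h2 : E * (∑ i, a i) + E ≤ E * ∑ i, b i := by
      rw [← Nat.mul_succ]; exact Nat.mul_le_mul_left _ hab
    omega
  refine ⟨k, E, e, fun a b ha hb haD hbD h => ?_, hord⟩
  rcases lt_trichotomy (∑ i, a i) (∑ i, b i) with h1 | h1 | h1
  · exact absurd h (hord a b ha hb h1).ne
  · rw [hwt, hwt, h1] at h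
    exact hk (by simpa using ⟨hT a haD, ha⟩) (by simpa using ⟨hT b hbD, hb⟩)
      (he _ _ (fun j => hbd j a ha) (fun j => hbd j b hb) (Nat.add_left_cancel h))
  · exact absurd h (hord b a hb ha h1).ne'

/-! ### Branching programs as products of univariate matrices -/

/-- The sum over all paths with a given start. -/
theorem sum_paths {R ι : Type*} [CommSemiring R] [Fintype ι] [DecidableEq ι] : ∀ (D : ℕ)
    (M : Fin D → Matrix ι ι R) (a : ι),
    ∑ p : Fin D → ι, ∏ i, M i ((Fin.cons a p : Fin (D + 1) → ι) i.castSucc) (p i) =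
      ∑ b, (List.ofFn M).prod a b
  | 0, M, a => by simp [Matrix.one_apply]
  | D + 1, M, a => by
    rw [← (Fin.consEquiv fun _ : Fin (D + 1) => ι).sum_comp, Fintype.sum_prod_type,
      List.ofFn_succ, List.prod_cons]
    simp only [Matrix.mul_apply]
    refine Eq.trans (sum_congr rfl fun a' _ => ?_) sum_comm
    rw [← mul_sum, ← sum_paths D (fun i => M i.succ) a', mul_sum]
    refine sum_congr rfl fun p _ => ?_
    rw [Fin.prod_univ_succ]
    simp only [Fin.consEquiv_apply, Fin.castSucc_zero, Fin.cons_zero, ← Fin.succ_castSucc, Fin.cons_succ]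

/-- The matrix of the labels in a step of a branching program. -/
def ABP.mat {R : Type u} [Zero R] {D r : ℕ} (A : ABP R D r) (i : Fin D) : Matrix (Fin r) (Fin r) R :=
  fun a b => if h : (a : ℕ) < A.width i.castSucc ∧ (b : ℕ) < A.width i.succ then
    A.weight i ⟨a, h.1⟩ ⟨b, h.2⟩ else 0

/-- All layers are padded to size `r` by zero edges. A path through an added vertex contains a zero
label because, for positive depth, every vertex of a path lies on one of its edges. -/
theorem ABP.value_eq {R : Type u} [CommSemiring R] {D r : ℕ} (A : ABP R D r) (hD : 0 < D) :
    A.value = ∑ a, ∑ b, (List.ofFn A.mat).prod a b := by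
  have h1 : A.value = ∑ p : Fin (D + 1) → Fin r, ∏ i : Fin D, A.mat i (p i.castSucc) (p i.succ) := by
    refine Fintype.sum_of_injective
      (fun (p : ∀ i : Fin (D + 1), Fin (A.width i)) i => Fin.castLE (A.width_le i) (p i)) ?_ _ _ ?_ ?_
    · intro p q h
      ext i
      simpa using congr_arg Fin.val (congr_fun h i)
    · intro p hp
      obtain ⟨i, hi⟩ : ∃ i, A.width i ≤ p i := by
        by_contra hcon
        push Not at hcon
        exact hp ⟨fun i => ⟨p i, hcon i⟩, rfl⟩
      -- The last layer has no outgoing edge, so the edge entering it is used.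
      by_cases hl : i = Fin.last D
      · subst hl
        refine prod_eq_zero (mem_univ ⟨D - 1, by omega⟩) (dif_neg fun h => ?_)
        have hs : (⟨D - 1, by omega⟩ : Fin D).succ = Fin.last D := by ext; simp; omega
        rw [hs] at h
        omega
      · obtain ⟨i, rfl⟩ := Fin.exists_castSucc_eq.2 hl
        exact prod_eq_zero (mem_univ i) (dif_neg fun h => by omega)
    · intro p
      refine prod_congr rfl fun i _ => ?_
      rw [ABP.mat, dif_pos ⟨(p i.castSucc).2, (p i.succ).2⟩]
      rfl
  rw [h1, ← (Fin.consEquiv fun _ : Fin (D + 1) => Fin r).sum_comp, Fintype.sum_prod_type]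
  refine sum_congr rfl fun a _ => ?_
  rw [← sum_paths]
  simp only [Fin.consEquiv_apply, Fin.cons_succ]

open Polynomial in
/-- The polynomials in `N` variables that are bilinear forms of a product of matrices of size `≤ r` the entries of
which are univariate polynomials of degree `< d`, in distinct variables. -/
def matProdClass (F : Type u) [Field F] (N d r : ℕ) : Set (MvPolynomial (Fin N) F) :=
  {f | ∃ (ι : Type) (_ : Fintype ι) (_ : DecidableEq ι) (l : ℕ) (v : Fin l → Fin N)
    (M : Fin l → Matrix ι ι F[X]) (c : Matrix ι ι F), Fintype.card ι ≤ r ∧ Function.Injective v ∧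
      (∀ i a b, (M i a b).natDegree < d) ∧ f = matEval c M fun i => MvPolynomial.X (v i)}

section
open Polynomial
variable {F : Type u} [Field F]

/-- The coefficients of a product of univariate matrices. -/
theorem matEval_expand {ι : Type} [Fintype ι] [DecidableEq ι] {N d l : ℕ} {v : Fin l → Fin N}
    (hv : Function.Injective v) (c : Matrix ι ι F) {M : Fin l → Matrix ι ι F[X]}
    (hM : ∀ i a b, (M i a b).natDegree < d) :
    (matEval c M fun i => (MvPolynomial.X (v i) : MvPolynomial (Fin N) F)) =
      ∑ b ∈ Fintype.piFinset fun _ => range d, MvPolynomial.monomial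
        (Finsupp.equivFunOnFinite.symm (Function.extend v b 0))
        (∑ p, ∑ q, c p q * blk (fun i e => (M i).map fun q => q.coeff e) b p q) := by
  have h := matEval_add hM c (fun _ => (0 : F)) fun i => (MvPolynomial.X (v i) : MvPolynomial (Fin N) F)
  simp only [map_zero, zero_add] at h
  rw [h]
  refine sum_congr rfl fun b _ => ?_
  have h1 : coefShift (fun _ => (0 : F)) M = fun i e => (M i).map fun q => q.coeff e := by
    ext i e p q
    simp [coefShift]
  rw [MvPolynomial.monomial_eq, Finsupp.prod_fintype _ _ (by simp), mul_comm,
    MvPolynomial.algebraMap_eq, h1]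
  congr 1
  refine Fintype.prod_of_injective v hv _ _ (fun i hi => ?_) fun i => ?_
  · rw [Finsupp.equivFunOnFinite_symm_apply_apply, Function.extend_apply' _ _ _ (by simpa using hi)]
    simp
  · rw [Finsupp.equivFunOnFinite_symm_apply_apply, hv.extend_apply]

/-- High powers in the matrices are irrelevant for polynomials of small individual degrees. -/
theorem matEval_trunc {ι : Type} [Fintype ι] [DecidableEq ι] {N d l : ℕ} (hd : 0 < d)
    {v : Fin l → Fin N} (hv : Function.Injective v) (c : Matrix ι ι F) (M : Fin l → Matrix ι ι F[X])
    (hf : ∀ w, (matEval c M fun i => (MvPolynomial.X (v i) : MvPolynomial (Fin N) F)).degreeOf w < d) :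
    ∃ M' : Fin l → Matrix ι ι F[X], (∀ i a b, (M' i a b).natDegree < d) ∧
      (matEval c M fun i => (MvPolynomial.X (v i) : MvPolynomial (Fin N) F)) =
        matEval c M' fun i => MvPolynomial.X (v i) := by
  classical
  obtain ⟨D, hdD, hD⟩ : ∃ D, d ≤ D ∧ ∀ i a b, (M i a b).natDegree < D := by
    refine ⟨d + ∑ i, ∑ a, ∑ b, (M i a b).natDegree, by omega, fun i a b => ?_⟩
    have h1 : (M i a b).natDegree ≤ ∑ b, (M i a b).natDegree :=
      single_le_sum (f := fun b => (M i a b).natDegree) (fun _ _ => Nat.zero_le _) (mem_univ b)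
    have h2 : ∑ b, (M i a b).natDegree ≤ ∑ a, ∑ b, (M i a b).natDegree :=
      single_le_sum (f := fun a => ∑ b, (M i a b).natDegree) (fun _ _ => Nat.zero_le _) (mem_univ a)
    have h3 : ∑ a, ∑ b, (M i a b).natDegree ≤ ∑ i, ∑ a, ∑ b, (M i a b).natDegree :=
      single_le_sum (f := fun i => ∑ a, ∑ b, (M i a b).natDegree) (fun _ _ => Nat.zero_le _) (mem_univ i)
    omega
  obtain ⟨M', hM', hMM'⟩ : ∃ M' : Fin l → Matrix ι ι F[X], (∀ i a b, (M' i a b).natDegree < d) ∧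
      ∀ i, ∀ e < d, ((M' i).map fun q => q.coeff e) = (M i).map fun q => q.coeff e := by
    have hnd : ∀ q : F[X], (∑ e ∈ range d, monomial e (q.coeff e)).natDegree < d := by
      intro q
      have : (∑ e ∈ range d, monomial e (q.coeff e)).natDegree ≤ d - 1 :=
        natDegree_sum_le_of_forall_le _ _ fun e he =>
          (natDegree_monomial_le _).trans (by have := mem_range.1 he; omega)
      omega
    refine ⟨fun i => Matrix.of fun a b => ∑ e ∈ range d, monomial e ((M i a b).coeff e),
      fun i a b => hnd _, fun i e he => ?_⟩
    ext a b
    simp only [Matrix.map_apply, Matrix.of_apply, finsetSum_coeff, coeff_monomial]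
    rw [sum_ite_eq' (range d), if_pos (mem_range.2 he)]
  have hfe := matEval_expand hv c hD
  refine ⟨M', hM', ?_⟩
  generalize (matEval c M fun i => (MvPolynomial.X (v i) : MvPolynomial (Fin N) F)) = f at hf hfe ⊢
  have hinj : ∀ b b' : Fin l → ℕ, Finsupp.equivFunOnFinite.symm (Function.extend v b 0) =
      Finsupp.equivFunOnFinite.symm (Function.extend v b' 0) → b = b' := by
    intro b b' h
    ext i
    simpa [hv.extend_apply] using congr_fun (Finsupp.equivFunOnFinite.symm.injective h) (v i)
  have hsub : (Fintype.piFinset fun _ : Fin l => range d) ⊆ Fintype.piFinset fun _ => range D :=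
    Fintype.piFinset_subset _ _ fun _ => range_subset_range.2 hdD
  -- Distinct `b` give distinct monomials, so this sum is a coefficient of `f`, at a monomial with
  -- an exponent at least `d`. The degree bound on `f` forces it to vanish.
  have hzero : ∀ b ∈ Fintype.piFinset fun _ : Fin l => range D,
      (b ∉ Fintype.piFinset fun _ : Fin l => range d) →
      (∑ p, ∑ q, c p q * blk (fun i e => (M i).map fun q => q.coeff e) b p q) = 0 := by
    intro b hb hbd
    obtain ⟨i, hi⟩ : ∃ i, d ≤ b i := by simpa [Fintype.mem_piFinset] using hbd
    have h1 : f.coeff (Finsupp.equivFunOnFinite.symm (Function.extend v b 0)) = 0 := by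
      by_contra hne
      have := MvPolynomial.monomial_le_degreeOf (v i) (MvPolynomial.mem_support_iff.2 hne)
      rw [Finsupp.equivFunOnFinite_symm_apply_apply, hv.extend_apply] at this
      have := hf (v i)
      omega
    rw [hfe, MvPolynomial.coeff_sum, sum_eq_single b
      (fun b' _ hb' => by rw [MvPolynomial.coeff_monomial, if_neg fun h => hb' (hinj _ _ h)])
      (fun h => absurd hb h), MvPolynomial.coeff_monomial, if_pos rfl] at h1
    exact h1
  rw [matEval_expand hv c hM', hfe, ← sum_subset hsub]
  · refine sum_congr rfl fun b hb => ?_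
    have hblk : blk (fun i e => (M i).map fun q => q.coeff e) b =
        blk (fun i e => (M' i).map fun q => q.coeff e) b := by
      simp only [blk, hMM' _ _ (mem_range.1 (Fintype.mem_piFinset.1 hb _))]
    rw [hblk]
  · intro b hb hbd
    rw [hzero b hb hbd, map_zero]

theorem roabpClass_subset {N d r : ℕ} (hN : 1 ≤ N) (hd : 1 ≤ d) :
    roabpClass F N d r ⊆ matProdClass F N d r := by
  rintro f ⟨hfd, A, ⟨π, hπ⟩, rfl⟩
  choose q hq using hπ
  let M : Fin N → Matrix (Fin r) (Fin r) F[X] := fun i => Matrix.of fun a b =>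
    if h : (a : ℕ) < A.width i.castSucc ∧ (b : ℕ) < A.width i.succ then q i ⟨a, h.1⟩ ⟨b, h.2⟩ else 0
  have hA : A.value = matEval (fun _ _ => 1) M fun i => MvPolynomial.X (π i) := by
    rw [ABP.value_eq A hN]
    simp only [matEval, map_one, one_mul]
    have : A.mat = fun i => (M i).map (aeval (MvPolynomial.X (π i))) := by
      ext1 i
      ext1 a b
      simp only [ABP.mat, M, Matrix.map_apply, Matrix.of_apply]
      split_ifs with h
      · exact hq i _ _
      · simp
    rw [this]
  rw [hA] at hfd ⊢
  obtain ⟨M', h1, h2⟩ := matEval_trunc hd π.injective _ M hfd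
  exact ⟨Fin r, inferInstance, inferInstance, N, π, M', _, by simp, π.injective, h1, h2⟩

theorem rename_mem_matProdClass {N N' d r : ℕ} {f : MvPolynomial (Fin N) F} (hf : f ∈ matProdClass F N d r)
    {e : Fin N → Fin N'} (he : Function.Injective e) : MvPolynomial.rename e f ∈ matProdClass F N' d r := by
  obtain ⟨ι, i₁, i₂, l, v, M, c, h1, h2, h3, rfl⟩ := hf
  refine ⟨ι, i₁, i₂, l, fun i => e (v i), M, c, h1, he.comp h2, h3, ?_⟩
  rw [map_matEval]
  simp

/-! ### Set-multilinear programs as products of univariate matrices -/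

theorem prod_upper {R ι : Type*} [CommRing R] [Fintype ι] [DecidableEq ι] : ∀ (n : ℕ)
    (B : Fin n → Matrix ι ι R), (List.ofFn fun j => (Matrix.fromBlocks 1 (B j) 0 1 : Matrix (ι ⊕ ι) (ι ⊕ ι) R)).prod =
      Matrix.fromBlocks 1 (∑ j, B j) 0 1
  | 0, B => by simp [Matrix.fromBlocks_one]
  | n + 1, B => by
    rw [List.ofFn_succ, List.prod_cons, prod_upper n, Matrix.fromBlocks_multiply, Fin.sum_univ_succ]
    simp [add_comm]

/-- The new lower right block is the upper right block of the rest plus `B 0` times its lower right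
block. The vanishing of the upper right block is thus carried along in the induction. -/
theorem prod_lower {R ι : Type*} [CommRing R] [Fintype ι] [DecidableEq ι] : ∀ (n : ℕ)
    (B : Fin n → Matrix ι ι R),
    (List.ofFn fun j => (Matrix.fromBlocks 0 0 1 (B j) : Matrix (ι ⊕ ι) (ι ⊕ ι) R)).prod.toBlocks₁₂ = 0 ∧
    (List.ofFn fun j => (Matrix.fromBlocks 0 0 1 (B j) : Matrix (ι ⊕ ι) (ι ⊕ ι) R)).prod.toBlocks₂₂ =
      (List.ofFn B).prod
  | 0, B => by
    simp only [List.ofFn_zero, List.prod_nil]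
    exact ⟨by ext; simp [Matrix.toBlocks₁₂], by ext; simp [Matrix.toBlocks₂₂, Matrix.one_apply]⟩
  | n + 1, B => by
    obtain ⟨h1, h2⟩ := prod_lower n fun j => B j.succ
    rw [List.ofFn_succ, List.prod_cons, List.ofFn_succ, List.prod_cons]
    rw [← Matrix.fromBlocks_toBlocks (List.ofFn fun j : Fin n =>
      (Matrix.fromBlocks 0 0 1 (B j.succ) : Matrix (ι ⊕ ι) (ι ⊕ ι) R)).prod, Matrix.fromBlocks_multiply,
      h1, h2]
    simp

/-- A matrix of linear forms is a sum of univariate matrices, and doubling the size turns a sum into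
a product: unipotent upper blocks add up. The first factor of each group has rows `0, 0` and `1, B`,
so the group multiplies to rows `0, 0` and `1, A`, and the lower right blocks of the groups
multiply. Every variable is read once, with degree at most one. -/
theorem smabpClass_subset {N r : ℕ} (hN : 1 ≤ N) : smabpClass F N r ⊆ matProdClass F N 2 (2 * r) := by
  rintro f ⟨D, n, A, ⟨σ, hσ⟩, rfl⟩
  have hcard : D * n = N := by simpa using Fintype.card_congr σ
  have hD : 0 < D := Nat.pos_of_ne_zero fun h => by simp [h] at hcard; omega
  obtain ⟨n, rfl⟩ : ∃ n', n = n' + 1 := Nat.exists_eq_succ_of_ne_zero fun h => by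
    simp [h] at hcard; omega
  choose co hco using hσ
  let B : Fin D → Fin (n + 1) → Matrix (Fin r) (Fin r) F := fun i j => Matrix.of fun a b =>
    if h : (a : ℕ) < A.width i.castSucc ∧ (b : ℕ) < A.width i.succ then co i ⟨a, h.1⟩ ⟨b, h.2⟩ j else 0
  let BX : Fin D → Fin (n + 1) → Matrix (Fin r) (Fin r) F[X] := fun i j =>
    (B i j).map fun z => C z * X
  let G : Fin D → Fin (n + 1) → Matrix (Fin r ⊕ Fin r) (Fin r ⊕ Fin r) F[X] := fun i j =>
    if j = 0 then Matrix.fromBlocks 0 0 1 (BX i j) else Matrix.fromBlocks 1 (BX i j) 0 1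
  let v : Fin (D * (n + 1)) → Fin N := fun k => σ (finProdFinEquiv.symm k)
  let x : Fin D → Fin (n + 1) → MvPolynomial (Fin N) F := fun i j => MvPolynomial.X (σ (i, j))
  let Y : Fin D → Fin (n + 1) → Matrix (Fin r) (Fin r) (MvPolynomial (Fin N) F) := fun i j =>
    (B i j).map fun z => MvPolynomial.C z * x i j
  have hA : A.mat = fun i => ∑ j, Y i j := by
    ext1 i
    ext1 a b
    simp only [ABP.mat, Y, B, Matrix.sum_apply, Matrix.map_apply, Matrix.of_apply]
    split_ifs with h
    · exact hco i _ _
    · simp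
  have hBX : ∀ i j, (BX i j).map (aeval (x i j)) = Y i j := by
    intro i j
    ext1 a b
    simp [BX, Y, MvPolynomial.algebraMap_eq]
  have hG0 : ∀ i, (G i 0).map (aeval (x i 0)) = Matrix.fromBlocks 0 0 1 (Y i 0) := by
    intro i
    simp only [G, if_pos rfl]
    rw [Matrix.fromBlocks_map, hBX]
    simp
  have hGs : ∀ i (j : Fin n), (G i j.succ).map (aeval (x i j.succ)) =
      Matrix.fromBlocks 1 (Y i j.succ) 0 1 := by
    intro i j
    simp only [G, if_neg (Fin.succ_ne_zero j)]
    rw [Matrix.fromBlocks_map, hBX]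
    simp
  have hrow : ∀ i, (List.ofFn fun j => (G i j).map (aeval (x i j))).prod =
      Matrix.fromBlocks 0 0 1 (A.mat i) := by
    intro i
    rw [List.ofFn_succ, List.prod_cons, hG0]
    simp only [hGs]
    rw [prod_upper, Matrix.fromBlocks_multiply, hA]
    simp [add_comm, Fin.sum_univ_succ]
  refine ⟨Fin r ⊕ Fin r, inferInstance, inferInstance, D * (n + 1), v,
    fun k => G (finProdFinEquiv.symm k).1 (finProdFinEquiv.symm k).2,
    Matrix.fromBlocks 0 0 0 (Matrix.of fun _ _ => 1), ?_, σ.injective.comp finProdFinEquiv.symm.injective, ?_, ?_⟩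
  · simp; omega
  · intro k a b
    have hB : ∀ i j a b, (BX i j a b).natDegree < 2 := fun i j a b =>
      lt_of_le_of_lt (by simpa [BX] using natDegree_C_mul_X_pow_le (B i j a b) 1) (by norm_num : 1 < 2)
    simp only [G]
    split_ifs
    · rcases a with a | a <;> rcases b with b | b <;> simp [hB, Matrix.one_apply]
      split_ifs <;> simp
    · rcases a with a | a <;> rcases b with b | b <;> simp [hB, Matrix.one_apply] <;>
      split_ifs <;> simp
  · rw [ABP.value_eq A hD, matEval]
    have hp : (List.ofFn fun k : Fin (D * (n + 1)) => (G (finProdFinEquiv.symm k).1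
        (finProdFinEquiv.symm k).2).map (aeval (MvPolynomial.X (v k) : MvPolynomial (Fin N) F))).prod =
        (List.ofFn fun i => (Matrix.fromBlocks 0 0 1 (A.mat i) :
          Matrix (Fin r ⊕ Fin r) (Fin r ⊕ Fin r) (MvPolynomial (Fin N) F))).prod := by
      rw [List.ofFn_mul, List.prod_flatten, List.map_ofFn]
      congr 2
      ext1 i
      rw [← hrow, Function.comp]
      congr 2
      ext1 j
      have : finProdFinEquiv.symm (⟨i * (n + 1) + j, by
          calc (i : ℕ) * (n + 1) + j < (i + 1) * (n + 1) := by rw [add_mul, one_mul]; omega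
            _ ≤ _ := Nat.mul_le_mul_right _ i.2⟩ : Fin (D * (n + 1))) = (i, j) := by
        rw [Equiv.symm_apply_eq]
        ext
        simp [mul_comm, add_comm]
      simp only [v, this, x]
    rw [hp]
    have h2 := (prod_lower D A.mat).2
    simp only [Fintype.sum_sum_type, Matrix.fromBlocks_apply₁₁, Matrix.fromBlocks_apply₁₂,
      Matrix.fromBlocks_apply₂₁, Matrix.fromBlocks_apply₂₂, Matrix.zero_apply, map_zero, zero_mul,
      sum_const_zero, zero_add, map_one, one_mul, Matrix.of_apply]
    refine sum_congr rfl fun a _ => sum_congr rfl fun b _ => ?_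
    rw [← h2]
    rfl

end
/-! ### The generator property -/

section
variable {F : Type u} [Field F] {R : Type*} [CommRing R] [Algebra F R]

theorem aeval_nodeIndicator {V : Type} {ξ : ℕ → F} {K k k' : ℕ} (hξ : Set.InjOn ξ (Set.Iio K))
    (hk : k < K) (hk' : k' < K) {g : V → R} {v : V} (hg : g v = algebraMap F R (ξ k')) :
    MvPolynomial.aeval g (nodeIndicator ξ K k v) = if k' = k then 1 else 0 := by
  rw [nodeIndicator, ← Polynomial.aeval_algHom_apply, MvPolynomial.aeval_X, hg,
    Polynomial.aeval_algebraMap_apply, Polynomial.coe_aeval_eq_eval]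
  have hs : Set.InjOn ξ (range K : Set ℕ) := by simpa using hξ
  split_ifs with h
  · subst h
    rw [Lagrange.eval_basis_self hs (mem_range.2 hk), map_one]
  · rw [Lagrange.eval_basis_of_ne (Ne.symm h) (mem_range.2 hk'), map_zero]

theorem aeval_ksGen {ξ : ℕ → F} {N d s : ℕ} (hξ : Set.InjOn ξ (Set.Iio (ksPrime N d)))
    (k : Fin (ksSeed N d s) → Fin (ksPrime N d)) (g : Fin (ksSeed N d s) ⊕ Fin (ksSeed N d s) → R)
    (hg : ∀ j, g (Sum.inr j) = algebraMap F R (ξ (k j))) (i : Fin N) :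
    MvPolynomial.aeval g (ksGen ξ N d s i) = ∏ j, g (Sum.inl j) ^ ksExp k i j := by
  rw [ksGen, map_prod]
  refine prod_congr rfl fun j _ => ?_
  rw [map_sum, sum_eq_single (k j : ℕ)]
  · rw [map_mul, aeval_nodeIndicator hξ (k j).2 (k j).2 (hg j), if_pos rfl, one_mul, map_pow,
      MvPolynomial.aeval_X, ksExp]
  · intro k' hk' hne
    rw [map_mul, aeval_nodeIndicator hξ (mem_range.1 hk') (k j).2 (hg j), if_neg (Ne.symm hne), zero_mul]
  · intro h
    exact absurd (mem_range.2 (k j).2) h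

/-- The Shpilka-Volkovich generator reaches all points of small support. -/
theorem exists_svGen_eq {ξ : ℕ → F} {N L : ℕ} (hξ : Set.InjOn ξ (Set.Iio (N + 1))) {S : Finset (Fin N)}
    (hS : #S ≤ L) {y : Fin N → R} (hy : ∀ w ∉ S, y w = 0) :
    ∃ g : Fin L ⊕ Fin L → R, ∀ w, MvPolynomial.aeval g (svGen ξ N L w) = y w := by
  classical
  obtain ⟨c⟩ : Nonempty (S ↪ Fin L) := Function.Embedding.nonempty_of_card_le (by simpa using hS)
  -- Coordinates are numbered from `1`, so an unused slot is given the node `ξ 0`, which selects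
  -- none, and the value `0`.
  let z : Fin L → ℕ := Function.extend c (fun w => ((w : Fin N) : ℕ) + 1) fun _ => 0
  let y' : Fin L → R := Function.extend c (fun w => y w) 0
  have hz : ∀ j, z j < N + 1 := by
    intro j
    by_cases h : ∃ w, c w = j
    · obtain ⟨w, rfl⟩ := h
      simp only [z, c.injective.extend_apply]
      omega
    · simp only [z, Function.extend_apply' _ _ _ h]
      omega
  refine ⟨Sum.elim y' fun j => algebraMap F R (ξ (z j)), fun w => ?_⟩
  have h1 : ∀ j, MvPolynomial.aeval (Sum.elim y' fun j => algebraMap F R (ξ (z j)))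
      (nodeIndicator ξ (N + 1) ((w : ℕ) + 1) (Sum.inr j)) = if z j = w + 1 then 1 else 0 := fun j =>
    aeval_nodeIndicator hξ (by omega) (hz j) rfl
  simp only [svGen, map_sum, map_mul, h1, MvPolynomial.aeval_X, Sum.elim_inl]
  rw [← Fintype.sum_of_injective c c.injective (fun s => if s.1 = w then y s else 0)]
  · by_cases hw : w ∈ S
    · rw [sum_eq_single (⟨w, hw⟩ : S)]
      · simp
      · intro s _ hs
        rw [if_neg fun h => hs (Subtype.ext h)]
      · simp
    · rw [hy w hw]
      refine sum_eq_zero fun s _ => if_neg ?_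
      rintro rfl
      exact hw s.2
  · intro j hj
    simp only [y']
    rw [Function.extend_apply' _ _ _ (by simpa using hj)]
    simp
  · intro s
    simp only [z, y', c.injective.extend_apply]
    simp [Fin.ext_iff]

theorem aeval_sum_rename {n : ℕ} {V : Type} (g : Fin n × Option V → R) (P : MvPolynomial V F) :
    MvPolynomial.aeval g (∑ i : Fin n, MvPolynomial.X (i, none) *
      MvPolynomial.rename (fun v => (i, some v)) P) =
      ∑ i, g (i, none) * MvPolynomial.aeval (fun v => g (i, some v)) P := by
  rw [map_sum]
  refine sum_congr rfl fun i _ => ?_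
  rw [map_mul, MvPolynomial.aeval_X, MvPolynomial.aeval_rename]
  rfl

theorem aeval_mainGen {ξ : ℕ → F} {n d r : ℕ} (g : MainVar n d r → R) (w : Fin (2 ^ n)) :
    MvPolynomial.aeval g (mainGen ξ n d r w) = ∑ i, g (i, none) *
      MvPolynomial.aeval (fun v : Fin (ksSeed (2 ^ n) d (mainSparsity n d r)) ⊕
        Fin (ksSeed (2 ^ n) d (mainSparsity n d r)) => g (i, some v))
        (ksGen ξ (2 ^ n) d (mainSparsity n d r) w) :=
  aeval_sum_rename g _

/-- The square in `supp` is the dimension `r²` of the matrix space. -/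
theorem lg_le_supp {ι s r : ℕ} (hι : ι ≤ r) (h : 2 ^ s ≤ ι * ι) : s ≤ supp r := by
  refine le_trans ?_ (Nat.le_succ _)
  refine Nat.le_log_of_pow_le (by norm_num) (h.trans ?_)
  rw [sq]
  exact Nat.mul_le_mul hι hι

/-- It suffices to find a specialization of the seed, over some larger domain, at which the
composition is nonzero. The shift and the few surviving variables from `exists_shift_ne_zero` are
produced by the two summands of the generator. -/
theorem bind₁_fullGen_ne_zero {ξ : ℕ → F} {n d r : ℕ} (hd : 1 ≤ d)
    (hξ : Set.InjOn ξ (Set.Iio (ksPrime (2 ^ n) d))) (hξ' : Set.InjOn ξ (Set.Iio (2 ^ n + 1)))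
    {f : MvPolynomial (Fin (2 ^ n)) F} (hf : f ∈ matProdClass F (2 ^ n) d r) (hf0 : f ≠ 0) :
    MvPolynomial.bind₁ (fullGen ξ n d r) f ≠ 0 := by
  obtain ⟨ι, _, _, l, v, M, c, hι, hv, hM, rfl⟩ := hf
  obtain ⟨k, E, e, W, hW, hWe⟩ : ∃ (k : Fin (mainSeed n d r) → Fin (ksPrime (2 ^ n) d)) (E : ℕ)
      (e : Fin (mainSeed n d r) → ℕ) (W : Fin (2 ^ n) → ℕ),
      Isolating d ((supp r + supp r) * (d - 1)) W ∧
        (n ≠ 0 → W = fun i : Fin (2 ^ n) => E + ∑ j, e j * ksExp k (i : ℕ) j) := by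
    -- A single variable needs no shift: there are no `u_i`, and the weight only has to exist.
    rcases eq_or_ne n 0 with rfl | hn
    · refine ⟨fun _ => ⟨0, (ksPrime_prime _ _).pos⟩, 0, fun _ => 0, fun _ => 1, ⟨?_, ?_⟩, by simp⟩
      · intro a b _ _ _ _ h
        simp only [wt, one_mul] at h
        ext i
        have : Subsingleton (Fin (2 ^ 0)) := inferInstanceAs (Subsingleton (Fin 1))
        rwa [Fintype.sum_subsingleton _ i, Fintype.sum_subsingleton _ i] at h
      · intro a b _ _ h
        simpa [wt] using h
    · obtain ⟨k, E, e, h⟩ := exists_isolating (N := 2 ^ n) (d := d) (S := mainSparsity n d r)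
        (D := (supp r + supp r) * (d - 1)) (Nat.le_self_pow hn 2) hd (by
          refine Nat.pow_le_pow_right (by positivity) ?_
          obtain ⟨d, rfl⟩ := Nat.exists_eq_add_of_le hd
          -- This gives `2 * supp r * (d - 1) + 1 ≤ 2 * d * supp r`, the exponent of the sparsity.
          have : 1 ≤ supp r := Nat.le_add_left _ _
          simp only [Nat.add_sub_cancel_left]
          nlinarith)
      exact ⟨k, E, e, _, h, fun _ => rfl⟩
  obtain ⟨K, _, _, _, τ, S, y, hS, hy, hne⟩ := exists_shift_ne_zero (j := n) hd hW (Nat.le_add_left 1 _)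
    (fun s hs => lg_le_supp hι hs)
    (by simpa using Fintype.card_le_of_injective v hv) hv hM (f := _) (c := c) rfl hf0
  obtain ⟨g₂, hg₂⟩ := exists_svGen_eq hξ' hS hy
  -- At the nodes `s_j = ξ (k j)`, the choice `u_i = τ_i ^ E`, `t_j = τ_i ^ e j` turns the `i`-th
  -- summand into `τ_i ^ W w`. The same `k`, `E`, `e` serve for all `i`.
  let g₁ : MainVar n d r → MvPolynomial (Fin l) K := fun w => match w with
    | (i, none) => MvPolynomial.C (τ i ^ E)
    | (i, some (Sum.inl j)) => MvPolynomial.C (τ i ^ e j)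
    | (_, some (Sum.inr j)) => algebraMap F _ (ξ (k j))
  have hg₁ : ∀ w, MvPolynomial.aeval g₁ (mainGen ξ n d r w) = MvPolynomial.C (∑ i, τ i ^ W w) := by
    intro w
    rw [aeval_mainGen, map_sum]
    refine sum_congr rfl fun i _ => ?_
    have hn : n ≠ 0 := by have := i.2; omega
    rw [hWe hn]
    have h := aeval_ksGen (s := mainSparsity n d r) hξ k (fun v => g₁ (i, some v)) (fun _ => rfl) w
    refine (congr_arg _ h).trans ?_
    rw [pow_add, map_mul]
    simp only [g₁, ← map_pow, ← map_prod, ← pow_mul, prod_pow_eq_pow_sum]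
    rfl
  have hg : ∀ w, MvPolynomial.aeval (Sum.elim g₁ g₂) (fullGen ξ n d r w) =
      MvPolynomial.C (∑ i, τ i ^ W w) + y w := by
    intro w
    rw [fullGen, map_add, MvPolynomial.aeval_rename, MvPolynomial.aeval_rename, Sum.elim_comp_inl,
      Sum.elim_comp_inr, hg₁, hg₂]
  intro h0
  refine hne ?_
  have h1 := congr_arg (MvPolynomial.aeval (Sum.elim g₁ g₂)) h0
  rw [MvPolynomial.aeval_bind₁, map_zero] at h1
  simpa only [hg] using h1

end
/-! ### Degrees of the generators -/

section
variable {F : Type u} [Field F]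

theorem degreeOf_aeval_X_le {V : Type} [DecidableEq V] (v w : V) (q : Polynomial F) :
    (Polynomial.aeval (MvPolynomial.X v : MvPolynomial V F) q).degreeOf w ≤
      if w = v then q.natDegree else 0 := by
  rw [Polynomial.aeval_eq_sum_range]
  refine (MvPolynomial.degreeOf_sum_le _ _ _).trans (Finset.sup_le fun i hi => ?_)
  rw [MvPolynomial.smul_eq_C_mul]
  refine (MvPolynomial.degreeOf_C_mul_le _ _ _).trans ?_
  split_ifs with h
  · subst h
    simpa [Nat.lt_succ_iff] using hi
  · rw [MvPolynomial.degreeOf_X_pow_of_ne _ h]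

theorem natDegree_basis_le (ξ : ℕ → F) (K k : ℕ) : (Lagrange.basis (range K) ξ k).natDegree ≤ K := by
  refine (Polynomial.natDegree_prod_le _ _).trans ((sum_le_card_nsmul _ _ 1 fun j _ => ?_).trans ?_)
  · by_cases h : ξ k = ξ j
    · rw [h, Lagrange.natDegree_basisDivisor_self]
      exact Nat.zero_le _
    · rw [Lagrange.natDegree_basisDivisor_of_ne h]
  · simpa using card_le_card (erase_subset k (range K))

theorem degreeOf_nodeIndicator_le {V : Type} [DecidableEq V] (ξ : ℕ → F) (K k : ℕ) (v w : V) :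
    (nodeIndicator ξ K k v).degreeOf w ≤ if w = v then K else 0 := by
  refine (degreeOf_aeval_X_le v w _).trans ?_
  split_ifs
  · exact natDegree_basis_le ξ K k
  · exact le_rfl

theorem degreeOf_X_pow_le {V : Type} [DecidableEq V] (v w : V) (e : ℕ) :
    ((MvPolynomial.X v : MvPolynomial V F) ^ e).degreeOf w ≤ if w = v then e else 0 := by
  split_ifs with h
  · subst h
    rw [MvPolynomial.degreeOf_X_self_pow]
  · rw [MvPolynomial.degreeOf_X_pow_of_ne _ h]

theorem degreeOf_rename_le {V W : Type} {P : MvPolynomial V F} {f : V → W} (hf : Function.Injective f) {B : ℕ}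
    (h : ∀ v, P.degreeOf v ≤ B) (w : W) : (MvPolynomial.rename f P).degreeOf w ≤ B := by
  by_cases hw : w ∈ Set.range f
  · obtain ⟨v, rfl⟩ := hw
    rw [MvPolynomial.degreeOf_rename_of_injective hf]
    exact h v
  · refine le_of_eq_of_le ?_ (Nat.zero_le B)
    classical
    rw [MvPolynomial.degreeOf_def, MvPolynomial.degrees_rename_of_injective hf]
    simpa using fun v _ h => hw ⟨v, h⟩

theorem degreeOf_ksGen_le (ξ : ℕ → F) (N d s : ℕ) (i : Fin N)
    (w : Fin (ksSeed N d s) ⊕ Fin (ksSeed N d s)) : (ksGen ξ N d s i).degreeOf w ≤ 2 * ksPrime N d := by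
  refine (MvPolynomial.degreeOf_prod_le _ _ _).trans
    ((sum_le_sum (g := fun j => (if w = Sum.inr j then ksPrime N d else 0) +
      if w = Sum.inl j then ksPrime N d else 0) fun j _ => ?_).trans ?_)
  · refine (MvPolynomial.degreeOf_sum_le _ _ _).trans (Finset.sup_le fun k _ => ?_)
    refine (MvPolynomial.degreeOf_mul_le _ _ _).trans (add_le_add (degreeOf_nodeIndicator_le _ _ _ _ _)
      ((degreeOf_X_pow_le _ _ _).trans ?_))
    split_ifs
    · exact (Nat.mod_lt _ (ksPrime_prime N d).pos).le
    · exact le_rfl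
  · rcases w with j | j <;> simp [two_mul]

theorem degreeOf_mainGen_le (ξ : ℕ → F) (n d r : ℕ) (k : Fin (2 ^ n)) (v : MainVar n d r) :
    (mainGen ξ n d r k).degreeOf v ≤ 2 * ksPrime (2 ^ n) d + 1 := by
  refine (MvPolynomial.degreeOf_sum_le _ _ _).trans (Finset.sup_le fun i _ => ?_)
  refine (MvPolynomial.degreeOf_mul_le _ _ _).trans ?_
  rw [add_comm]
  refine add_le_add (degreeOf_rename_le ?_ (fun v => degreeOf_ksGen_le ξ (2 ^ n) d _ k v) v) ?_
  · intro a b h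
    exact Option.some_injective _ (Prod.ext_iff.1 h).2
  · have := degreeOf_X_pow_le (F := F) (i, none) v 1
    rw [pow_one] at this
    refine this.trans ?_
    split_ifs <;> simp

theorem degreeOf_svGen_le (ξ : ℕ → F) (N l : ℕ) (k : Fin N) (v : Fin l ⊕ Fin l) :
    (svGen ξ N l k).degreeOf v ≤ N + 2 := by
  refine (MvPolynomial.degreeOf_sum_le _ _ _).trans (Finset.sup_le fun i _ => ?_)
  refine (MvPolynomial.degreeOf_mul_le _ _ _).trans ?_
  refine add_le_add (b := N + 1) (d := 1) ((degreeOf_nodeIndicator_le _ _ _ _ _).trans ?_) ?_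
  · split_ifs <;> simp
  · have := degreeOf_X_pow_le (F := F) (Sum.inl i) v 1
    rw [pow_one] at this
    refine this.trans ?_
    split_ifs <;> simp

theorem degreeOf_fullGen_le (ξ : ℕ → F) (n d r : ℕ) (k : Fin (2 ^ n))
    (v : MainVar n d r ⊕ (Fin (supp r) ⊕ Fin (supp r))) :
    (fullGen ξ n d r k).degreeOf v ≤ 2 * ksPrime (2 ^ n) d + 2 ^ n + 2 := by
  refine (MvPolynomial.degreeOf_add_le _ _ _).trans (max_le ?_ ?_)
  · exact degreeOf_rename_le Sum.inl_injective
      (fun v => (degreeOf_mainGen_le ξ n d r k v).trans (by linarith [Nat.zero_le (2 ^ n)])) v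
  · exact degreeOf_rename_le Sum.inr_injective
      (fun v => (degreeOf_svGen_le ξ _ _ k v).trans (by omega)) v

theorem degreeOf_bind₁_le {V W : Type} [Fintype V] {g : V → MvPolynomial W F} {f : MvPolynomial V F} {d B : ℕ}
    (hf : ∀ v, f.degreeOf v ≤ d) {w : W} (hg : ∀ v, (g v).degreeOf w ≤ B) :
    (MvPolynomial.bind₁ g f).degreeOf w ≤ Fintype.card V * (d * B) := by
  conv_lhs => rw [f.as_sum, map_sum]
  refine (MvPolynomial.degreeOf_sum_le _ _ _).trans (Finset.sup_le fun a ha => ?_)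
  rw [MvPolynomial.bind₁_monomial]
  refine (MvPolynomial.degreeOf_C_mul_le _ _ _).trans ((MvPolynomial.degreeOf_prod_le _ _ _).trans
    ((sum_le_card_nsmul _ _ (d * B) fun v _ => ?_).trans ?_))
  · exact (MvPolynomial.degreeOf_pow_le _ _ _).trans
      (Nat.mul_le_mul ((MvPolynomial.le_degreeOf_of_mem_support v ha).trans (hf v)) (hg v))
  · rw [smul_eq_mul]
    exact Nat.mul_le_mul_right _ (card_le_univ _)

theorem degreeOf_lt_of_mem_matProdClass {N d r : ℕ} (hd : 1 ≤ d) {f : MvPolynomial (Fin N) F}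
    (hf : f ∈ matProdClass F N d r) (w : Fin N) : f.degreeOf w < d := by
  obtain ⟨ι, _, _, l, v, M, c, -, hv, hM, rfl⟩ := hf
  rw [matEval_expand hv c hM]
  refine (MvPolynomial.degreeOf_sum_le _ _ _).trans_lt ((Finset.sup_lt_iff hd).2 fun b hb => ?_)
  refine (MvPolynomial.degreeOf_lt_iff hd).2 fun m hm => ?_
  rw [Finset.mem_singleton.1 (MvPolynomial.support_monomial_subset hm)]
  by_cases h : ∃ i, v i = w
  · obtain ⟨i, rfl⟩ := h
    simpa [hv.extend_apply] using mem_range.1 (Fintype.mem_piFinset.1 hb i)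
  · simpa [Function.extend_apply' _ _ _ h] using Nat.lt_of_succ_le hd

/-- A nonzero polynomial does not vanish on a grid. The points of the grid are indexed by
numbers, through their digits. -/
theorem exists_grid_eval_ne_zero {V : Type} [Finite V] {ξ : ℕ → F} {D n : ℕ} (hD : 0 < D)
    (hξ : Set.InjOn ξ (Set.Iio D)) {pos : V → ℕ} (hpos : Function.Injective pos) (hn : ∀ v, pos v < n)
    {g : MvPolynomial V F} (hg : ∀ v, g.degreeOf v < D) (hg0 : g ≠ 0) :
    ∃ I < D ^ n, MvPolynomial.eval (fun v => ξ (I / D ^ pos v % D)) g ≠ 0 := by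
  classical
  by_contra! hcon
  refine hg0 (MvPolynomial.eq_zero_of_eval_zero_at_prod_finset g (fun _ => (range D).image ξ) (fun v => ?_)
    fun x hx => ?_)
  · rw [card_image_of_injOn (by simpa using hξ), card_range]
    exact hg v
  · simp only [mem_image, mem_range] at hx
    choose a ha hax using hx
    have : NeZero D := ⟨hD.ne'⟩
    -- Positions that belong to no variable get the digit `0`.
    let b : Fin n → Fin D := fun i => if h : ∃ v, pos v = i then ⟨a h.choose, ha _⟩ else 0
    have h := hcon (finFunctionFinEquiv b) (finFunctionFinEquiv b).2
    have hx : x = fun v => ξ ((finFunctionFinEquiv b : ℕ) / D ^ pos v % D) := by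
      funext v
      have h1 := congr_arg Fin.val (congr_fun (finFunctionFinEquiv.symm_apply_apply b) ⟨pos v, hn v⟩)
      rw [finFunctionFinEquiv_symm_apply_val] at h1
      simp only at h1
      rw [h1, ← hax v]
      have hex : ∃ v', pos v' = pos v := ⟨v, rfl⟩
      simp only [b, dif_pos hex]
      rw [hpos hex.choose_spec]
    rw [hx]
    exact h

end
/-! ### The values of the generators, and the hitting set -/

section
variable {F : Type u} [Field F]

/-- The value of the `k`-th Lagrange polynomial for the nodes `ξ 0, …, ξ (K - 1)`. -/
def indVal (ξ : ℕ → F) (K k : ℕ) (x : F) : F :=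
  ∏ l ∈ range K, if l = k then 1 else (ξ k - ξ l)⁻¹ * (x - ξ l)

/-- The value of a coordinate of the main generator, its variables being read from `z` in the order
of `mainPos`. -/
def mainVal (ξ : ℕ → F) (n d r : ℕ) (z : ℕ → F) (k : ℕ) : F :=
  ∑ i ∈ range n, z (i * (2 * mainSeed n d r + 1)) * ∏ j ∈ range (mainSeed n d r),
    ∑ q ∈ range (ksPrime (2 ^ n) d),
      indVal ξ (ksPrime (2 ^ n) d) q (z (i * (2 * mainSeed n d r + 1) + 1 + mainSeed n d r + j)) *
        z (i * (2 * mainSeed n d r + 1) + 1 + j) ^ (q ^ (k + 1) % ksPrime (2 ^ n) d)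

/-- The value of a coordinate of the Shpilka-Volkovich generator, its variables being read from
position `b` on. -/
def svVal (ξ : ℕ → F) (N l b : ℕ) (z : ℕ → F) (k : ℕ) : F :=
  ∑ j ∈ range l, indVal ξ (N + 1) (k + 1) (z (b + l + j)) * z (b + j)

/-- The value of a coordinate of the full generator. -/
def fullVal (ξ : ℕ → F) (n d r : ℕ) (z : ℕ → F) (k : ℕ) : F :=
  mainVal ξ n d r z k + svVal ξ (2 ^ n) (supp r) (n * (2 * mainSeed n d r + 1)) z k

theorem eval_nodeIndicator {V : Type} (ξ : ℕ → F) (K k : ℕ) (v : V) (y : V → F) :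
    MvPolynomial.eval y (nodeIndicator ξ K k v) = indVal ξ K k (y v) := by
  have h : MvPolynomial.eval y (nodeIndicator ξ K k v) =
      (Lagrange.basis (range K) ξ k).eval (y v) := by
    rw [nodeIndicator, ← MvPolynomial.coe_aeval_eq_eval, RingHom.coe_coe,
      ← Polynomial.aeval_algHom_apply, MvPolynomial.aeval_X, Polynomial.coe_aeval_eq_eval]
  rw [h, Lagrange.basis, Polynomial.eval_prod, indVal, ← filter_ne', prod_filter]
  refine prod_congr rfl fun l _ => ?_
  by_cases h : l = k <;> simp [h, Lagrange.basisDivisor]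

theorem eval_mainGen (ξ : ℕ → F) (n d r : ℕ) (k : Fin (2 ^ n)) (z : ℕ → F) :
    MvPolynomial.eval (fun v => z (mainPos n d r v)) (mainGen ξ n d r k) = mainVal ξ n d r z k := by
  rw [← MvPolynomial.coe_aeval_eq_eval, RingHom.coe_coe]
  refine (aeval_mainGen _ k).trans ?_
  rw [mainVal, ← Fin.sum_univ_eq_sum_range (fun i => z (i * (2 * mainSeed n d r + 1)) * _)]
  refine sum_congr rfl fun i _ => congr_arg₂ _ rfl ?_
  rw [MvPolynomial.aeval_eq_eval, ksGen, map_prod, ← Fin.prod_univ_eq_prod_range (fun j => ∑ q ∈ _, _)]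
  refine prod_congr rfl fun j _ => ?_
  rw [map_sum]
  refine sum_congr rfl fun q _ => ?_
  rw [map_mul, map_pow, MvPolynomial.eval_X]
  exact congr_arg (· * _) (eval_nodeIndicator _ _ _ _ _)

/-- The positions of the variables of the full generator. -/
def fullPos (n d r : ℕ) : MainVar n d r ⊕ (Fin (supp r) ⊕ Fin (supp r)) → ℕ
  | .inl v => mainPos n d r v
  | .inr (.inl j) => n * (2 * mainSeed n d r + 1) + j
  | .inr (.inr j) => n * (2 * mainSeed n d r + 1) + supp r + j

theorem eval_fullGen (ξ : ℕ → F) (n d r : ℕ) (k : Fin (2 ^ n)) (z : ℕ → F) :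
    MvPolynomial.eval (fun v => z (fullPos n d r v)) (fullGen ξ n d r k) = fullVal ξ n d r z k := by
  rw [fullGen, map_add, MvPolynomial.eval_rename, MvPolynomial.eval_rename, fullVal, ← eval_mainGen]
  refine congr_arg₂ _ rfl ?_
  rw [svGen, map_sum, svVal, ← Fin.sum_univ_eq_sum_range (fun j => indVal _ _ _ _ * _)]
  refine sum_congr rfl fun j _ => ?_
  rw [map_mul, eval_nodeIndicator, MvPolynomial.eval_X]
  rfl

/-! ### Layout of the seed, and the grid of seeds -/

theorem mainPos_eq (n d r : ℕ) (i : Fin n) (v) : ∃ j < 2 * mainSeed n d r + 1,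
    mainPos n d r (i, v) = i * (2 * mainSeed n d r + 1) + j ∧
      j = match v with
        | none => 0
        | some (.inl j) => 1 + j
        | some (.inr j) => 1 + mainSeed n d r + j := by
  rcases v with _ | j | j
  · exact ⟨0, by omega, rfl, rfl⟩
  · exact ⟨1 + j, by omega, by rw [← add_assoc]; rfl, rfl⟩
  · exact ⟨1 + mainSeed n d r + j, by omega, by rw [← add_assoc, ← add_assoc]; rfl, rfl⟩

theorem mainPos_lt (n d r : ℕ) (v) : mainPos n d r v < n * (2 * mainSeed n d r + 1) := by
  obtain ⟨i, v⟩ := v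
  obtain ⟨j, hj, h, -⟩ := mainPos_eq n d r i v
  rw [h]
  calc _ < (i + 1) * (2 * mainSeed n d r + 1) := by rw [add_one_mul]; omega
    _ ≤ _ := Nat.mul_le_mul_right _ i.2

theorem mainPos_injective (n d r : ℕ) : Function.Injective (mainPos n d r) := by
  rintro ⟨i, v⟩ ⟨i', v'⟩ h
  obtain ⟨j, hj, h1, h2⟩ := mainPos_eq n d r i v
  obtain ⟨j', hj', h1', h2'⟩ := mainPos_eq n d r i' v'
  rw [h1, h1'] at h
  have hi : (i : ℕ) = i' := by
    have := congr_arg (· / (2 * mainSeed n d r + 1)) h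
    simpa [Nat.mul_add_div, mul_comm _ (2 * mainSeed n d r + 1), Nat.div_eq_of_lt hj, Nat.div_eq_of_lt hj'] using this
  have hj : j = j' := by rw [hi] at h; omega
  obtain rfl : i = i' := Fin.ext hi
  congr 1
  rw [hj, h2'] at h2
  rcases v with _ | ⟨v⟩ | ⟨v⟩ <;> rcases v' with _ | ⟨v'⟩ | ⟨v'⟩ <;> simp at h2 ⊢ <;> omega

theorem fullPos_injective (n d r : ℕ) : Function.Injective (fullPos n d r) := by
  rintro (v | v | v) (v' | v' | v') h
  · rw [mainPos_injective n d r h]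
  · have := mainPos_lt n d r v
    simp only [fullPos] at h
    omega
  · have := mainPos_lt n d r v
    simp only [fullPos] at h
    omega
  · have := mainPos_lt n d r v'
    simp only [fullPos] at h
    omega
  · simp only [fullPos] at h
    simp only [Sum.inr.injEq, Sum.inl.injEq]
    omega
  · simp only [fullPos] at h
    omega
  · have := mainPos_lt n d r v'
    simp only [fullPos] at h
    omega
  · simp only [fullPos] at h
    omega
  · simp only [fullPos] at h
    simp only [Sum.inr.injEq]
    omega

/-- The number of variables of the full generator. -/
def fullVars (n d r : ℕ) : ℕ := n * (2 * mainSeed n d r + 1) + 2 * supp r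

theorem fullPos_lt (n d r : ℕ) (v) : fullPos n d r v < fullVars n d r := by
  rw [fullVars]
  rcases v with v | v | v
  · exact (mainPos_lt n d r v).trans_le (Nat.le_add_right _ _)
  · simp only [fullPos]
    omega
  · simp only [fullPos]
    omega

/-- The number of values for each variable of the full generator. -/
def gridSize (n d : ℕ) : ℕ := (2 ^ n * d + 1) ^ 6

/-- The points of the hitting set. -/
def hitVal (ξ : ℕ → F) (N d r I k : ℕ) : F :=
  fullVal ξ (Nat.clog 2 N) d r
    (fun pos => ξ (I / gridSize (Nat.clog 2 N) d ^ pos % gridSize (Nat.clog 2 N) d)) k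

/-- The left side bounds the individual degrees of the composition with the full generator, as given
by `degreeOf_bind₁_le` and `degreeOf_fullGen_le`. -/
theorem ksPrime_lt_gridSize {n d : ℕ} (hd : 1 ≤ d) :
    2 ^ n * (d * (2 * ksPrime (2 ^ n) d + 2 ^ n + 2)) < gridSize n d := by
  have h := ksPrime_le (N := 2 ^ n) (d := d) (by positivity)
  have h1 : 2 ^ n ≤ 2 ^ n * d := Nat.le_mul_of_pos_right _ hd
  rw [gridSize, ← mul_assoc]
  set Q := 2 ^ n * d
  calc Q * (2 * ksPrime (2 ^ n) d + 2 ^ n + 2) ≤ Q * (2 * (2 * Q ^ 3) + Q + 2) := by gcongr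
    _ < Q * (2 * (2 * Q ^ 3) + Q + 2) +
        (Q ^ 6 + 6 * Q ^ 5 + 11 * Q ^ 4 + 20 * Q ^ 3 + 14 * Q ^ 2 + 4 * Q + 1) :=
        Nat.lt_add_of_pos_right (by positivity)
    _ = (Q + 1) ^ 6 := by ring

theorem ksPrime_le_gridSize {n d : ℕ} (hd : 1 ≤ d) : ksPrime (2 ^ n) d ≤ gridSize n d := by
  refine le_trans ?_ (ksPrime_lt_gridSize hd).le
  have h1 : 1 ≤ 2 ^ n * d := Nat.mul_pos (by positivity) hd
  rw [← mul_assoc]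
  exact le_trans (by linarith [Nat.zero_le (2 ^ n)]) (Nat.le_mul_of_pos_left _ h1)

theorem two_pow_lt_gridSize {n d : ℕ} (hd : 1 ≤ d) : 2 ^ n + 1 ≤ gridSize n d := by
  have h1 : 2 ^ n ≤ 2 ^ n * d := Nat.le_mul_of_pos_right _ hd
  exact (Nat.succ_le_succ h1).trans (Nat.le_self_pow (by norm_num) _)

/-- The polynomial is regarded as one in `2 ^ Nat.clog 2 N` variables. Its composition with the
generator is nonzero and does not vanish on the grid of seeds. Only the first `N` coordinates of a
point matter. -/
theorem isHittingSet {ξ : ℕ → F} {N d r : ℕ} (hd : 1 ≤ d)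
    (hξ : Set.InjOn ξ (Set.Iio (gridSize (Nat.clog 2 N) d))) {C : Set (MvPolynomial (Fin N) F)}
    (hC : C ⊆ matProdClass F N d r) :
    IsHittingSet C (Set.range fun (I : Fin (gridSize (Nat.clog 2 N) d ^ fullVars (Nat.clog 2 N) d r))
      (k : Fin N) => hitVal ξ N d r I k) := by
  set n := Nat.clog 2 N with hn
  have hN : N ≤ 2 ^ n := Nat.le_pow_clog (by norm_num) N
  refine fun f hf => ⟨fun h => by simp [h], fun h => ?_⟩
  by_contra hf0
  have hf' := rename_mem_matProdClass (hC hf) (Fin.castLE_injective hN)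
  have hb : MvPolynomial.bind₁ (fullGen ξ n d r) (MvPolynomial.rename (Fin.castLE hN) f) ≠ 0 :=
    bind₁_fullGen_ne_zero hd (hξ.mono (Set.Iio_subset_Iio (ksPrime_le_gridSize hd)))
      (hξ.mono (Set.Iio_subset_Iio (two_pow_lt_gridSize hd))) hf' fun h0 => hf0
        (MvPolynomial.rename_injective _ (Fin.castLE_injective hN) (by rw [h0, map_zero]))
  have hdeg := fun v => (degreeOf_bind₁_le
    (fun w => (degreeOf_lt_of_mem_matProdClass hd hf' w).le) (fun k => degreeOf_fullGen_le ξ n d r k v)).trans_lt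
      (by rw [Fintype.card_fin]; exact ksPrime_lt_gridSize hd)
  obtain ⟨I, hI, hne⟩ := exists_grid_eval_ne_zero (by unfold gridSize; positivity) hξ (fullPos_injective n d r)
    (fullPos_lt n d r) hdeg hb
  refine hne ?_
  have h1 := h _ ⟨⟨I, hI⟩, rfl⟩
  rw [MvPolynomial.bind₁_rename, ← MvPolynomial.coe_aeval_eq_eval, RingHom.coe_coe,
    MvPolynomial.aeval_bind₁, MvPolynomial.aeval_eq_eval]
  rw [← h1]
  refine congr_arg (fun x => MvPolynomial.eval x f) (funext fun k => ?_)
  rw [MvPolynomial.aeval_eq_eval]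
  exact eval_fullGen ξ n d r (Fin.castLE hN k) (fun pos => ξ (I / gridSize n d ^ pos % gridSize n d))

end
/-! ### Size bounds -/

theorem supp_le (r : ℕ) : supp r ≤ 2 * (Nat.log 2 r + 1) := by
  rw [supp]
  have h : r ^ 2 < 2 ^ (2 * (Nat.log 2 r + 1)) := by
    rw [mul_comm, pow_mul]
    exact Nat.pow_lt_pow_left (Nat.lt_pow_succ_log_self (by norm_num) r) (by norm_num)
  have := Nat.log_lt_of_lt_pow' (by omega) h
  omega

theorem log_mainSparsity_le {n d r : ℕ} (hd : 1 ≤ d) :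
    Nat.log (2 ^ n * d) (mainSparsity n d r) ≤ 2 * d * supp r := by
  rcases Nat.lt_or_ge 1 (2 ^ n * d) with h | h
  · have h1 : mainSparsity n d r ≤ (2 ^ n * d) ^ (2 * d * supp r) :=
      Nat.pow_le_pow_left (Nat.le_mul_of_pos_right _ hd) _
    exact (Nat.log_mono_right h1).trans_eq (Nat.log_pow h _)
  · rw [Nat.log_of_left_le_one h]
    exact Nat.zero_le _

theorem mainSeed_le {n d r : ℕ} (hd : 1 ≤ d) : mainSeed n d r ≤ 2 * d * supp r + 1 :=
  Nat.succ_le_succ (log_mainSparsity_le hd)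

theorem mainSeed_le_logb {n d r : ℕ} (hn : 1 ≤ n) (hd : 1 ≤ d) :
    (mainSeed n d r : ℝ) ≤
      5 * (d * (Nat.log 2 r + 1 : ℕ) * Real.logb ((2 ^ n * d : ℕ) : ℝ) ((2 ^ n : ℕ) : ℝ)) := by
  set b := 2 ^ n * d with hb
  set l := Real.logb (b : ℝ) ((2 ^ n : ℕ) : ℝ) with hl
  have h2 : 2 ≤ 2 ^ n := Nat.le_self_pow (by omega) 2
  have hb2 : 2 ≤ b := h2.trans (Nat.le_mul_of_pos_right _ hd)
  have hb1 : (1 : ℝ) < b := by exact_mod_cast hb2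
  have hl0 : 0 ≤ l := Real.logb_nonneg hb1 (by exact_mod_cast (by omega : 1 ≤ 2 ^ n))
  have h1 : (Nat.log b (mainSparsity n d r) : ℝ) ≤ 2 * d * supp r * l := by
    refine (Real.natLog_le_logb _ _).trans_eq ?_
    rw [mainSparsity, Nat.cast_pow, Real.logb_pow]
    rw [Nat.cast_mul, Nat.cast_mul, Nat.cast_ofNat, hl]
  -- This is `2 ^ n * d ≤ (2 ^ n) ^ d` in logarithms; it lets the additive `1` in the seed length be
  -- absorbed, and `5 = 2 * 2 + 1`.
  have h3 : 1 ≤ d * l := by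
    rw [← Real.logb_pow, ← Nat.cast_pow, Real.le_logb_iff_rpow_le hb1 (by positivity), Real.rpow_one]
    obtain ⟨d, rfl⟩ := Nat.exists_eq_add_of_le hd
    have : 2 ^ n * (1 + d) ≤ (2 ^ n) ^ (1 + d) := by
      rw [pow_add, pow_one]
      refine Nat.mul_le_mul_left _ ?_
      have h4 : d + 1 ≤ 2 ^ d := Nat.lt_two_pow_self
      exact (by omega : 1 + d ≤ 2 ^ d).trans (Nat.pow_le_pow_left h2 d)
    exact_mod_cast this
  have h5 : (supp r : ℝ) ≤ 2 * (Nat.log 2 r + 1 : ℕ) := by exact_mod_cast supp_le r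
  have h6 : (1 : ℝ) ≤ (Nat.log 2 r + 1 : ℕ) := by exact_mod_cast Nat.le_add_left 1 _
  have h7 : (mainSeed n d r : ℝ) = Nat.log b (mainSparsity n d r) + 1 := by
    rw [mainSeed, ksSeed]
    push_cast
    rfl
  have h8 : d * l * supp r ≤ d * l * (2 * (Nat.log 2 r + 1 : ℕ)) := by gcongr
  have h9 : 1 * 1 ≤ d * l * (Nat.log 2 r + 1 : ℕ) := by gcongr
  rw [h7]
  linarith

theorem two_pow_clog_le {N : ℕ} (hN : 1 ≤ N) : 2 ^ Nat.clog 2 N ≤ 2 * N := by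
  rcases Nat.lt_or_ge 1 N with h | h
  · have h1 := Nat.pow_pred_clog_lt_self (b := 2) (by norm_num) h
    have h2 := Nat.clog_pos (b := 2) (by norm_num) h
    obtain ⟨m, hm⟩ : ∃ m, Nat.clog 2 N = m + 1 := ⟨_, (Nat.succ_pred_eq_of_pos h2).symm⟩
    rw [hm] at h1 ⊢
    simp only [Nat.pred_succ] at h1
    rw [pow_succ]
    omega
  · obtain rfl : N = 1 := by omega
    simp

theorem gridSize_clog_le {N : ℕ} (d : ℕ) (hN : 1 ≤ N) :
    gridSize (Nat.clog 2 N) d ≤ (N * d + 1) ^ 12 := by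
  rw [gridSize, show 12 = 2 * 6 from rfl, pow_mul]
  refine Nat.pow_le_pow_left ?_ 6
  have h := Nat.mul_le_mul_right d (two_pow_clog_le hN)
  nlinarith

/-- The constant is `11 + 4`: each of the blocks has at most `11 * (d * L)` variables, and the
Shpilka-Volkovich part has at most `4 * L`, where `L = Nat.log 2 r + 1`. -/
theorem fullVars_clog_le {N d r : ℕ} (hd : 1 ≤ d) :
    fullVars (Nat.clog 2 N) d r ≤ 15 * (d * (Nat.log 2 r + 1) * (Nat.log 2 N + 1)) := by
  have h1 := supp_le r
  have h2 := mainSeed_le (n := Nat.clog 2 N) (r := r) hd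
  have h3 : Nat.clog 2 N ≤ Nat.log 2 N + 1 :=
    Nat.clog_le_of_le_pow (Nat.lt_pow_succ_log_self (by norm_num) N).le
  rw [fullVars]
  set L := Nat.log 2 r + 1
  set l := Nat.log 2 N + 1
  have hL : 1 ≤ L := Nat.le_add_left 1 _
  have hl : 1 ≤ l := Nat.le_add_left 1 _
  have h4 : 2 * mainSeed (Nat.clog 2 N) d r + 1 ≤ 11 * (d * L) := by
    have : d * supp r ≤ d * (2 * L) := Nat.mul_le_mul_left d h1
    have : 1 * 1 ≤ d * L := Nat.mul_le_mul hd hL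
    nlinarith
  have h5 := Nat.mul_le_mul h3 h4
  have h6 : 1 * (L * 1) ≤ d * (L * l) := by gcongr
  nlinarith

theorem card_grid_le {N d r : ℕ} (hN : 1 ≤ N) (hd : 1 ≤ d) :
    gridSize (Nat.clog 2 N) d ^ fullVars (Nat.clog 2 N) d r ≤
      (N * d + 1) ^ (180 * (d * (Nat.log 2 r + 1) * (Nat.log 2 N + 1))) := by
  refine (Nat.pow_le_pow_left (gridSize_clog_le d hN) _).trans ?_
  rw [← pow_mul]
  refine Nat.pow_le_pow_right (Nat.succ_pos _) ?_
  have := fullVars_clog_le (N := N) (r := r) hd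
  linarith

/-! ### Computability of the parameters -/

/-- The logarithm counts the positive exponents whose power does not exceed `a`. The leading factor
handles bases below `2`, where `Nat.log` is `0`, and the bound `B` keeps the loop short. -/
theorem log_eq_sum (b : ℕ) {a B : ℕ} (hB : Nat.log b a ≤ B) :
    Nat.log b a = (if 2 ≤ b then 1 else 0) * ∑ i ∈ range B, if b ^ (i + 1) ≤ a then 1 else 0 := by
  split_ifs with hb
  · have h : ∀ i, b ^ (i + 1) ≤ a ↔ i < Nat.log b a := by
      intro i
      rcases Nat.eq_zero_or_pos a with rfl | ha
      · simp only [Nat.log_zero_right, Nat.not_lt_zero, iff_false, not_le]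
        positivity
      · rw [← Nat.le_log_iff_pow_le hb ha.ne', Nat.succ_le_iff]
    simp only [h, sum_boole, one_mul, Nat.cast_id]
    rw [show ({i ∈ range B | i < Nat.log b a} : Finset ℕ) = range (Nat.log b a) by
      ext i; simp only [mem_filter, mem_range]; omega, card_range]
  · rw [Nat.log_of_left_le_one (by omega), zero_mul]

theorem clog_eq_sum (N : ℕ) : Nat.clog 2 N = ∑ i ∈ range N, if N ≤ 2 ^ i then 0 else 1 := by
  have h : ∀ i, N ≤ 2 ^ i ↔ ¬ i < Nat.clog 2 N := by
    intro i
    rw [not_lt, Nat.clog_le_iff_le_pow (by norm_num)]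
  have h2 : Nat.clog 2 N ≤ N := Nat.clog_le_of_le_pow Nat.lt_two_pow_self.le
  simp only [h, ite_not, sum_boole, Nat.cast_id]
  rw [show ({i ∈ range N | i < Nat.clog 2 N} : Finset ℕ) = range (Nat.clog 2 N) by
    ext i; simp only [mem_filter, mem_range]; omega, card_range]

theorem prime_iff_prod (x : ℕ) : x.Prime ↔ 2 ≤ x ∧ 1 ≤ ∏ j ∈ range (x - 2), x % (j + 2) := by
  rw [Nat.prime_def_lt', Nat.one_le_iff_ne_zero, prod_ne_zero_iff]
  refine and_congr_right fun _ => ⟨fun h j hj hj' => ?_, fun h m hm hm' hmx => ?_⟩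
  · have := mem_range.1 hj
    exact h (j + 2) (by omega) (by omega) (Nat.dvd_of_mod_eq_zero hj')
  · refine h (m - 2) (mem_range.2 (by omega)) ?_
    rw [Nat.sub_add_cancel hm]
    exact Nat.mod_eq_zero_of_dvd hmx

/-- The product over `j` is the indicator that no prime lies in `[M, M + i]`, where `M = (N * d) ^
3`. The sum therefore measures the distance from `M` to the next prime, which is at most `M`. -/
theorem ksPrime_eq_sum {N d : ℕ} (h0 : N * d ≠ 0) :
    ksPrime N d = (N * d) ^ 3 + ∑ i ∈ range ((N * d) ^ 3), ∏ j ∈ range (i + 1),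
      (1 - (if 2 ≤ (N * d) ^ 3 + j then 1 else 0) *
        if 1 ≤ ∏ l ∈ range ((N * d) ^ 3 + j - 2), ((N * d) ^ 3 + j) % (l + 2) then 1 else 0) := by
  set M := (N * d) ^ 3
  have h1 : ∀ x, (1 - (if 2 ≤ x then 1 else 0) *
      if 1 ≤ ∏ l ∈ range (x - 2), x % (l + 2) then 1 else 0) = if x.Prime then 0 else 1 := by
    intro x
    have := prime_iff_prod x
    split_ifs <;> simp_all
  have h2 : ∀ i, (∏ j ∈ range (i + 1), if (M + j).Prime then 0 else 1) =
      if M + i < ksPrime N d then 1 else 0 := by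
    intro i
    split_ifs with h
    · refine prod_eq_one fun j hj => if_neg fun hp => ?_
      exact Nat.find_min (Nat.exists_infinite_primes M) (m := M + j)
        (lt_of_le_of_lt (Nat.add_le_add_left (Nat.lt_succ_iff.1 (mem_range.1 hj)) M) h)
        ⟨Nat.le_add_right _ _, hp⟩
    · have hle : M ≤ ksPrime N d := le_ksPrime N d
      refine prod_eq_zero (i := ksPrime N d - M) (mem_range.2 (by omega)) ?_
      rw [Nat.add_sub_cancel' hle, if_pos (ksPrime_prime N d)]
  simp only [h1, h2, sum_boole, Nat.cast_id]
  have h3 : M ≤ ksPrime N d := le_ksPrime N d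
  have h4 : ksPrime N d ≤ 2 * M := ksPrime_le h0
  rw [show ({i ∈ range M | M + i < ksPrime N d} : Finset ℕ) = range (ksPrime N d - M) by
    ext i; simp only [mem_filter, mem_range]; omega, card_range]
  omega

/-! ### Programs for the parameters -/

section
variable {α : Type} {X : α → ℕ} {Γ : Set (α → ℕ)} {f g : α → ℕ}

theorem PB.lift {n f : α → ℕ} (hf : PB X f) : PB (fun q : (x : α) × Fin (n x) => X q.1) fun q => f q.1 :=
  hf.comp Sigma.fst

theorem PB.index {n : α → ℕ} (hn : PB X n) :
    PB (fun q : (x : α) × Fin (n x) => X q.1) fun q => (q.2 : ℕ) :=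
  hn.lift.mono fun q => q.2.2.le

variable (hX : ∀ x, 2 ≤ X x)
include hX

theorem NatC.log {B : α → ℕ} (hf : NatC.{u} X Γ f) (hg : NatC.{u} X Γ g) (hB : NatC.{u} X Γ B)
    (hBX : PB X B) (h : ∀ x, Nat.log (f x) (g x) ≤ B x) : NatC.{u} X Γ fun x => Nat.log (f x) (g x) := by
  simp only [fun x => log_eq_sum (f x) (h x)]
  have hX' : ∀ q : (x : α) × Fin (B x), 2 ≤ X q.1 := fun q => hX q.1
  refine ((NatC.const hX 2).le hX hf).mul hX
    (NatC.sum hX (g := fun x i => if f x ^ (i + 1) ≤ g x then 1 else 0) hB hBX ?_)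
  exact (hf.lift.pow hX' ((NatC.index hX hBX).add hX' (NatC.const hX' 1))
    (hBX.index.add hX' (PB.const hX' 1))).le hX' hg.lift

theorem NatC.clog (hf : NatC.{u} X Γ f) (hfX : PB X f) : NatC.{u} X Γ fun x => Nat.clog 2 (f x) := by
  have hX' : ∀ q : (x : α) × Fin (f x), 2 ≤ X q.1 := fun q => hX q.1
  simp only [clog_eq_sum]
  refine NatC.sum hX (g := fun x i => if f x ≤ 2 ^ i then 0 else 1) hf hfX ?_
  have := (NatC.const hX' 1).sub hX' (hf.lift.le hX' ((NatC.const hX' 2).pow hX' (NatC.index hX hfX) hfX.index))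
  convert this using 2 with q
  split_ifs <;> rfl

/-- In the situation `x`, the parameters are `n x`, `d x`, and `r x`. -/
structure Params (X : α → ℕ) (Γ : Set (α → ℕ)) (n d r : α → ℕ) : Prop where
  natC_n : NatC.{u} X Γ n
  natC_d : NatC.{u} X Γ d
  natC_r : NatC.{u} X Γ r
  pb_n : PB X fun x => 2 ^ n x
  pb_d : PB X d
  pb_r : PB X r
  one_le_d : ∀ x, 1 ≤ d x

namespace Params
omit hX
variable {n d r : α → ℕ} (h : Params.{u} X Γ n d r)
include h

theorem lift {k : α → ℕ} : Params.{u} (fun q => X q.1) (loopCtx Γ k) (fun q => n q.1) (fun q => d q.1)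
    (fun q => r q.1) :=
  ⟨h.natC_n.lift, h.natC_d.lift, h.natC_r.lift, h.pb_n.lift, h.pb_d.lift, h.pb_r.lift,
    fun q => h.one_le_d q.1⟩

theorem pb_log : PB X n := h.pb_n.mono fun _ => Nat.lt_two_pow_self.le

include hX

theorem natC_two_pow : NatC.{u} X Γ fun x => 2 ^ n x :=
  (NatC.const hX 2).pow hX h.natC_n h.pb_log

theorem pb_supp : PB X fun x => supp (r x) :=
  ((h.pb_r.pow 2).add hX (PB.const hX 1)).mono fun _ => Nat.add_le_add_right (Nat.log_le_self _ _) 1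

theorem natC_supp : NatC.{u} X Γ fun x => supp (r x) := by
  have h1 : NatC.{u} X Γ fun x => r x ^ 2 := h.natC_r.pow hX (NatC.const hX 2) (PB.const hX 2)
  exact (NatC.log hX (NatC.const hX 2) h1 h1 (h.pb_r.pow 2) fun x => Nat.log_le_self _ _).add hX
    (NatC.const hX 1)

theorem pb_mainSeed : PB X fun x => mainSeed (n x) (d x) (r x) :=
  ((((PB.const hX 2).mul h.pb_d).mul (h.pb_supp hX)).add hX (PB.const hX 1)).mono fun x =>
    mainSeed_le (h.one_le_d x)

theorem natC_mainSeed : NatC.{u} X Γ fun x => mainSeed (n x) (d x) (r x) := by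
  have hE := ((NatC.const hX 2).mul hX h.natC_d).mul hX (h.natC_supp hX)
  have hEX := ((PB.const hX 2).mul h.pb_d).mul (h.pb_supp hX)
  -- The sparsity itself may be superpolynomial, but its bit length is polynomial, and that is all
  -- `NatC` asks for.
  have hS : NatC.{u} X Γ fun x => mainSparsity (n x) (d x) (r x) := (h.natC_two_pow hX).pow hX hE hEX
  exact (NatC.log hX ((h.natC_two_pow hX).mul hX h.natC_d) hS hE hEX
    fun x => log_mainSparsity_le (h.one_le_d x)).add hX (NatC.const hX 1)

theorem pb_ksPrime : PB X fun x => ksPrime (2 ^ n x) (d x) :=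
  ((PB.const hX 2).mul ((h.pb_n.mul h.pb_d).pow 3)).mono fun x =>
    ksPrime_le (Nat.mul_pos (by positivity) (h.one_le_d x)).ne'

theorem natC_ksPrime : NatC.{u} X Γ fun x => ksPrime (2 ^ n x) (d x) := by
  simp only [fun x => ksPrime_eq_sum (Nat.mul_pos (Nat.two_pow_pos (n x)) (h.one_le_d x)).ne']
  have hM : NatC.{u} X Γ fun x => (2 ^ n x * d x) ^ 3 :=
    ((h.natC_two_pow hX).mul hX h.natC_d).pow hX (NatC.const hX 3) (PB.const hX 3)
  have hMX : PB X fun x => (2 ^ n x * d x) ^ 3 := (h.pb_n.mul h.pb_d).pow 3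
  generalize hMdef : (fun x => (2 ^ n x * d x) ^ 3) = M at hM hMX
  simp only [fun x => show (2 ^ n x * d x) ^ 3 = M x from congr_fun hMdef x]
  refine hM.add hX (NatC.sum hX (g := fun x i => ∏ j ∈ range (i + 1), (1 - (if 2 ≤ M x + j then 1 else 0) *
    if 1 ≤ ∏ l ∈ range (M x + j - 2), (M x + j) % (l + 2) then 1 else 0)) hM hMX ?_)
  have hX₁ : ∀ q : (x : α) × Fin (M x), 2 ≤ X q.1 := fun q => hX q.1
  have hiX := hMX.index.add hX₁ (PB.const hX₁ 1)
  refine NatC.prod hX₁ (g := fun q j => 1 - (if 2 ≤ M q.1 + j then 1 else 0) *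
    if 1 ≤ ∏ l ∈ range (M q.1 + j - 2), (M q.1 + j) % (l + 2) then 1 else 0)
    ((NatC.index hX hMX).add hX₁ (NatC.const hX₁ 1)) hiX ?_
  have hX₂ : ∀ q : (q : (x : α) × Fin (M x)) × Fin (q.2 + 1), 2 ≤ X q.1.1 := fun q => hX q.1.1
  have hy := hM.lift.lift.add hX₂ (NatC.index hX₁ hiX)
  have hyX := hMX.lift.lift.add hX₂ hiX.index
  have hzX := hyX.mono fun x => Nat.sub_le _ 2
  refine (NatC.const hX₂ 1).sub hX₂ (((NatC.const hX₂ 2).le hX₂ hy).mul hX₂ ((NatC.const hX₂ 1).le hX₂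
    (NatC.prod hX₂ (g := fun q l => (M q.1.1 + q.2) % (l + 2)) (hy.sub hX₂ (NatC.const hX₂ 2)) hzX ?_)))
  have hX₃ : ∀ q : (q : (q : (x : α) × Fin (M x)) × Fin (q.2 + 1)) × Fin (M q.1.1 + q.2 - 2),
      2 ≤ X q.1.1.1 := fun q => hX _
  exact hy.lift.mod hX₃ ((NatC.index hX₂ hzX).add hX₃ (NatC.const hX₃ 2))

theorem pb_mul : PB X fun x => n x * (2 * mainSeed (n x) (d x) (r x) + 1) :=
  h.pb_log.mul (((PB.const hX 2).mul (h.pb_mainSeed hX)).add hX (PB.const hX 1))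

theorem natC_width : NatC.{u} X Γ fun x => 2 * mainSeed (n x) (d x) (r x) + 1 :=
  ((NatC.const hX 2).mul hX (h.natC_mainSeed hX)).add hX (NatC.const hX 1)

theorem pb_fullVars : PB X fun x => fullVars (n x) (d x) (r x) :=
  (h.pb_mul hX).add hX ((PB.const hX 2).mul (h.pb_supp hX))

theorem natC_gridSize : NatC.{u} X Γ fun x => gridSize (n x) (d x) :=
  (((h.natC_two_pow hX).mul hX h.natC_d).add hX (NatC.const hX 1)).pow hX (NatC.const hX 6) (PB.const hX 6)

theorem natC_fullVars : NatC.{u} X Γ fun x => fullVars (n x) (d x) (r x) :=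
  (h.natC_n.mul hX (h.natC_width hX)).add hX ((NatC.const hX 2).mul hX (h.natC_supp hX))

end Params

end
/-! ### Programs for the generators -/

/-- In every situation derived from `x`, the field elements `z x k`, `k < V x`, are computable. -/
def SeqC {α : Type} (X : α → ℕ) (Γ : Set (α → ℕ)) (R A V : α → ℕ)
    (z : ∀ (F : Type u) [Field F], (ℕ → F) → (ℕ → F) → α → ℕ → F) : Prop :=
  ∀ (β : Type) (h : β → α) (Δ : Set (β → ℕ)), (∀ g ∈ Γ, (fun y => g (h y)) ∈ Δ) → ∀ k : β → ℕ,
    NatC.{u} (fun y => X (h y)) Δ k → (∀ y, k y < V (h y)) →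
    FldC.{u} (fun y => X (h y)) Δ (fun y => R (h y)) (fun y => A (h y))
      (fun F _ ξ mem y => z F ξ mem (h y) (k y))

section
variable {α : Type} {X : α → ℕ} {Γ : Set (α → ℕ)} {R A V : α → ℕ}
  {z : ∀ (F : Type u) [Field F], (ℕ → F) → (ℕ → F) → α → ℕ → F}

theorem SeqC.lift {n : α → ℕ} (hz : SeqC.{u} X Γ R A V z) :
    SeqC.{u} (fun q => X q.1) (loopCtx Γ n) (fun q => R q.1) (fun q => A q.1) (fun q => V q.1)
      (fun F _ ξ mem q => z F ξ mem q.1) := fun β h Δ hΔ k hk hkV =>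
  hz β (fun y => (h y).1) Δ (fun g hg => hΔ _ (Or.inr ⟨g, hg, rfl⟩)) k hk hkV

theorem SeqC.get (hz : SeqC.{u} X Γ R A V z) {k : α → ℕ} (hk : NatC.{u} X Γ k) (hkV : ∀ x, k x < V x) :
    FldC.{u} X Γ R A (fun F _ ξ mem x => z F ξ mem x (k x)) :=
  hz α id Γ (fun _ hg => hg) k hk hkV

variable (hX : ∀ x, 2 ≤ X x) (hA : NatC.{u} X Γ A) (hRA : ∀ x, R x ≤ A x)
include hX hA hRA

/-- The case `l = k` is decided on the indices, by testing whether `(l - k) + (k - l)` is zero. -/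
theorem FldC.indVal {K k : α → ℕ} (hK : NatC.{u} X Γ K) (hKX : PB X K) (hk : NatC.{u} X Γ k)
    {e : ∀ (F : Type u) [Field F], (ℕ → F) → (ℕ → F) → α → F} (he : FldC.{u} X Γ R A e) :
    FldC.{u} X Γ R A (fun F _ ξ mem x => indVal ξ (K x) (k x) (e F ξ mem x)) := by
  refine FldC.prod hX hA hRA hK hKX (g := fun F _ ξ mem x l =>
    if l = k x then 1 else (ξ (k x) - ξ l)⁻¹ * (e F ξ mem x - ξ l)) ?_
  have hX' : ∀ q : (x : α) × Fin (K x), 2 ≤ X q.1 := fun q => hX q.1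
  have hRA' : ∀ q : (x : α) × Fin (K x), R q.1 ≤ A q.1 := fun q => hRA q.1
  have hl := NatC.index.{u} (Γ := Γ) hX hKX
  have := FldC.ite hX' ((hl.sub hX' hk.lift).add hX' (hk.lift.sub hX' hl))
    (FldC.one (R := fun q => R q.1) hX' hA.lift)
    (((FldC.node hX' hA.lift hk.lift).sub hX' hA.lift hRA' (FldC.node hX' hA.lift hl)).inv hX' hA.lift
      hRA' |>.mul hX' hA.lift hRA' (he.lift.sub hX' hA.lift hRA' (FldC.node hX' hA.lift hl)))
  convert this using 7 with F _ ξ mem q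
  omega

theorem FldC.svVal {N l b k : α → ℕ} (hz : SeqC.{u} X Γ R A V z) (hN : NatC.{u} X Γ N) (hNX : PB X N)
    (hl : NatC.{u} X Γ l) (hlX : PB X l) (hb : NatC.{u} X Γ b) (hk : NatC.{u} X Γ k)
    (hV : ∀ x, b x + 2 * l x ≤ V x) :
    FldC.{u} X Γ R A (fun F _ ξ mem x => svVal ξ (N x) (l x) (b x) (z F ξ mem x) (k x)) := by
  refine FldC.sum hX hA hRA hl hlX (g := fun F _ ξ mem x j =>
    PIT.indVal ξ (N x + 1) (k x + 1) (z F ξ mem x (b x + l x + j)) * z F ξ mem x (b x + j)) ?_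
  have hX' : ∀ q : (x : α) × Fin (l x), 2 ≤ X q.1 := fun q => hX q.1
  have hRA' : ∀ q : (x : α) × Fin (l x), R q.1 ≤ A q.1 := fun q => hRA q.1
  have hj := NatC.index.{u} (Γ := Γ) hX hlX
  have h1 : NatC.{u} X Γ fun _ => 1 := NatC.const hX 1
  refine (FldC.indVal hX' hA.lift hRA' (hN.add hX h1).lift (hNX.add hX (PB.const hX 1)).lift
    (hk.add hX h1).lift (hz.lift.get ((hb.add hX hl).lift.add hX' hj) fun q => ?_)).mul hX' hA.lift
    hRA' (hz.lift.get (hb.lift.add hX' hj) fun q => ?_)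
  · have := hV q.1
    have := q.2.2
    omega
  · have := hV q.1
    have := q.2.2
    omega

/-- A coordinate of the Klivans-Spielman generator. -/
theorem FldC.ksVal {m p b k : α → ℕ} (hz : SeqC.{u} X Γ R A V z) (hm : NatC.{u} X Γ m) (hmX : PB X m)
    (hp : NatC.{u} X Γ p) (hpX : PB X p) (hp0 : ∀ x, 0 < p x) (hb : NatC.{u} X Γ b) (hk : NatC.{u} X Γ k)
    (hkX : PB X k) (hV : ∀ x, b x + 2 * m x ≤ V x) :
    FldC.{u} X Γ R A (fun F _ ξ mem x => ∏ j ∈ range (m x), ∑ q ∈ range (p x),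
      PIT.indVal ξ (p x) q (z F ξ mem x (b x + m x + j)) *
        z F ξ mem x (b x + j) ^ (q ^ (k x + 1) % p x)) := by
  refine FldC.prod hX hA hRA hm hmX (g := fun F _ ξ mem x j => ∑ q ∈ range (p x),
      PIT.indVal ξ (p x) q (z F ξ mem x (b x + m x + j)) *
        z F ξ mem x (b x + j) ^ (q ^ (k x + 1) % p x)) ?_
  have hX₁ : ∀ q : (x : α) × Fin (m x), 2 ≤ X q.1 := fun q => hX q.1
  have hRA₁ : ∀ q : (x : α) × Fin (m x), R q.1 ≤ A q.1 := fun q => hRA q.1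
  have hj := NatC.index.{u} (Γ := Γ) hX hmX
  refine FldC.sum hX₁ hA.lift hRA₁ hp.lift hpX.lift (g := fun F _ ξ mem x q =>
      PIT.indVal ξ (p x.1) q (z F ξ mem x.1 (b x.1 + m x.1 + x.2)) *
        z F ξ mem x.1 (b x.1 + x.2) ^ (q ^ (k x.1 + 1) % p x.1)) ?_
  have hX₂ : ∀ q : (x : (x : α) × Fin (m x)) × Fin (p x.1), 2 ≤ X q.1.1 := fun q => hX q.1.1
  have hRA₂ : ∀ q : (x : (x : α) × Fin (m x)) × Fin (p x.1), R q.1.1 ≤ A q.1.1 := fun q => hRA q.1.1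
  have hq := NatC.index.{u} (Γ := loopCtx Γ m) hX₁ hpX.lift
  have h1 : NatC.{u} X Γ fun _ => 1 := NatC.const hX 1
  have hA₂ := hA.lift (n := m) |>.lift (n := fun x => p x.1)
  refine (FldC.indVal hX₂ hA₂ hRA₂ hp.lift.lift hpX.lift.lift hq (hz.lift.lift.get
    ((hb.add hX hm).lift.add hX₁ hj).lift fun q => ?_)).mul hX₂ hA₂ hRA₂
    (FldC.pow hX₂ hA₂ hRA₂ (hz.lift.lift.get (hb.lift.add hX₁ hj).lift fun q => ?_)
      ((hq.pow hX₂ (hk.add hX h1).lift.lift (hkX.add hX (PB.const hX 1)).lift.lift).mod hX₂ hp.lift.lift)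
      (hpX.lift.lift.mono fun q => (Nat.mod_lt _ (hp0 _)).le))
  · have := hV q.1.1
    have := q.1.2.2
    omega
  · have := hV q.1.1
    have := q.1.2.2
    omega

theorem FldC.mainVal {n d r k : α → ℕ} (hz : SeqC.{u} X Γ R A V z) (h : Params.{u} X Γ n d r)
    (hk : NatC.{u} X Γ k) (hkX : PB X k)
    (hV : ∀ x, n x * (2 * mainSeed (n x) (d x) (r x) + 1) ≤ V x) :
    FldC.{u} X Γ R A (fun F _ ξ mem x => mainVal ξ (n x) (d x) (r x) (z F ξ mem x) (k x)) := by
  refine FldC.sum hX hA hRA h.natC_n h.pb_log (g := fun F _ ξ mem x i =>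
    z F ξ mem x (i * (2 * mainSeed (n x) (d x) (r x) + 1)) *
      ∏ j ∈ range (mainSeed (n x) (d x) (r x)), ∑ q ∈ range (ksPrime (2 ^ n x) (d x)),
        PIT.indVal ξ (ksPrime (2 ^ n x) (d x)) q (z F ξ mem x
          (i * (2 * mainSeed (n x) (d x) (r x) + 1) + 1 + mainSeed (n x) (d x) (r x) + j)) *
        z F ξ mem x (i * (2 * mainSeed (n x) (d x) (r x) + 1) + 1 + j) ^
          (q ^ (k x + 1) % ksPrime (2 ^ n x) (d x))) ?_
  have hX' : ∀ q : (x : α) × Fin (n x), 2 ≤ X q.1 := fun q => hX q.1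
  have hRA' : ∀ q : (x : α) × Fin (n x), R q.1 ≤ A q.1 := fun q => hRA q.1
  have hi := NatC.index.{u} (Γ := Γ) hX h.pb_log
  have hb := hi.mul hX' (h.lift.natC_width hX')
  have hle : ∀ q : (x : α) × Fin (n x), q.2 * (2 * mainSeed (n q.1) (d q.1) (r q.1) + 1) + 1 +
      2 * mainSeed (n q.1) (d q.1) (r q.1) ≤ V q.1 := fun q => by
    refine le_trans ?_ ((Nat.mul_le_mul_right _ q.2.2).trans (hV q.1))
    rw [Nat.succ_mul (q.2 : ℕ)]
    omega
  refine FldC.mul hX' hA.lift hRA' (hz.lift.get hb fun q => ?_)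
    (FldC.ksVal hX' hA.lift hRA' hz.lift (h.natC_mainSeed hX).lift (h.pb_mainSeed hX).lift
      (h.natC_ksPrime hX).lift (h.pb_ksPrime hX).lift (fun q => (ksPrime_prime _ _).pos)
      (hb.add hX' (NatC.const hX' 1)) hk.lift hkX.lift hle)
  have := hle q
  omega

theorem FldC.fullVal {n d r k : α → ℕ} (hz : SeqC.{u} X Γ R A V z) (h : Params.{u} X Γ n d r)
    (hk : NatC.{u} X Γ k) (hkX : PB X k) (hV : ∀ x, fullVars (n x) (d x) (r x) ≤ V x) :
    FldC.{u} X Γ R A (fun F _ ξ mem x => fullVal ξ (n x) (d x) (r x) (z F ξ mem x) (k x)) :=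
  (FldC.mainVal hX hA hRA hz h hk hkX fun x => (Nat.le_add_right _ _).trans (hV x)).add hX hA hRA
    (FldC.svVal hX hA hRA hz (h.natC_two_pow hX) h.pb_n (h.natC_supp hX) (h.pb_supp hX)
      (h.natC_n.mul hX (h.natC_width hX)) hk hV)

theorem SeqC.mem (hV : ∀ x, V x ≤ R x) : SeqC.{u} X Γ R A V fun _ _ _ mem _ k => mem k :=
  fun _ h _ hΔ _ hk hkV => FldC.mem (fun y => hX (h y)) (hA.comap h hΔ) hk (fun y => hRA (h y))
    fun y => (hkV y).trans_le (hV (h y))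

omit hRA in
/-- The digits of a number. -/
theorem SeqC.digits {D I : α → ℕ} (hD : NatC.{u} X Γ D) (hI : NatC.{u} X Γ I) (hVX : PB X V) :
    SeqC.{u} X Γ R A V fun _ _ ξ _ x k => ξ (I x / D x ^ k % D x) := by
  intro β h Δ hΔ k hk hkV
  have hX' : ∀ y, 2 ≤ X (h y) := fun y => hX (h y)
  have hD' := hD.comap h hΔ
  exact FldC.node hX' (hA.comap h hΔ) (((hI.comap h hΔ).div hX' (hD'.pow hX' hk
    ((hVX.comp h).mono fun y => (hkV y).le))).mod hX' hD')

end

/-- A program for the main generator. -/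
theorem exists_mainGen_prog {α : Type} {X : α → ℕ} {Γ : Set (α → ℕ)} {n d r : α → ℕ}
    (hX : ∀ x, 2 ≤ X x) (h : Params.{u} X Γ n d r) (loc : (α → ℕ) → ℕ) (b : ℕ)
    (hb : ∀ g ∈ Γ, loc g < b) : ∃ (P : Prog) (T : α → ℕ), PB X T ∧
      ∀ (F : Type u) [Field F] (ξ : ℕ → F) (x : α) (σ : State F),
        (∀ g ∈ Γ, σ.nat (loc g) = g x) → Runs ξ P σ (T x) fun τ =>
          ∀ k < 2 ^ n x, τ.fld k = mainVal ξ (n x) (d x) (r x) σ.fld k := by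
  have hR := h.natC_n.mul hX (h.natC_width hX)
  have hX' : ∀ q : (x : α) × Fin (2 ^ n x), 2 ≤ X q.1 := fun q => hX q.1
  have hk := NatC.index.{u} (Γ := Γ) hX h.pb_n
  have hA := hR.lift.add hX' hk
  exact FldC.vector hX hR (h.natC_two_pow hX) h.pb_n (e := fun F _ ξ mem x k => mainVal ξ (n x) (d x) (r x) mem k)
    (FldC.mainVal hX' hA (fun q => Nat.le_add_right _ _)
      (SeqC.mem hX' hA (fun q => Nat.le_add_right _ _) fun q => le_rfl) h.lift hk h.pb_n.index
      fun q => le_rfl) loc b hb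

/-- A program for the points of the hitting set. -/
theorem exists_hitVal_prog {α : Type} {X : α → ℕ} {Γ : Set (α → ℕ)} {N d r I : α → ℕ}
    (hX : ∀ x, 2 ≤ X x) (hN : NatC.{u} X Γ N) (hNX : PB X N) (h : Params.{u} X Γ (fun x => Nat.clog 2 (N x)) d r)
    (hI : NatC.{u} X Γ I) (loc : (α → ℕ) → ℕ) (b : ℕ) (hb : ∀ g ∈ Γ, loc g < b) :
    ∃ (P : Prog) (T : α → ℕ), PB X T ∧
      ∀ (F : Type u) [Field F] (ξ : ℕ → F) (x : α) (σ : State F),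
        (∀ g ∈ Γ, σ.nat (loc g) = g x) → Runs ξ P σ (T x) fun τ =>
          ∀ k < N x, τ.fld k = hitVal ξ (N x) (d x) (r x) (I x) k := by
  have hR : NatC.{u} X Γ fun _ => 0 := NatC.const hX 0
  have hX' : ∀ q : (x : α) × Fin (N x), 2 ≤ X q.1 := fun q => hX q.1
  have hk := NatC.index.{u} (Γ := Γ) hX hNX
  have hA := hR.lift.add hX' hk
  exact FldC.vector hX hR hN hNX (e := fun F _ ξ _ x k => hitVal ξ (N x) (d x) (r x) (I x) k)
    (FldC.fullVal hX' hA (fun q => Nat.le_add_right _ _)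
      (SeqC.digits hX' hA (h.natC_gridSize hX).lift hI.lift (h.pb_fullVars hX).lift) h.lift hk hNX.index
      fun q => le_rfl) loc b hb

/-! ### Explicitness -/

/-- Some program computes the coordinates of the main generator in polynomial time. -/
theorem exists_prog_mainGen : ∃ (P : Prog) (c : ℕ), ∀ (F : Type u) [Field F] (ξ : ℕ → F) (n d r : ℕ),
    1 ≤ d → 1 ≤ r → ∀ w : ℕ → F, P.Outputs ξ [n, d, r] w
      (fun k : Fin (2 ^ n) => mainVal ξ n d r w k) ((2 ^ n * d * r + 1) ^ c) := by
  classical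
  let α := {t : ℕ × ℕ × ℕ // 1 ≤ t.2.1 ∧ 1 ≤ t.2.2}
  let n : α → ℕ := fun x => x.1.1
  let d : α → ℕ := fun x => x.1.2.1
  let r : α → ℕ := fun x => x.1.2.2
  let X : α → ℕ := fun x => 2 ^ n x * d x * r x + 1
  let Γ : Set (α → ℕ) := {n, d, r}
  have hd : ∀ x, 1 ≤ d x := fun x => x.2.1
  have hr : ∀ x, 1 ≤ r x := fun x => x.2.2
  have hX : ∀ x, 2 ≤ X x := fun x =>
    Nat.succ_le_succ (Nat.mul_pos (Nat.mul_pos (by positivity) (hd x)) (hr x))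
  have hnX : PB X fun x => 2 ^ n x := PB.self.mono fun x =>
    ((Nat.le_mul_of_pos_right _ (hd x)).trans (Nat.le_mul_of_pos_right _ (hr x))).trans (Nat.le_succ _)
  have hdX : PB X d := PB.self.mono fun x =>
    ((Nat.le_mul_of_pos_left _ (by positivity)).trans (Nat.le_mul_of_pos_right _ (hr x))).trans (Nat.le_succ _)
  have hrX : PB X r := PB.self.mono fun x =>
    (Nat.le_mul_of_pos_left _ (Nat.mul_pos (by positivity) (hd x))).trans (Nat.le_succ _)
  have h : Params.{u} X Γ n d r := ⟨NatC.var hX (by simp [Γ])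
    (hnX.mono fun _ => Nat.lt_two_pow_self.le).size, NatC.var hX (by simp [Γ]) hdX.size,
    NatC.var hX (by simp [Γ]) hrX.size, hnX, hdX, hrX, hd⟩
  obtain ⟨P, T, ⟨c, hT⟩, hP⟩ := exists_mainGen_prog hX h
    (fun g => if g = n then 0 else if g = d then 1 else 2) 3 (fun g _ => by split_ifs <;> norm_num)
  refine ⟨P, c, fun F _ ξ n' d' r' hd' hr' w => ?_⟩
  obtain ⟨τ, t, h1, h2, h3⟩ := hP F ξ ⟨(n', d', r'), hd', hr'⟩ ⟨fun k => [n', d', r'].getD k 0, w⟩ (by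
    intro g hg
    simp only
    split_ifs with h4 h5
    · rw [h4]; rfl
    · rw [h5]; rfl
    · rcases hg with hg | hg | hg
      · exact absurd hg h4
      · exact absurd hg h5
      · rw [hg]; rfl)
  exact ⟨τ, t, h1, h2.trans (hT _), fun k => h3 k k.2⟩

/-- Some program computes the points of the hitting set in polynomial time. -/
theorem exists_prog_hitVal : ∃ (P : Prog) (c : ℕ), ∀ (F : Type u) [Field F] (ξ : ℕ → F) (N d r I : ℕ),
    1 ≤ N → 1 ≤ d → 1 ≤ r → I < gridSize (Nat.clog 2 N) d ^ fullVars (Nat.clog 2 N) d r →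
      P.Outputs ξ [N, d, r, I] (fun _ => 0) (fun k : Fin N => hitVal ξ N d r I k)
        ((N * d * r + 1) ^ c) := by
  classical
  let α := {t : ℕ × ℕ × ℕ × ℕ // (1 ≤ t.1 ∧ 1 ≤ t.2.1 ∧ 1 ≤ t.2.2.1) ∧ t.2.2.2 <
    gridSize (Nat.clog 2 t.1) t.2.1 ^ fullVars (Nat.clog 2 t.1) t.2.1 t.2.2.1}
  let N : α → ℕ := fun x => x.1.1
  let d : α → ℕ := fun x => x.1.2.1
  let r : α → ℕ := fun x => x.1.2.2.1
  let I : α → ℕ := fun x => x.1.2.2.2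
  let X : α → ℕ := fun x => N x * d x * r x + 1
  let Γ : Set (α → ℕ) := {N, d, r, I}
  have hN : ∀ x, 1 ≤ N x := fun x => x.2.1.1
  have hd : ∀ x, 1 ≤ d x := fun x => x.2.1.2.1
  have hr : ∀ x, 1 ≤ r x := fun x => x.2.1.2.2
  have hX : ∀ x, 2 ≤ X x := fun x => Nat.succ_le_succ (Nat.mul_pos (Nat.mul_pos (hN x) (hd x)) (hr x))
  have hNX : PB X N := PB.self.mono fun x =>
    ((Nat.le_mul_of_pos_right _ (hd x)).trans (Nat.le_mul_of_pos_right _ (hr x))).trans (Nat.le_succ _)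
  have hdX : PB X d := PB.self.mono fun x =>
    ((Nat.le_mul_of_pos_left _ (hN x)).trans (Nat.le_mul_of_pos_right _ (hr x))).trans (Nat.le_succ _)
  have hrX : PB X r := PB.self.mono fun x =>
    (Nat.le_mul_of_pos_left _ (Nat.mul_pos (hN x) (hd x))).trans (Nat.le_succ _)
  have hNC : NatC.{u} X Γ N := NatC.var hX (by simp [Γ]) hNX.size
  have h : Params.{u} X Γ (fun x => Nat.clog 2 (N x)) d r := ⟨hNC.clog hX hNX,
    NatC.var hX (by simp [Γ]) hdX.size, NatC.var hX (by simp [Γ]) hrX.size,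
    ((PB.const hX 2).mul hNX).mono fun x => two_pow_clog_le (hN x), hdX, hrX, hd⟩
  have hI : NatC.{u} X Γ I := NatC.var hX (by simp [Γ]) (((h.natC_gridSize hX).pow hX
    (h.natC_fullVars hX) (h.pb_fullVars hX)).1.mono fun x => Nat.size_le_size x.2.2.le)
  obtain ⟨P, T, ⟨c, hT⟩, hP⟩ := exists_hitVal_prog hX hNC hNX h hI
    (fun g => if g = N then 0 else if g = d then 1 else if g = r then 2 else 3) 4
    (fun g _ => by split_ifs <;> norm_num)
  refine ⟨P, c, fun F _ ξ N' d' r' I' hN' hd' hr' hI' => ?_⟩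
  obtain ⟨τ, t, h1, h2, h3⟩ := hP F ξ ⟨(N', d', r', I'), ⟨hN', hd', hr'⟩, hI'⟩
    ⟨fun k => [N', d', r', I'].getD k 0, fun _ => 0⟩ (by
    intro g hg
    simp only
    split_ifs with h4 h5 h6
    · rw [h4]; rfl
    · rw [h5]; rfl
    · rw [h6]; rfl
    · rcases hg with hg | hg | hg | hg
      · exact absurd hg h4
      · exact absurd hg h5
      · exact absurd hg h6
      · rw [hg]; rfl)
  exact ⟨τ, t, h1, h2.trans (hT _), fun k => h3 k k.2⟩

/-- The case of individual degree `< 2`, with the width multiplied by a constant. -/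
theorem exists_prog_hitVal_two (e : ℕ) : ∃ (P : Prog) (c : ℕ), ∀ (F : Type u) [Field F] (ξ : ℕ → F)
    (N r I : ℕ), 1 ≤ N → 1 ≤ r → I < gridSize (Nat.clog 2 N) 2 ^ fullVars (Nat.clog 2 N) 2 (e * r) →
      P.Outputs ξ [N, r, I] (fun _ => 0) (fun k : Fin N => hitVal ξ N 2 (e * r) I k)
        ((N * r + 1) ^ c) := by
  classical
  let α := {t : ℕ × ℕ × ℕ // (1 ≤ t.1 ∧ 1 ≤ t.2.1) ∧ t.2.2 <
    gridSize (Nat.clog 2 t.1) 2 ^ fullVars (Nat.clog 2 t.1) 2 (e * t.2.1)}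
  let N : α → ℕ := fun x => x.1.1
  let r : α → ℕ := fun x => x.1.2.1
  let I : α → ℕ := fun x => x.1.2.2
  let X : α → ℕ := fun x => N x * r x + 1
  let Γ : Set (α → ℕ) := {N, r, I}
  have hN : ∀ x, 1 ≤ N x := fun x => x.2.1.1
  have hr : ∀ x, 1 ≤ r x := fun x => x.2.1.2
  have hX : ∀ x, 2 ≤ X x := fun x => Nat.succ_le_succ (Nat.mul_pos (hN x) (hr x))
  have hNX : PB X N := PB.self.mono fun x => (Nat.le_mul_of_pos_right _ (hr x)).trans (Nat.le_succ _)
  have hrX : PB X r := PB.self.mono fun x => (Nat.le_mul_of_pos_left _ (hN x)).trans (Nat.le_succ _)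
  have hNC : NatC.{u} X Γ N := NatC.var hX (by simp [Γ]) hNX.size
  have hrC : NatC.{u} X Γ r := NatC.var hX (by simp [Γ]) hrX.size
  have h : Params.{u} X Γ (fun x => Nat.clog 2 (N x)) (fun _ => 2) fun x => e * r x := ⟨hNC.clog hX hNX,
    NatC.const hX 2, (NatC.const hX e).mul hX hrC,
    ((PB.const hX 2).mul hNX).mono fun x => two_pow_clog_le (hN x), PB.const hX 2,
    (PB.const hX e).mul hrX, fun _ => by norm_num⟩
  have hI : NatC.{u} X Γ I := NatC.var hX (by simp [Γ]) (((h.natC_gridSize hX).pow hX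
    (h.natC_fullVars hX) (h.pb_fullVars hX)).1.mono fun x => Nat.size_le_size x.2.2.le)
  obtain ⟨P, T, ⟨c, hT⟩, hP⟩ := exists_hitVal_prog hX hNC hNX h hI
    (fun g => if g = N then 0 else if g = r then 1 else 2) 3 (fun g _ => by split_ifs <;> norm_num)
  refine ⟨P, c, fun F _ ξ N' r' I' hN' hr' hI' => ?_⟩
  obtain ⟨τ, t, h1, h2, h3⟩ := hP F ξ ⟨(N', r', I'), ⟨hN', hr'⟩, hI'⟩
    ⟨fun k => [N', r', I'].getD k 0, fun _ => 0⟩ (by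
    intro g hg
    simp only
    split_ifs with h4 h5
    · rw [h4]; rfl
    · rw [h5]; rfl
    · rcases hg with hg | hg | hg
      · exact absurd hg h4
      · exact absurd hg h5
      · rw [hg]; rfl)
  exact ⟨τ, t, h1, h2.trans (hT _), fun k => h3 k k.2⟩

theorem hasExplicitHittingSet {F : Type u} [Field F] {P : Prog} {ξ : ℕ → F} {input : List ℕ} {N d r : ℕ}
    {C : Set (MvPolynomial (Fin N) F)} {S T : ℕ} (hd : 1 ≤ d)
    (hξ : Set.InjOn ξ (Set.Iio (gridSize (Nat.clog 2 N) d))) (hC : C ⊆ matProdClass F N d r)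
    (hS : gridSize (Nat.clog 2 N) d ^ fullVars (Nat.clog 2 N) d r ≤ S)
    (hP : ∀ I < gridSize (Nat.clog 2 N) d ^ fullVars (Nat.clog 2 N) d r,
      P.Outputs ξ (input ++ [I]) (fun _ => 0) (fun k : Fin N => hitVal ξ N d r I k) T) :
    HasExplicitHittingSet P ξ input C S T :=
  ⟨_, _, hS, isHittingSet hd hξ hC, fun i => hP i i.2⟩

theorem Prog.Outputs.mono {F : Type u} [Field F] {P : Prog} {ξ : ℕ → F} {input : List ℕ} {w : ℕ → F} {N : ℕ}
    {out : Fin N → F} {T T' : ℕ} (h : P.Outputs ξ input w out T) (hT : T ≤ T') :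
    P.Outputs ξ input w out T' := by
  obtain ⟨τ, t, h1, h2, h3⟩ := h
  exact ⟨τ, t, h1, h2.trans hT, h3⟩

/-- The constant is `180 * 2 * 2 * 2`: one factor from the degree bound `2`, one from `Nat.log 2 (e
* r) + 1 ≤ 2 * (Nat.log 2 r + 1)`, one from `N * 2 + 1 ≤ (N + 1) ^ 2`. -/
theorem card_grid_two_le {N r e : ℕ} (hN : 1 ≤ N) (hr : 1 ≤ r) (he : e ≤ 2) :
    gridSize (Nat.clog 2 N) 2 ^ fullVars (Nat.clog 2 N) 2 (e * r) ≤
      (N + 1) ^ (1440 * ((Nat.log 2 r + 1) * (Nat.log 2 N + 1))) := by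
  refine (card_grid_le hN (by norm_num)).trans ?_
  have h1 : Nat.log 2 (e * r) ≤ Nat.log 2 r + 1 := by
    rw [← Nat.log_mul_base (by norm_num) (by omega), mul_comm r]
    exact Nat.log_mono_right (Nat.mul_le_mul_right r he)
  have h2 : N * 2 + 1 ≤ (N + 1) ^ 2 := by nlinarith
  refine (Nat.pow_le_pow_left h2 _).trans ?_
  rw [← pow_mul]
  refine Nat.pow_le_pow_right (Nat.succ_pos _) ?_
  have h3 : (Nat.log 2 (e * r) + 1) * (Nat.log 2 N + 1) ≤
      (2 * (Nat.log 2 r + 1)) * (Nat.log 2 N + 1) := Nat.mul_le_mul_right _ (by omega)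
  linarith

end PIT

/-- `c` is an absolute constant: it serves in all bounds `poly(…)` and `O(…)`. For `N, d, r ≥ 1`,
`poly(N, d)` is written `(N * d + 1) ^ c`, and `O(lg r)` is written `c * (⌊lg r⌋ + 1)`. -/
theorem theorem6p5 :
    ∃ (c : ℕ) (genProg hitProg multilinearProg setMultilinearProg : PIT.Prog),
      -- the generator, for `N = 2 ^ n`
      (∀ (F : Type u) [Field F] (n d r : ℕ), 1 ≤ d → 1 ≤ r →
        (((2 ^ n * d + 1) ^ c : ℕ) : ℕ∞) ≤ ENat.card F →
        ∀ ξ : ℕ → F, Set.InjOn ξ (Set.Iio ((2 ^ n * d + 1) ^ c)) →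
          -- the seed length
          (1 ≤ n → (PIT.mainSeed n d r : ℝ) ≤
            c * (d * (Nat.log 2 r + 1 : ℕ) * Real.logb ((2 ^ n * d : ℕ) : ℝ) ((2 ^ n : ℕ) : ℝ))) ∧
          -- the individual degrees
          (∀ k v, (PIT.mainGen ξ n d r k).degreeOf v ≤ (2 ^ n * d + 1) ^ c) ∧
          -- the explicitness
          (∀ w : ℕ → F, genProg.Outputs ξ [n, d, r] w
            (fun k => MvPolynomial.eval (fun v => w (PIT.mainPos n d r v)) (PIT.mainGen ξ n d r k))
            ((2 ^ n * d * r + 1) ^ c)) ∧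
          -- the generator property
          (∀ f ∈ PIT.roabpClass F (2 ^ n) d r,
            f ≠ 0 ↔ MvPolynomial.bind₁ (PIT.fullGen ξ n d r) f ≠ 0)) ∧
      -- the hitting set, for every `N`
      (∀ (F : Type u) [Field F] (N d r : ℕ), 1 ≤ N → 1 ≤ d → 1 ≤ r →
        (((N * d + 1) ^ c : ℕ) : ℕ∞) ≤ ENat.card F →
        ∀ ξ : ℕ → F, Set.InjOn ξ (Set.Iio ((N * d + 1) ^ c)) →
          PIT.HasExplicitHittingSet hitProg ξ [N, d, r] (PIT.roabpClass F N d r)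
            ((N * d + 1) ^ (c * (d * (Nat.log 2 r + 1) * (Nat.log 2 N + 1))))
            ((N * d * r + 1) ^ c)) ∧
      -- multilinear read-once oblivious branching programs
      (∀ (F : Type u) [Field F] (N r : ℕ), 1 ≤ N → 1 ≤ r →
        (((N + 1) ^ c : ℕ) : ℕ∞) ≤ ENat.card F →
        ∀ ξ : ℕ → F, Set.InjOn ξ (Set.Iio ((N + 1) ^ c)) →
          PIT.HasExplicitHittingSet multilinearProg ξ [N, r] (PIT.roabpClass F N 2 r)
            ((N + 1) ^ (c * ((Nat.log 2 r + 1) * (Nat.log 2 N + 1))))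
            ((N * r + 1) ^ c)) ∧
      -- set-multilinear branching programs
      (∀ (F : Type u) [Field F] (N r : ℕ), 1 ≤ N → 1 ≤ r →
        (((N + 1) ^ c : ℕ) : ℕ∞) ≤ ENat.card F →
        ∀ ξ : ℕ → F, Set.InjOn ξ (Set.Iio ((N + 1) ^ c)) →
          PIT.HasExplicitHittingSet setMultilinearProg ξ [N, r] (PIT.smabpClass F N r)
            ((N + 1) ^ (c * ((Nat.log 2 r + 1) * (Nat.log 2 N + 1))))
            ((N * r + 1) ^ c)) := by
  classical
  obtain ⟨P₁, c₁, h₁⟩ := PIT.exists_prog_mainGen.{u}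
  obtain ⟨P₂, c₂, h₂⟩ := PIT.exists_prog_hitVal.{u}
  obtain ⟨P₃, c₃, h₃⟩ := PIT.exists_prog_hitVal_two.{u} 1
  obtain ⟨P₄, c₄, h₄⟩ := PIT.exists_prog_hitVal_two.{u} 2
  -- The largest numerical constant needed is `1440`, from `card_grid_two_le`; the others come from
  -- the running times.
  obtain ⟨c, hc, hc₁, hc₂, hc₃, hc₄⟩ : ∃ c, 1440 ≤ c ∧ c₁ ≤ c ∧ c₂ ≤ c ∧ c₃ ≤ c ∧ c₄ ≤ c :=
    ⟨1440 + c₁ + c₂ + c₃ + c₄, by omega, by omega, by omega, by omega, by omega⟩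
  have hnode : ∀ N, 1 ≤ N → PIT.gridSize (Nat.clog 2 N) 2 ≤ (N + 1) ^ c := fun N hN => by
    refine (PIT.gridSize_clog_le 2 hN).trans
      ((Nat.pow_le_pow_left (by nlinarith : N * 2 + 1 ≤ (N + 1) ^ 2) 12).trans ?_)
    rw [← pow_mul]
    exact Nat.pow_le_pow_right (Nat.succ_pos _) (by omega)
  refine ⟨c, P₁, P₂, P₃, P₄, fun F _ n d r hd hr _ ξ hξ => ?_, fun F _ N d r hN hd hr _ ξ hξ => ?_,
    fun F _ N r hN hr _ ξ hξ => ?_, fun F _ N r hN hr _ ξ hξ => ?_⟩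
  · have hgrid : PIT.gridSize n d ≤ (2 ^ n * d + 1) ^ c := Nat.pow_le_pow_right (Nat.succ_pos _) (by omega)
    refine ⟨fun hn => ?_, fun k v => ?_, fun w => ?_, fun f hf => ⟨fun h => ?_, fun h h0 => h ?_⟩⟩
    · refine (PIT.mainSeed_le_logb hn hd).trans (mul_le_mul_of_nonneg_right ?_ ?_)
      · exact_mod_cast (by omega : 5 ≤ c)
      · have h1 : 1 ≤ 2 ^ n := Nat.one_le_two_pow
        have h2 : 1 ≤ 2 ^ n * d := Nat.mul_pos h1 hd
        exact mul_nonneg (by positivity) (div_nonneg (Real.log_nonneg (by exact_mod_cast h1))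
          (Real.log_nonneg (by exact_mod_cast h2)))
    · refine (PIT.degreeOf_mainGen_le ξ n d r k v).trans (le_trans ?_ hgrid)
      refine le_trans ?_ (PIT.ksPrime_lt_gridSize hd).le
      rw [← mul_assoc]
      exact le_trans (by linarith [Nat.zero_le (2 ^ n)])
        (Nat.le_mul_of_pos_left _ (Nat.mul_pos (Nat.two_pow_pos n) hd))
    · simp only [PIT.eval_mainGen]
      exact (h₁ F ξ n d r hd hr w).mono (Nat.pow_le_pow_right (Nat.succ_pos _) hc₁)
    · exact PIT.bind₁_fullGen_ne_zero hd
        (hξ.mono (Set.Iio_subset_Iio ((PIT.ksPrime_le_gridSize hd).trans hgrid)))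
        (hξ.mono (Set.Iio_subset_Iio ((PIT.two_pow_lt_gridSize hd).trans hgrid)))
        (PIT.roabpClass_subset (Nat.two_pow_pos n) hd hf) h
    · rw [h0, map_zero]
  · refine PIT.hasExplicitHittingSet hd (hξ.mono (Set.Iio_subset_Iio ((PIT.gridSize_clog_le d hN).trans
      (Nat.pow_le_pow_right (Nat.succ_pos _) (by omega))))) (PIT.roabpClass_subset hN hd)
      ((PIT.card_grid_le hN hd).trans (Nat.pow_le_pow_right (Nat.succ_pos _)
        (Nat.mul_le_mul_right _ (by omega)))) fun I hI => (h₂ F ξ N d r I hN hd hr hI).mono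
          (Nat.pow_le_pow_right (Nat.succ_pos _) hc₂)
  · have hS := PIT.card_grid_two_le (e := 1) hN hr (by norm_num)
    simp only [one_mul] at h₃ hS
    exact PIT.hasExplicitHittingSet (by norm_num) (hξ.mono (Set.Iio_subset_Iio (hnode N hN)))
      (PIT.roabpClass_subset hN (by norm_num)) (hS.trans (Nat.pow_le_pow_right (Nat.succ_pos _)
        (Nat.mul_le_mul_right _ hc))) fun I hI => (h₃ F ξ N r I hN hr hI).mono
          (Nat.pow_le_pow_right (Nat.succ_pos _) hc₃)
  · exact PIT.hasExplicitHittingSet (by norm_num) (hξ.mono (Set.Iio_subset_Iio (hnode N hN)))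
      (PIT.smabpClass_subset hN) ((PIT.card_grid_two_le hN hr le_rfl).trans
        (Nat.pow_le_pow_right (Nat.succ_pos _) (Nat.mul_le_mul_right _ hc))) fun I hI =>
          (h₄ F ξ N r I hN hr hI).mono (Nat.pow_le_pow_right (Nat.succ_pos _) hc₄)
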